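/- Let $K$ be the function field of a smooth projective complex curve $\mathcal C$, let $E/K$ be an elliptic curve with Weierstrass equation $y^2=f(x)$, $f=x^3+a_2x^2+a_4x+a_6$, $a_i\in K$, with origin $O$ the point at infinity, and let $\delta$ be a non-zero $\mathbb C$-derivation of $K$, also written $g\mapsto g'$ on elements of $K$. Extend $\delta$ to the function field $K(E)$ by $\delta x=0$, and to differentials of $K(E)/K$ by $\delta(h\,dx)=(\delta h)\,dx$; write $\delta f=a_2'x^2+a_4'x+a_6'$. Suppose that $A,B,C\in K$ and $F\in K(E)$ are such that $L=A\delta^2+B\delta+C$ satisfies $$L\left(\frac{dx}{y}\right)=dF .$$ Let $P=(x(P),y(P))\in E(K)$ be an affine point with $y(P)\neq0$. For $t$ in a suitable non-empty Zariski open subset of $\mathcal C$, the integral $\int_O^{P(t)}dx/y$ along a path from $O$ to $P(t)$ in the fibre $E_t(\mathbb C)$ has, locally in $t$, holomorphic branches obtained by letting the path vary with $t$. Applying $L$ to any of these branches (with $\delta$ acting as the corresponding meromorphic vector field on $\mathcal C$) yields one and the same function, which is the restriction of a unique element $M(P)\in K$, denoted $M(P)=L\int_O^P dx/y$. Moreover,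 $F$ is regular at $P$ and at $O$, and $$M(P)=F(P)-F(O)+A\left(\frac{x(P)'\,(-\delta f)(P)}{2\,y(P)^3}+\left(\frac{x(P)'}{y(P)}\right)'\right)+B\,\frac{x(P)'}{y(P)} .$$ -/

import Mathlib

open scoped Polynomial Topology
open Filter Set

noncomputable section

namespace ManinMap

/-! ### The algebraic side: the function field `K(E)`, the lifted derivation, exactness -/

section Algebraic

variable {K : Type*} [Field K]

/-- The coordinate function `x` in the function field `K(E)`. -/
def xFun (E : WeierstrassCurve K) : E.toAffine.FunctionField :=
  algebraMap K[X] E.toAffine.FunctionField Polynomial.X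

/-- The coordinate function `y` in the function field `K(E)`. -/
def yFun (E : WeierstrassCurve K) : E.toAffine.FunctionField :=
  algebraMap E.toAffine.CoordinateRing E.toAffine.FunctionField
    (WeierstrassCurve.Affine.CoordinateRing.mk E.toAffine Polynomial.X)

/-- Suppose the functions `u, v` generate `K(E)` and are coordinates on an affine plane model of
`E` containing the `K`-rational point `(u₀, v₀)`.  `HasValue u v u₀ v₀ F c` says that the rational
function `F` is regular at that point, with value `c` there: `F = a(u, v) / b(u, v)` for
polynomials `a, b` with `b(u₀, v₀) ≠ 0`, and `c = a(u₀, v₀) / b(u₀, v₀)`. -/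
def HasValue {E : WeierstrassCurve K} (u v : E.toAffine.FunctionField) (u₀ v₀ : K)
    (F : E.toAffine.FunctionField) (c : K) : Prop :=
  ∃ a b : MvPolynomial (Fin 2) K,
    MvPolynomial.eval ![u₀, v₀] b ≠ 0 ∧
    F * MvPolynomial.aeval ![u, v] b = MvPolynomial.aeval ![u, v] a ∧
    c = MvPolynomial.eval ![u₀, v₀] a / MvPolynomial.eval ![u₀, v₀] b

/-- `F` is regular at the affine point `(x, y)` of `E`, with value `c`. -/
def HasValueAt (E : WeierstrassCurve K) (F : E.toAffine.FunctionField) (x y c : K) : Prop :=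
  HasValue (xFun E) (yFun E) x y F c

/-- `F` is regular at the point at infinity `O` of `E`, with value `c`.  In the affine chart
`Y ≠ 0` of the projective plane, with coordinates `X / Y = x / y` and `Z / Y = 1 / y`, the point
`O = [0 : 1 : 0]` is the origin. -/
def HasValueAtO (E : WeierstrassCurve K) (F : E.toAffine.FunctionField) (c : K) : Prop :=
  HasValue (xFun E / yFun E) (1 / yFun E) 0 0 F c

/-- `K(E)` is formally étale over `K[x]` in characteristic zero. -/
theorem formallyEtale_functionField [CharZero K] (E : WeierstrassCurve K) :
    Algebra.FormallyEtale K[X] E.toAffine.FunctionField := by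
  let : Algebra (FractionRing K[X]) E.toAffine.FunctionField :=
    FractionRing.liftAlgebra K[X] E.toAffine.FunctionField
  have : IsScalarTower K[X] (FractionRing K[X]) E.toAffine.FunctionField :=
    FractionRing.isScalarTower_liftAlgebra K[X] E.toAffine.FunctionField
  have : Module.Finite K[X] E.toAffine.CoordinateRing :=
    Module.Finite.of_basis (WeierstrassCurve.Affine.CoordinateRing.basis E.toAffine)
  have : Algebra.IsAlgebraic (FractionRing K[X]) E.toAffine.FunctionField :=
    isAlgebraic_of_isFractionRing K[X] E.toAffine.CoordinateRing (FractionRing K[X]) _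
  have : Algebra.FormallyEtale K[X] (FractionRing K[X]) :=
    Algebra.FormallyEtale.of_isLocalization (nonZeroDivisors K[X])
  have : Algebra.FormallyEtale (FractionRing K[X]) E.toAffine.FunctionField :=
    Algebra.FormallyEtale.of_isSeparable _ _
  exact Algebra.FormallyEtale.comp K[X] (FractionRing K[X]) _

end Algebraic

section Lift

variable {K : Type*} [Field K] [Algebra ℂ K]

theorem existsUnique_liftDerivation (δ : Derivation ℂ K K) (E : WeierstrassCurve K) :
    ∃! D : Derivation ℂ E.toAffine.FunctionField E.toAffine.FunctionField,
      (∀ g : K, D (algebraMap K _ g) = algebraMap K _ (δ g)) ∧ D (xFun E) = 0 := by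
  have : CharZero K := charZero_of_injective_algebraMap (algebraMap ℂ K).injective
  have := formallyEtale_functionField E
  let d₀ : Derivation ℂ K[X] E.toAffine.FunctionField :=
    ((Algebra.linearMap K[X] E.toAffine.FunctionField).comp
      PolynomialModule.equivPolynomialSelf.toLinearMap).compDer δ.mapCoeffs
  let e := KaehlerDifferential.tensorKaehlerEquivOfFormallyEtale ℂ K[X] E.toAffine.FunctionField
  let D : Derivation ℂ E.toAffine.FunctionField E.toAffine.FunctionField :=
    ((LinearMap.liftBaseChange E.toAffine.FunctionField d₀.liftKaehlerDifferential).comp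
      e.symm.toLinearMap).compDer (KaehlerDifferential.D ℂ _)
  have hD : ∀ p : K[X], D (algebraMap K[X] _ p) = d₀ p := by
    intro p
    change LinearMap.liftBaseChange _ _ (e.symm (KaehlerDifferential.D ℂ _ (algebraMap K[X] _ p))) = _
    rw [KaehlerDifferential.tensorKaehlerEquivOfFormallyEtale_symm_D_algebraMap]
    simp
  have hd : ∀ p : K[X], d₀ p = algebraMap K[X] _ (PolynomialModule.equivPolynomialSelf (δ.mapCoeffs p)) :=
    fun p => rfl
  have hC : ∀ g : K, algebraMap K E.toAffine.FunctionField g = algebraMap K[X] _ (Polynomial.C g) := by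
    intro g
    rw [IsScalarTower.algebraMap_apply K K[X]]; rfl
  have hDK : ∀ g : K, D (algebraMap K _ g) = algebraMap K _ (δ g) := by
    intro g
    rw [hC, hC, hD, hd, Derivation.mapCoeffs_C]
    congr 1
  have hDx : D (xFun E) = 0 := by
    rw [xFun, hD, hd, Derivation.mapCoeffs_X]; simp
  refine ⟨D, ⟨hDK, hDx⟩, ?_⟩
  · rintro D' ⟨h1, h2⟩
    have h3 : ∀ p : K[X], D' (algebraMap K[X] _ p) = D (algebraMap K[X] _ p) := by
      intro p
      induction p using Polynomial.induction_on' with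
      | add p q hp hq => simp only [map_add, hp, hq]
      | monomial n a =>
        rw [← Polynomial.C_mul_X_pow_eq_monomial, map_mul, map_pow, ← hC]
        change D' (_ * xFun E ^ n) = D (_ * xFun E ^ n)
        simp only [Derivation.leibniz, Derivation.leibniz_pow, h1, h2, hDK, hDx]
    have h4 : D'.liftKaehlerDifferential ∘ₗ e.toLinearMap =
        D.liftKaehlerDifferential ∘ₗ e.toLinearMap := by
      apply TensorProduct.AlgebraTensorModule.curry_injective
      ext p
      simpa [e, KaehlerDifferential.tensorKaehlerEquivOfFormallyEtale_apply] using h3 p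
    ext a
    have h5 := LinearMap.congr_fun h4 (e.symm (KaehlerDifferential.D ℂ _ a))
    simpa using h5

/-- The extension of the derivation `δ` of `K` to the function field `K(E)` with `δ x = 0`. -/
def liftDerivation (δ : Derivation ℂ K K) (E : WeierstrassCurve K) :
    Derivation ℂ E.toAffine.FunctionField E.toAffine.FunctionField :=
  (existsUnique_liftDerivation δ E).choose

/-- The function `L(h) = A δ²h + B δh + C h` on `K(E)`, for the operator `L = A δ² + B δ + C`. -/
def applyL (δ : Derivation ℂ K K) (E : WeierstrassCurve K) (A B C : K)
    (h : E.toAffine.FunctionField) : E.toAffine.FunctionField :=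
  A • liftDerivation δ E (liftDerivation δ E h) + B • liftDerivation δ E h + C • h

/-- `L(dx/y) = dF` in the Kähler differentials of `K(E)` over `K`.  The operator `δ` acts on
differentials by `δ(h dx) = (δh) dx`, so that `L(dx/y) = L(1/y) dx`. -/
def IsExactWith (δ : Derivation ℂ K K) (E : WeierstrassCurve K) (A B C : K)
    (F : E.toAffine.FunctionField) : Prop :=
  applyL δ E A B C (1 / yFun E) • KaehlerDifferential.D K E.toAffine.FunctionField (xFun E) =
    KaehlerDifferential.D K E.toAffine.FunctionField F

/-- `(δf)(x)` for the cubic `f = x³ + a₂ x² + a₄ x + a₆`, where `δ` acts on the coefficients. -/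
def deltaCubic (δ : Derivation ℂ K K) (E : WeierstrassCurve K) (x : K) : K :=
  δ E.a₂ * x ^ 2 + δ E.a₄ * x + δ E.a₆

end Lift

/-! ### The analytic side: elliptic integrals in the fibres -/

/-- A germ at `0 ∈ ℂ` of a nonconstant holomorphic map to the compact Riemann surface with function
field `K`, given by pulling back rational functions to germs of meromorphic functions: a
homomorphism of `ℂ`-algebras `g ↦ ev g` from `K` to the germs of meromorphic functions at `0`.
For example, a local holomorphic parametrization of the curve around any of its points.  (The map
is nonconstant, because the homomorphism is injective, `K` being a field.) -/
structure Arc (K : Type*) [Field K] [Algebra ℂ K] where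
  /-- `ev g z` is the value of the rational function `g` at the point with parameter `z`. -/
  ev : K → ℂ → ℂ
  meromorphic : ∀ g, MeromorphicAt (ev g) 0
  const : ∀ c : ℂ, ∀ᶠ z in 𝓝[≠] (0 : ℂ), ev (algebraMap ℂ K c) z = c
  add : ∀ g h, ∀ᶠ z in 𝓝[≠] (0 : ℂ), ev (g + h) z = ev g z + ev h z
  mul : ∀ g h, ∀ᶠ z in 𝓝[≠] (0 : ℂ), ev (g * h) z = ev g z * ev h z

/-- A path in the complex curve `W : y² = x³ + a₂ x² + a₄ x + a₆` from `O` to the affine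
point `(x, y)`.  It starts at `O` at time `0`, i.e. its `x`-coordinate tends to infinity there; for
times in `(0, 1]` it is a `C¹` path in the affine curve, and it avoids the points with `y = 0`.
(Every path from `O` to `(x, y)`, `y ≠ 0`, is homotopic to one of this kind.) -/
structure IsFibrePath (W : WeierstrassCurve ℂ) (x y : ℂ) (X Y : ℝ → ℂ) : Prop where
  contDiff_X : ContDiffOn ℝ 1 X (Ioc 0 1)
  contDiff_Y : ContDiffOn ℝ 1 Y (Ioc 0 1)
  equation : ∀ s ∈ Ioc (0 : ℝ) 1, W.toAffine.Equation (X s) (Y s)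
  ne_zero : ∀ s ∈ Ioc (0 : ℝ) 1, Y s ≠ 0
  start : Tendsto X (𝓝[>] 0) (Bornology.cobounded ℂ)
  end_X : X 1 = x
  end_Y : Y 1 = y

/-- `w` is the value of the integral of `dx/y` along the path `(X, Y)` on `(0, 1]`. -/
def IsPathIntegral (X Y : ℝ → ℂ) (w : ℂ) : Prop :=
  Tendsto (fun ε : ℝ => ∫ s in ε..1, deriv X s / Y s) (𝓝[>] 0) (𝓝 w)

section Analytic

variable {K : Type*} [Field K] [Algebra ℂ K]

/-- The fibre of `E` over the point of the arc with parameter `z`. -/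
def Arc.fibre (φ : Arc K) (E : WeierstrassCurve K) (z : ℂ) : WeierstrassCurve ℂ :=
  ⟨φ.ev E.a₁ z, φ.ev E.a₂ z, φ.ev E.a₃ z, φ.ev E.a₄ z, φ.ev E.a₆ z⟩

/-- A holomorphically varying family, for `z` in `V`, of paths from `O` to `P(z)` in the fibres of
`E`, where `P = (x, y)`. -/
structure IsPathFamily (φ : Arc K) (E : WeierstrassCurve K) (x y : K) (V : Set ℂ)
    (X Y : ℂ → ℝ → ℂ) : Prop where
  path : ∀ z ∈ V, IsFibrePath (φ.fibre E z) (φ.ev x z) (φ.ev y z) (X z) (Y z)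
  contDiff_X : ContDiffOn ℝ 1 (Function.uncurry X) (V ×ˢ Ioc 0 1)
  contDiff_Y : ContDiffOn ℝ 1 (Function.uncurry Y) (V ×ˢ Ioc 0 1)
  holomorphic_X : ∀ s ∈ Ioc (0 : ℝ) 1, DifferentiableOn ℂ (fun z => X z s) V
  holomorphic_Y : ∀ s ∈ Ioc (0 : ℝ) 1, DifferentiableOn ℂ (fun z => Y z s) V
  start : ∀ z ∈ V, Tendsto (Function.uncurry X) (𝓝 z ×ˢ 𝓝[>] 0) (Bornology.cobounded ℂ)

/-- Near the parameter `z₁`, the function `w` is the branch of `∫_O^P dx/y` obtained by integrating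
along the family of paths `(X, Y)`. -/
def IsBranch (φ : Arc K) (E : WeierstrassCurve K) (x y : K) (z₁ : ℂ) (X Y : ℂ → ℝ → ℂ)
    (w : ℂ → ℂ) : Prop :=
  ∃ V : Set ℂ, IsOpen V ∧ z₁ ∈ V ∧ IsPathFamily φ E x y V X Y ∧
    ∀ z ∈ V, IsPathIntegral (X z) (Y z) (w z)

/-- The vector field `v d/dz` represents the derivation `δ` of `K` along the arc. -/
def Arc.Represents (φ : Arc K) (δ : Derivation ℂ K K) (v : ℂ → ℂ) : Prop :=
  MeromorphicAt v 0 ∧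
    ∀ g : K, ∀ᶠ z in 𝓝[≠] (0 : ℂ), φ.ev (δ g) z = v z * deriv (φ.ev g) z

/-- `L w = A δ²w + B δw + C w` for a function `w` of the parameter of the arc, where `δ` acts as
the vector field `v d/dz`. -/
def Arc.applyL (φ : Arc K) (v : ℂ → ℂ) (A B C : K) (w : ℂ → ℂ) (z : ℂ) : ℂ :=
  φ.ev A z * (v z * deriv (fun ζ => v ζ * deriv w ζ) z) +
    φ.ev B z * (v z * deriv w z) + φ.ev C z * w z

/-- `m ∈ K` is the value `M(P) = L ∫_O^P dx/y` of the Manin map at `P = (x, y)`: along every arc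
in the base curve, at all parameters `z₁ ≠ 0` close enough to `0`,
* there are paths from `O` to `P(z₁)` in the fibre;
* every such path extends to a branch of the multivalued function `∫_O^P dx/y` near `z₁`;
* for every branch `w` of it, `L w` and `m` have the same value at `z₁`. -/
def IsManinValue (δ : Derivation ℂ K K) (E : WeierstrassCurve K) (A B C : K) (x y m : K) : Prop :=
  ∀ φ : Arc K, ∃ v : ℂ → ℂ, φ.Represents δ v ∧ ∀ᶠ z₁ in 𝓝[≠] (0 : ℂ),
    (∃ X₀ Y₀ : ℝ → ℂ, IsFibrePath (φ.fibre E z₁) (φ.ev x z₁) (φ.ev y z₁) X₀ Y₀) ∧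
    (∀ X₀ Y₀ : ℝ → ℂ, IsFibrePath (φ.fibre E z₁) (φ.ev x z₁) (φ.ev y z₁) X₀ Y₀ →
      ∃ X Y w, IsBranch φ E x y z₁ X Y w ∧
        EqOn (X z₁) X₀ (Ioc 0 1) ∧ EqOn (Y z₁) Y₀ (Ioc 0 1)) ∧
    ∀ X Y w, IsBranch φ E x y z₁ X Y w → φ.applyL v A B C w z₁ = φ.ev m z₁

end Analytic

end ManinMap

end

/-! Write `f` for the cubic. Since `δx = 0`, the relation `y² = f` gives `δ(1/y) = -δf/(2y³)`, hence
`L(1/y) = R(x)/y⁵` with `deg R ≤ 6` (`applyL_one_div_yFun`). The hypothesis therefore reads `dF/dx =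
R/y⁵`, which is odd in `y`. So the even part of `F` is a constant `α`, and the odd part is `S/y³`
with `S` rational in `x` and `2fS' - 3f'S = 2R`. Comparing orders at a pole rules out poles of `S`,
because `f` is squarefree (`isUnit_denominator`), and comparing leading terms gives `deg S ≤ 4`
(`natDegree_le_four`). Thus `F = α + S(x)/y³` (`exists_primitive_shape`); it is regular at `P`, has
the value `α` at `O`, and `F(P) - F(O) = S(x(P))/y(P)³`.

On the analytic side let `(X, Y)(z, s)`, `0 < s ≤ 1`, be paths from `O` to `P(z)`, and let `δ = v
∂/∂z`. Differentiating the moving integrand differs from differentiating at fixed `x` by an exact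
term: `δ(X_s/Y) = -δf(X) X_s/(2Y³) + ∂_s(δX/Y)` (`deriv_deltaXDivY_eq`). Doing this twice, and using
`S` for the part at fixed `x`, produces a function `boundary` with `∂_s boundary = L(X_s/Y)`
(`hasDerivWithinAt_boundary`). For `T(z, s) = ∫_s^1 X_s/Y` the sum `L T + boundary` does not depend
on `s`. At `s = 1` the function `T` vanishes for all `z`, so only `boundary` remains; as `s → 0`,
`boundary → 0` and `L T → L w`. Hence `L w` is the boundary term at `P`, which is the stated formula
(`applyL_eq_boundary`).

The limits at `O` need control of `z`-derivatives, while the paths are only assumed to satisfy `X →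
∞` locally uniformly in `z`. Weierstrass' theorem on locally uniform limits of holomorphic functions
(`differentiableOn_and_tendsto_dz_sub`) supplies it, once `X/Y → 0` and `T → w` are known locally
uniformly. The latter comes from an explicit primitive of `dx/y` near `O`, bounded by `12 |x/y|`
(`tail_integral`).

Finally, `IsManinValue` must be satisfiable and must determine `m`. Every derivation is a vector
field along every arc (`Arc.exists_represents`), fibres contain paths (`exists_isFibrePath`), and
these extend to nearby fibres (`IsGoodSet.exists_isPathFamily`). At least one arc exists
(`nonempty_arc`), and an element of `K` is determined by its germ along it. -/

noncomputable section

namespace ManinMap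

/-! ### The function field as a quadratic extension of `K(x)` -/

section FunctionField

variable {K : Type*} [Field K] (E : WeierstrassCurve K)

/-- The cubic `f = x³ + a₂ x² + a₄ x + a₆`. -/
def cubic : K[X] :=
  .X ^ 3 + .C E.a₂ * .X ^ 2 + .C E.a₄ * .X + .C E.a₆

theorem yFun_sq [E.IsCharNeTwoNF] :
    yFun E ^ 2 = algebraMap K[X] E.toAffine.FunctionField (cubic E) := by
  have h : WeierstrassCurve.Affine.CoordinateRing.mk E.toAffine Polynomial.X ^ 2 =
      algebraMap K[X] E.toAffine.CoordinateRing (cubic E) := by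
    change _ = WeierstrassCurve.Affine.CoordinateRing.mk E.toAffine (Polynomial.C (cubic E))
    rw [← map_pow]
    refine AdjoinRoot.mk_eq_mk.mpr ⟨1, ?_⟩
    simp [WeierstrassCurve.Affine.polynomial, cubic]
  rw [yFun, ← map_pow, h, ← IsScalarTower.algebraMap_apply]

theorem algebraMap_functionField_injective :
    Function.Injective (algebraMap K[X] E.toAffine.FunctionField) := by
  rw [IsScalarTower.algebraMap_eq K[X] E.toAffine.CoordinateRing]
  exact (IsFractionRing.injective E.toAffine.CoordinateRing E.toAffine.FunctionField).comp
    (FaithfulSMul.algebraMap_injective K[X] E.toAffine.CoordinateRing)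

theorem algebraMap_eq_C (g : K) : algebraMap K E.toAffine.FunctionField g =
    algebraMap K[X] E.toAffine.FunctionField (.C g) := by
  rw [IsScalarTower.algebraMap_apply K K[X]]; rfl

theorem algebraMap_X : algebraMap K[X] E.toAffine.FunctionField .X = xFun E := rfl

theorem monic_cubic : (cubic E).Monic := by unfold cubic; monicity!

theorem natDegree_cubic : (cubic E).natDegree = 3 := by unfold cubic; compute_degree!

theorem cubic_ne_zero : cubic E ≠ 0 := (monic_cubic E).ne_zero

theorem yFun_ne_zero [E.IsCharNeTwoNF] : yFun E ≠ 0 := by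
  intro h
  have := yFun_sq E
  rw [h, zero_pow two_ne_zero, eq_comm, map_eq_zero_iff _ (algebraMap_functionField_injective E)]
    at this
  exact cubic_ne_zero E this

theorem algebraMap_smul_basis (p q : K[X]) :
    algebraMap E.toAffine.CoordinateRing E.toAffine.FunctionField
      (p • 1 + q • WeierstrassCurve.Affine.CoordinateRing.mk E.toAffine Polynomial.X) =
    algebraMap K[X] _ p + algebraMap K[X] _ q * yFun E := by
  rw [map_add, Algebra.smul_def, Algebra.smul_def, map_mul, map_mul, map_one, mul_one,
    ← IsScalarTower.algebraMap_apply, ← IsScalarTower.algebraMap_apply]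
  rfl

/-- The coordinate ring is free over `K[x]` on `1, y`, so identities in `K(E)` split into parts even
and odd in `y`. -/
theorem eq_zero_of_add_mul_yFun {p q : K[X]}
    (h : algebraMap K[X] E.toAffine.FunctionField p +
      algebraMap K[X] E.toAffine.FunctionField q * yFun E = 0) : p = 0 ∧ q = 0 := by
  rw [← algebraMap_smul_basis, map_eq_zero_iff _ (IsFractionRing.injective _ _)] at h
  exact WeierstrassCurve.Affine.CoordinateRing.smul_basis_eq_zero h

/-- Every rational function on `E` is `(p(x) + q(x) y) / d(x)` for polynomials `p, q, d`. -/
theorem exists_mul_eq_add_mul_yFun [E.IsCharNeTwoNF] (F : E.toAffine.FunctionField) :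
    ∃ p q d : K[X], d ≠ 0 ∧ F * algebraMap K[X] _ d =
      algebraMap K[X] _ p + algebraMap K[X] _ q * yFun E := by
  obtain ⟨a, b, hb, rfl⟩ := IsFractionRing.div_surjective (A := E.toAffine.CoordinateRing) F
  obtain ⟨p, q, rfl⟩ := WeierstrassCurve.Affine.CoordinateRing.exists_smul_basis_eq a
  obtain ⟨r, s, rfl⟩ := WeierstrassCurve.Affine.CoordinateRing.exists_smul_basis_eq b
  have hb0 := nonZeroDivisors.ne_zero hb
  have hb1 : algebraMap K[X] E.toAffine.FunctionField r +
      algebraMap K[X] E.toAffine.FunctionField s * yFun E ≠ 0 := by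
    rw [← algebraMap_smul_basis, Ne, map_eq_zero_iff _ (IsFractionRing.injective _ _)]
    exact hb0
  -- The denominator `r + s y` is rationalized with its conjugate `r - s y`, which must be non-zero
  -- as well.
  have hc : algebraMap K[X] E.toAffine.FunctionField r -
      algebraMap K[X] E.toAffine.FunctionField s * yFun E ≠ 0 := by
    intro h
    have := eq_zero_of_add_mul_yFun E (p := r) (q := -s) (by rw [map_neg, neg_mul, ← sub_eq_add_neg, h])
    apply hb1
    simp [this.1, neg_eq_zero.mp this.2]
  have hy := yFun_sq E
  have key : (algebraMap K[X] E.toAffine.FunctionField r +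
      algebraMap K[X] E.toAffine.FunctionField s * yFun E) * (algebraMap K[X] E.toAffine.FunctionField r -
      algebraMap K[X] E.toAffine.FunctionField s * yFun E) =
      algebraMap K[X] E.toAffine.FunctionField (r ^ 2 - s ^ 2 * cubic E) := by
    rw [map_sub, map_mul, map_pow, map_pow, ← hy]; ring
  refine ⟨p * r - q * s * cubic E, q * r - p * s, r ^ 2 - s ^ 2 * cubic E, ?_, ?_⟩
  · intro h
    rw [h, map_zero] at key
    exact mul_ne_zero hb1 hc key
  · rw [algebraMap_smul_basis, algebraMap_smul_basis, ← key,
      div_mul_eq_mul_div, div_eq_iff hb1]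
    simp only [map_sub, map_mul, ← hy]
    ring

/-- The derivation `d/dx` of the function field `K(E)` over `K`. -/
theorem exists_derivation_xFun [CharZero K] :
    ∃ D : Derivation K E.toAffine.FunctionField E.toAffine.FunctionField, D (xFun E) = 1 := by
  have := formallyEtale_functionField E
  -- As `K(E)` is formally étale over `K[x]`, its differentials are the base change of those of
  -- `K[x]`, so `d/dx` extends from polynomials.
  let d₀ : Derivation K K[X] E.toAffine.FunctionField :=
    (Algebra.linearMap K[X] E.toAffine.FunctionField).compDer Polynomial.derivative'
  let e := KaehlerDifferential.tensorKaehlerEquivOfFormallyEtale K K[X] E.toAffine.FunctionField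
  refine ⟨((LinearMap.liftBaseChange E.toAffine.FunctionField d₀.liftKaehlerDifferential).comp
      e.symm.toLinearMap).compDer (KaehlerDifferential.D K _), ?_⟩
  change LinearMap.liftBaseChange _ _
    (e.symm (KaehlerDifferential.D K _ (algebraMap K[X] _ Polynomial.X))) = _
  rw [KaehlerDifferential.tensorKaehlerEquivOfFormallyEtale_symm_D_algebraMap]
  simp [d₀]

theorem derivation_algebraMap
    {D : Derivation K E.toAffine.FunctionField E.toAffine.FunctionField} (hD : D (xFun E) = 1)
    (p : K[X]) : D (algebraMap K[X] _ p) = algebraMap K[X] _ (Polynomial.derivative p) := by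
  induction p using Polynomial.induction_on' with
  | add p q hp hq => simp only [map_add, hp, hq]
  | monomial n a =>
    rw [← Polynomial.C_mul_X_pow_eq_monomial, map_mul, map_pow, ← algebraMap_eq_C, algebraMap_X,
      Polynomial.derivative_C_mul_X_pow]
    simp only [Derivation.leibniz, Derivation.leibniz_pow, hD, Derivation.map_algebraMap, map_mul,
      map_pow, map_natCast, algebraMap_X, ← algebraMap_eq_C, smul_eq_mul, nsmul_eq_mul]
    ring

theorem derivation_yFun [E.IsCharNeTwoNF]
    {D : Derivation K E.toAffine.FunctionField E.toAffine.FunctionField} (hD : D (xFun E) = 1) :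
    2 * yFun E * D (yFun E) = algebraMap K[X] _ (Polynomial.derivative (cubic E)) := by
  rw [← derivation_algebraMap E hD, ← yFun_sq, Derivation.leibniz_pow]
  simp
  ring

end FunctionField

/-! ### Polynomial lemmas: Wronskian, squarefree cubic, the equation `2fS' - 3f'S = 2R` -/

section Polynomials

variable {K : Type*} [Field K]

/-- The hypothesis says `(p/d)' = 0`. After division by the gcd, a vanishing Wronskian of coprime
polynomials forces both derivatives to vanish, so in characteristic zero both are constants. -/
theorem exists_eq_C_mul_of_wronskian_eq_zero [CharZero K] {p d : K[X]} (hd : d ≠ 0)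
    (h : p * Polynomial.derivative d = d * Polynomial.derivative p) : ∃ α : K, p = .C α * d := by
  classical
  obtain ⟨g, p', d', rfl, rfl, hg, hco⟩ : ∃ g p' d' : K[X], p = g * p' ∧ d = g * d' ∧ g ≠ 0 ∧
      IsCoprime p' d' := by
    refine ⟨gcd p d, p / gcd p d, d / gcd p d, ?_, ?_, ?_, isCoprime_div_gcd_div_gcd hd⟩
    · exact (EuclideanDomain.mul_div_cancel' (gcd_ne_zero_of_right hd) (gcd_dvd_left p d)).symm
    · exact (EuclideanDomain.mul_div_cancel' (gcd_ne_zero_of_right hd) (gcd_dvd_right p d)).symm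
    · exact gcd_ne_zero_of_right hd
  have hw : Polynomial.wronskian p' d' = 0 := by
    simp only [Polynomial.derivative_mul] at h
    have : g ^ 2 * Polynomial.wronskian p' d' = 0 := by
      rw [Polynomial.wronskian]; linear_combination h
    simpa [hg] using this
  obtain ⟨h1, h2⟩ := hco.wronskian_eq_zero_iff.mp hw
  rw [Polynomial.eq_C_of_derivative_eq_zero h1, Polynomial.eq_C_of_derivative_eq_zero h2]
  rw [Polynomial.eq_C_of_derivative_eq_zero h2] at hd
  have h3 : d'.coeff 0 ≠ 0 := by
    intro h; simp [h] at hd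
  refine ⟨p'.coeff 0 / d'.coeff 0, ?_⟩
  rw [mul_left_comm, ← map_mul, div_mul_cancel₀ _ h3]

theorem isCoprime_cubic_derivative [CharZero K] (E : WeierstrassCurve K) [E.IsElliptic]
    [E.IsCharNeTwoNF] : IsCoprime (cubic E) (Polynomial.derivative (cubic E)) := by
  have hΔ : E.Δ ≠ 0 := E.isUnit_Δ.ne_zero
  set a := (Polynomial.C E.a₂ : K[X]) with ha
  set b := (Polynomial.C E.a₄ : K[X]) with hb
  set c := (Polynomial.C E.a₆ : K[X]) with hc
  -- Euclid's algorithm for `f` and `f'`: `9f = (3x + a) f' + (m x + n)`, and `m² f' = (3m x + 2am -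
  -- 3n)(m x + n) + c` with `16 c = -9Δ`. Back substitution gives the Bézout coefficients below.
  set m := 6 * b - 2 * a ^ 2 with hm
  set n := 9 * c - a * b with hn
  have hu : (Polynomial.C (-9 * E.Δ) : K[X]) * Polynomial.C (-9 * E.Δ)⁻¹ = 1 := by
    rw [← map_mul, mul_inv_cancel₀ (by simpa using hΔ), map_one]
  have hΔ' : (Polynomial.C (-9 * E.Δ) : K[X]) = -9 * (-64 * a ^ 3 * c + 16 * a ^ 2 * b ^ 2 -
      64 * b ^ 3 - 432 * c ^ 2 + 288 * a * b * c) := by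
    rw [WeierstrassCurve.Δ_of_isCharNeTwoNF, ha, hb, hc]
    simp only [map_mul, map_add, map_sub, map_neg, map_pow, map_ofNat]
  have hf : cubic E = .X ^ 3 + a * .X ^ 2 + b * .X + c := rfl
  have hf' : Polynomial.derivative (cubic E) = 3 * .X ^ 2 + 2 * a * .X + b := by
    rw [hf, ha, hb, hc]
    simp only [Polynomial.derivative_add, Polynomial.derivative_X_pow, Polynomial.derivative_C_mul,
      Polynomial.derivative_C, Polynomial.derivative_X, Nat.cast_ofNat, map_ofNat]
    ring
  refine ⟨-16 * 9 * (3 * m * .X + 2 * a * m - 3 * n) * Polynomial.C (-9 * E.Δ)⁻¹,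
    16 * (m ^ 2 + (3 * m * .X + 2 * a * m - 3 * n) * (3 * .X + a)) * Polynomial.C (-9 * E.Δ)⁻¹, ?_⟩
  rw [← hu, hΔ', hf', hf, hm, hn]
  ring

/-- A rational solution `N / D` of the differential equation `2 f S' - 3 f' S = 2 R`, where `f` is
squarefree, is a polynomial. -/
theorem isUnit_denominator [CharZero K] {f N D R : K[X]} (hD : D ≠ 0) (hND : IsCoprime N D)
    (hf : IsCoprime f (Polynomial.derivative f))
    (h : 2 * R * D ^ 2 + 3 * Polynomial.derivative f * N * D + 2 * f * N * Polynomial.derivative D =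
      2 * f * Polynomial.derivative N * D) : IsUnit D := by
  by_contra hu
  obtain ⟨π, hπ, hπD⟩ := WfDvdMonoid.exists_irreducible_factor hu hD
  have hp : Prime π := hπ.prime
  obtain ⟨k, D₁, hD₁, rfl⟩ : ∃ k D₁, ¬ π ∣ D₁ ∧ D = π ^ k * D₁ := by
    obtain ⟨k, D₁, h1, h2⟩ := WfDvdMonoid.max_power_factor hD hπ
    exact ⟨k, D₁, h1, h2⟩
  obtain ⟨k, rfl⟩ : ∃ j, k = j + 1 := by
    refine Nat.exists_eq_succ_of_ne_zero ?_
    rintro rfl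
    simp [hD₁] at hπD
  have hN : ¬ π ∣ N := fun hh => hπ.not_isUnit (hND.isUnit_of_dvd' hh hπD)
  have hπ' : ¬ π ∣ Polynomial.derivative π :=
    fun hh => hπ.not_isUnit (IsCoprime.isUnit_of_dvd' (Irreducible.separable hπ) dvd_rfl hh)
  have hconst : ∀ m : ℕ, m ≠ 0 → ¬ π ∣ (m : K[X]) := by
    intro m hm hh
    refine hπ.not_isUnit (isUnit_of_dvd_unit hh ?_)
    rw [← map_natCast (Polynomial.C : K →+* K[X])]
    exact Polynomial.isUnit_C.mpr (isUnit_iff_ne_zero.mpr (by exact_mod_cast hm))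
  have h0 : (π ^ k) ≠ 0 := pow_ne_zero _ hπ.ne_zero
  have h1 : 2 * R * π ^ (k + 2) * D₁ ^ 2 + 3 * Polynomial.derivative f * N * π * D₁ +
      2 * f * N * ((k + 1) * Polynomial.derivative π * D₁ + π * Polynomial.derivative D₁) =
      2 * f * Polynomial.derivative N * π * D₁ := by
    apply mul_left_cancel₀ h0
    simp only [Polynomial.derivative_mul, Polynomial.derivative_pow_succ, map_add, map_natCast,
      map_one] at h
    linear_combination h
  -- `π` divides `D` exactly `k + 1` times, so `D'` contributes the only term not divisible by `π`,
  -- unless `π ∣ f`.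
  have h2 : π ∣ ((2 * (k + 1) : ℕ) : K[X]) * f * N * Polynomial.derivative π * D₁ := by
    refine ⟨2 * f * Polynomial.derivative N * D₁ - 2 * R * π ^ (k + 1) * D₁ ^ 2 -
      3 * Polynomial.derivative f * N * D₁ - 2 * f * N * Polynomial.derivative D₁, ?_⟩
    push_cast
    linear_combination h1
  have h3 : π ∣ f := by
    have := hconst (2 * (k + 1)) (by positivity)
    simpa only [hp.dvd_mul, hN, hπ', hD₁, this, or_false, false_or] using h2
  have hnf' : ¬ π ∣ Polynomial.derivative f := fun hh => hπ.not_isUnit (hf.isUnit_of_dvd' h3 hh)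
  obtain ⟨f₁, rfl⟩ := h3
  rw [Polynomial.derivative_mul] at h1 hnf'
  have hf₁ : ¬ π ∣ f₁ := fun hh => hnf' ((hh.mul_left _).add (dvd_mul_right _ _))
  -- With `f = π f₁`, the lowest-order terms come from both `3f'ND` and `2fND'`; their coefficients
  -- add up to `3 + 2(k + 1) = 2k + 5`, which is not zero.
  have h4 : π ∣ ((2 * k + 5 : ℕ) : K[X]) * f₁ * N * Polynomial.derivative π * D₁ := by
    refine ⟨2 * f₁ * Polynomial.derivative N * D₁ - 2 * R * π ^ k * D₁ ^ 2 -
      3 * Polynomial.derivative f₁ * N * D₁ - 2 * f₁ * N * Polynomial.derivative D₁, ?_⟩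
    apply mul_left_cancel₀ hπ.ne_zero
    push_cast
    linear_combination h1
  have : ¬ π ∣ ((2 * k + 5 : ℕ) : K[X]) := hconst _ (by positivity)
  have h5 : ¬ π ∣ ((2 * k + 5 : ℕ) : K[X]) * f₁ * N * Polynomial.derivative π * D₁ := by
    simp only [hp.dvd_mul, not_or]
    exact ⟨⟨⟨⟨this, hf₁⟩, hN⟩, hπ'⟩, hD₁⟩
  exact h5 h4

/-- If `deg S = n + 5`, the coefficient of degree `n + 7 > 6` on the left is `2(n + 5) - 9 = 2n + 1`
times the leading coefficient of `S`. An odd integer is non-zero in `K`, so no cancellation occurs.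
-/
theorem natDegree_le_four [CharZero K] {f S R : K[X]} (hf : f.Monic) (hf3 : f.natDegree = 3)
    (hR : R.natDegree ≤ 6)
    (h : 2 * f * Polynomial.derivative S - 3 * Polynomial.derivative f * S = 2 * R) :
    S.natDegree ≤ 4 := by
  by_contra! hn
  obtain ⟨n, hn'⟩ : ∃ n, S.natDegree = n + 5 := ⟨S.natDegree - 5, by omega⟩
  have hS : S.coeff (n + 5) ≠ 0 := by
    rw [← hn', Polynomial.coeff_natDegree, Polynomial.leadingCoeff_ne_zero]
    rintro rfl
    simp at hn
  have h1 : (f * Polynomial.derivative S).coeff (3 + (n + 4)) = (n + 5) * S.coeff (n + 5) := by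
    rw [Polynomial.coeff_mul_add_eq_of_natDegree_le hf3.le, Polynomial.coeff_derivative]
    · have : f.coeff 3 = 1 := by
        have := hf.coeff_natDegree
        rwa [hf3] at this
      rw [this]; push_cast; ring
    · exact (Polynomial.natDegree_derivative_le S).trans (by omega)
  have h2 : (Polynomial.derivative f * S).coeff (2 + (n + 5)) = 3 * S.coeff (n + 5) := by
    rw [Polynomial.coeff_mul_add_eq_of_natDegree_le _ hn'.le, Polynomial.coeff_derivative]
    · have : f.coeff (2 + 1) = 1 := by
        have := hf.coeff_natDegree
        rwa [hf3] at this
      rw [this]; push_cast; ring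
    · exact (Polynomial.natDegree_derivative_le f).trans (by omega)
  have h3 : R.coeff (n + 7) = 0 := Polynomial.coeff_eq_zero_of_natDegree_lt (by omega)
  have h4 := congrArg (fun p => Polynomial.coeff p (n + 7)) h
  simp only [mul_assoc, Polynomial.coeff_sub, Polynomial.coeff_ofNat_mul, h3] at h4
  rw [show 3 + (n + 4) = n + 7 by ring] at h1
  rw [show 2 + (n + 5) = n + 7 by ring] at h2
  rw [h1, h2] at h4
  have h5 : ((2 * n + 1 : ℕ) : K) * S.coeff (n + 5) = 0 := by
    push_cast; linear_combination h4
  have h6 : ((2 * n + 1 : ℕ) : K) ≠ 0 := by exact_mod_cast (by omega : 2 * n + 1 ≠ 0)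
  exact (mul_ne_zero h6 hS) h5

end Polynomials

/-! ### Integration of `R(x)/y⁵` in the function field -/

section Primitive

variable {K : Type*} [Field K] (E : WeierstrassCurve K) [E.IsCharNeTwoNF]

/-- A function with derivative `R(x) / y⁵` is a constant plus `q(x) y / d(x)`. -/
theorem exists_sub_const_mul_eq_mul_yFun [CharZero K]
    {D₀ : Derivation K E.toAffine.FunctionField E.toAffine.FunctionField} (hD₀ : D₀ (xFun E) = 1)
    {F : E.toAffine.FunctionField} {R : K[X]} (hF : D₀ F * yFun E ^ 5 = algebraMap K[X] _ R) :
    ∃ (α : K) (q d : K[X]), d ≠ 0 ∧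
      (F - algebraMap K _ α) * algebraMap K[X] _ d = algebraMap K[X] _ q * yFun E := by
  obtain ⟨p, q, d, hd, h⟩ := exists_mul_eq_add_mul_yFun E F
  have hy := yFun_sq E
  have hdy := derivation_yFun E hD₀
  have h' := congrArg D₀ h
  simp only [map_add, Derivation.leibniz, derivation_algebraMap E hD₀, smul_eq_mul] at h'
  -- Differentiate `F d = p + q y`, eliminate `F` and clear denominators. Since `dF/dx = R/y⁵` is
  -- odd in `y`, the even part reads `p d' = d p'`.
  obtain ⟨e1, -⟩ := eq_zero_of_add_mul_yFun E
    (p := 2 * cubic E ^ 3 * (p * Polynomial.derivative d - d * Polynomial.derivative p))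
    (q := 2 * R * d ^ 2 + 2 * cubic E ^ 3 * q * Polynomial.derivative d -
      2 * cubic E ^ 3 * d * Polynomial.derivative q -
      cubic E ^ 2 * d * q * Polynomial.derivative (cubic E)) (by
      simp only [map_add, map_sub, map_mul, map_pow, map_ofNat, ← hy, ← hF, ← hdy]
      linear_combination (2 * yFun E ^ 6 * algebraMap K[X] E.toAffine.FunctionField d) * h' -
        2 * yFun E ^ 6 * algebraMap K[X] E.toAffine.FunctionField (Polynomial.derivative d) * h)
  have hf3 : (2 * cubic E ^ 3 : K[X]) ≠ 0 :=
    mul_ne_zero two_ne_zero (pow_ne_zero _ (cubic_ne_zero E))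
  obtain ⟨α, rfl⟩ := exists_eq_C_mul_of_wronskian_eq_zero hd
    (sub_eq_zero.mp ((mul_eq_zero.mp e1).resolve_left hf3))
  refine ⟨α, q, d, hd, ?_⟩
  rw [map_mul, ← algebraMap_eq_C] at h
  linear_combination h

/-- If `G d(x) = q(x) y`, then `G y³` is a rational function of `x`. -/
theorem exists_isCoprime_mul_yFun_pow {G : E.toAffine.FunctionField} {q d : K[X]} (hd : d ≠ 0)
    (h : G * algebraMap K[X] _ d = algebraMap K[X] _ q * yFun E) :
    ∃ N D : K[X], D ≠ 0 ∧ IsCoprime N D ∧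
      G * yFun E ^ 3 * algebraMap K[X] _ D = algebraMap K[X] _ N := by
  classical
  have hy := yFun_sq E
  have hg : gcd (q * cubic E ^ 2) d ≠ 0 := gcd_ne_zero_of_right hd
  have e1 := EuclideanDomain.mul_div_cancel' hg (gcd_dvd_left (q * cubic E ^ 2) d)
  have e2 := EuclideanDomain.mul_div_cancel' hg (gcd_dvd_right (q * cubic E ^ 2) d)
  refine ⟨q * cubic E ^ 2 / gcd (q * cubic E ^ 2) d, d / gcd (q * cubic E ^ 2) d, ?_,
    isCoprime_div_gcd_div_gcd hd, ?_⟩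
  · intro h0
    rw [h0, mul_zero] at e2
    exact hd e2.symm
  · have e1' := congrArg (algebraMap K[X] E.toAffine.FunctionField) e1
    have e2' := congrArg (algebraMap K[X] E.toAffine.FunctionField) e2
    rw [map_mul] at e1' e2'
    rw [map_mul (algebraMap K[X] E.toAffine.FunctionField) q, map_pow, ← hy] at e1'
    apply mul_left_cancel₀ ((map_ne_zero_iff _ (algebraMap_functionField_injective E)).mpr hg)
    linear_combination G * yFun E ^ 3 * e2' - e1' + yFun E ^ 3 * h

/-- Differentiate `G y³ D = N`, multiply by `2fD`, and insert `2 y y' = f'` and `y⁵ G' = R`. -/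
theorem differentialEquation_of_mul_eq
    {D₀ : Derivation K E.toAffine.FunctionField E.toAffine.FunctionField} (hD₀ : D₀ (xFun E) = 1)
    {G : E.toAffine.FunctionField} {R N D : K[X]} (hG : D₀ G * yFun E ^ 5 = algebraMap K[X] _ R)
    (hND : G * yFun E ^ 3 * algebraMap K[X] _ D = algebraMap K[X] _ N) :
    2 * R * D ^ 2 + 3 * Polynomial.derivative (cubic E) * N * D +
      2 * cubic E * N * Polynomial.derivative D = 2 * cubic E * Polynomial.derivative N * D := by
  apply algebraMap_functionField_injective E
  have hy := yFun_sq E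
  have hdy := derivation_yFun E hD₀
  have h' := congrArg D₀ hND
  simp only [Derivation.leibniz, Derivation.leibniz_pow, derivation_algebraMap E hD₀, smul_eq_mul,
    nsmul_eq_mul] at h'
  push_cast at h'
  simp only [map_add, map_mul, map_pow, map_ofNat, ← hy, ← hG, ← hdy, ← hND, ← h']
  ring

/-- A function `G = F - α` with derivative `R(x) / y⁵` and `G d(x) = q(x) y` is `S(x) / y³` for a
polynomial `S`. -/
theorem exists_polynomial_of_mul_eq [CharZero K] [E.IsElliptic]
    {D₀ : Derivation K E.toAffine.FunctionField E.toAffine.FunctionField} (hD₀ : D₀ (xFun E) = 1)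
    {G : E.toAffine.FunctionField} {R q d : K[X]} (hG : D₀ G * yFun E ^ 5 = algebraMap K[X] _ R)
    (hd : d ≠ 0) (h : G * algebraMap K[X] _ d = algebraMap K[X] _ q * yFun E) :
    ∃ S : K[X], G * yFun E ^ 3 = algebraMap K[X] _ S ∧
      2 * cubic E * Polynomial.derivative S - 3 * Polynomial.derivative (cubic E) * S = 2 * R := by
  obtain ⟨N, D, hD, hco, hND⟩ := exists_isCoprime_mul_yFun_pow E hd h
  have hODE := differentialEquation_of_mul_eq E hD₀ hG hND
  have hDu : IsUnit D := isUnit_denominator hD hco (isCoprime_cubic_derivative E) hODE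
  obtain ⟨c, hc, rfl⟩ := Polynomial.isUnit_iff.mp hDu
  have hcc : (Polynomial.C c⁻¹ : K[X]) * .C c = 1 := by
    rw [← map_mul, inv_mul_cancel₀ hc.ne_zero, map_one]
  refine ⟨.C c⁻¹ * N, ?_, ?_⟩
  · have h1 := congrArg (algebraMap K[X] E.toAffine.FunctionField) hcc
    rw [map_mul, map_one] at h1
    rw [map_mul, ← hND, mul_left_comm, h1, mul_one]
  · rw [Polynomial.derivative_C, mul_zero, add_zero] at hODE
    rw [Polynomial.derivative_C_mul]
    linear_combination (-Polynomial.C c⁻¹ ^ 2) * hODE -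
      (2 * cubic E * Polynomial.derivative N * Polynomial.C c⁻¹ -
        3 * Polynomial.derivative (cubic E) * N * Polynomial.C c⁻¹ -
        2 * R * (Polynomial.C c⁻¹ * Polynomial.C c + 1)) * hcc

end Primitive

/-! ### The form `L(dx/y)` and its primitive -/

section ExactForm

variable {K : Type*} [Field K] [Algebra ℂ K] (δ : Derivation ℂ K K) (E : WeierstrassCurve K)

theorem liftDerivation_algebraMap (g : K) :
    liftDerivation δ E (algebraMap K _ g) = algebraMap K _ (δ g) :=
  (existsUnique_liftDerivation δ E).choose_spec.1.1 g

theorem liftDerivation_xFun : liftDerivation δ E (xFun E) = 0 :=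
  (existsUnique_liftDerivation δ E).choose_spec.1.2

/-- The polynomial `δf`, where `δ` acts on the coefficients of the cubic `f`. -/
def deltaCubicPoly : K[X] := .C (δ E.a₂) * .X ^ 2 + .C (δ E.a₄) * .X + .C (δ E.a₆)

/-- The polynomial `δ²f`, where `δ` acts on the coefficients of the cubic `f`. -/
def deltaSqCubicPoly : K[X] :=
  .C (δ (δ E.a₂)) * .X ^ 2 + .C (δ (δ E.a₄)) * .X + .C (δ (δ E.a₆))

/-- The polynomial `R` with `L(1/y) = R(x) / y⁵`. -/
def numeratorL (A B C : K) : K[X] :=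
  .C A * (.C (3 / 4) * deltaCubicPoly δ E ^ 2 - .C (1 / 2) * cubic E * deltaSqCubicPoly δ E) -
    .C (1 / 2) * .C B * cubic E * deltaCubicPoly δ E + .C C * cubic E ^ 2

theorem liftDerivation_cubic :
    liftDerivation δ E (algebraMap K[X] _ (cubic E)) = algebraMap K[X] _ (deltaCubicPoly δ E) := by
  simp only [cubic, deltaCubicPoly, map_add, map_mul, map_pow, ← algebraMap_eq_C, algebraMap_X,
    Derivation.leibniz, Derivation.leibniz_pow, liftDerivation_algebraMap, liftDerivation_xFun]
  simp only [smul_eq_mul]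
  ring

theorem liftDerivation_deltaCubicPoly :
    liftDerivation δ E (algebraMap K[X] _ (deltaCubicPoly δ E)) =
      algebraMap K[X] _ (deltaSqCubicPoly δ E) := by
  simp only [deltaSqCubicPoly, deltaCubicPoly, map_add, map_mul, map_pow, ← algebraMap_eq_C,
    algebraMap_X, Derivation.leibniz, Derivation.leibniz_pow, liftDerivation_algebraMap,
    liftDerivation_xFun]
  simp only [smul_eq_mul]
  ring

theorem natDegree_numeratorL (A B C : K) : (numeratorL δ E A B C).natDegree ≤ 6 := by
  unfold numeratorL deltaCubicPoly deltaSqCubicPoly cubic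
  compute_degree

/-- Pair both sides of the identity of differentials with the linear functional induced by `d/dx`,
which sends `dx` to `1`. -/
theorem derivation_eq_applyL {A B C : K} {F : E.toAffine.FunctionField}
    (hF : IsExactWith δ E A B C F)
    {D : Derivation K E.toAffine.FunctionField E.toAffine.FunctionField} (hD : D (xFun E) = 1) :
    D F = applyL δ E A B C (1 / yFun E) := by
  have := congrArg D.liftKaehlerDifferential hF
  simpa [hD] using this.symm

variable [E.IsCharNeTwoNF]

/-- Applying `δ` to `y² = f` once and twice gives `2y δy = δf` and `2(δy)² + 2y δ²y = δ²f`, which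
express `δ(1/y)` and `δ²(1/y)` by `δf`, `δ²f` and odd powers of `1/y`. -/
theorem applyL_one_div_yFun (A B C : K) :
    applyL δ E A B C (1 / yFun E) * yFun E ^ 5 = algebraMap K[X] _ (numeratorL δ E A B C) := by
  have : CharZero K := charZero_of_injective_algebraMap (algebraMap ℂ K).injective
  have : CharZero E.toAffine.FunctionField :=
    charZero_of_injective_algebraMap (algebraMap K E.toAffine.FunctionField).injective
  have hy := yFun_sq E
  have hy0 := yFun_ne_zero E
  set D := liftDerivation δ E with hD
  have h1 : 2 * yFun E * D (yFun E) = algebraMap K[X] _ (deltaCubicPoly δ E) := by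
    rw [← liftDerivation_cubic, ← hy, Derivation.leibniz_pow]
    simp
    ring
  have h2 : 2 * D (yFun E) ^ 2 + 2 * yFun E * D (D (yFun E)) =
      algebraMap K[X] _ (deltaSqCubicPoly δ E) := by
    rw [← liftDerivation_deltaCubicPoly, ← h1, ← hD]
    rw [show 2 * yFun E * D (yFun E) = (2 : ℕ) • (yFun E * D (yFun E)) by simp; ring, map_nsmul]
    simp only [Derivation.leibniz, smul_eq_mul, nsmul_eq_mul]
    push_cast
    ring
  have h3 : D (1 / yFun E) = - (D (yFun E) / yFun E ^ 2) := by
    rw [one_div, Derivation.leibniz_inv, smul_eq_mul]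
    field_simp
  have h4 : D (D (1 / yFun E)) =
      - (D (D (yFun E)) / yFun E ^ 2) + 2 * D (yFun E) ^ 2 / yFun E ^ 3 := by
    rw [h3, map_neg, Derivation.leibniz_div, Derivation.leibniz_pow]
    simp only [smul_eq_mul, nsmul_eq_mul]
    field_simp
    push_cast
    ring
  have h34 : algebraMap K E.toAffine.FunctionField (3 / 4) = 3 / 4 := by
    rw [map_div₀, map_ofNat, map_ofNat]
  have h12 : algebraMap K E.toAffine.FunctionField (1 / 2) = 1 / 2 := by
    rw [map_div₀, map_one, map_ofNat]
  rw [applyL, ← hD, h4, h3, Algebra.smul_def, Algebra.smul_def, Algebra.smul_def]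
  simp only [numeratorL, map_add, map_sub, map_mul, map_pow, ← algebraMap_eq_C, h34, h12, ← h1, ← h2,
    ← hy]
  field_simp
  ring

/-- The shape of a primitive `F` of `L(dx/y)`. -/
theorem exists_primitive_shape [E.IsElliptic] {A B C : K} {F : E.toAffine.FunctionField}
    (hF : IsExactWith δ E A B C F) :
    ∃ (α : K) (S : K[X]), S.natDegree ≤ 4 ∧
      F * yFun E ^ 3 = algebraMap K _ α * yFun E ^ 3 + algebraMap K[X] _ S ∧
      2 * cubic E * Polynomial.derivative S - 3 * Polynomial.derivative (cubic E) * S =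
        2 * numeratorL δ E A B C := by
  have : CharZero K := charZero_of_injective_algebraMap (algebraMap ℂ K).injective
  obtain ⟨D₀, hD₀⟩ := exists_derivation_xFun E
  have hdF : D₀ F * yFun E ^ 5 = algebraMap K[X] _ (numeratorL δ E A B C) := by
    rw [derivation_eq_applyL δ E hF hD₀, applyL_one_div_yFun]
  obtain ⟨α, q, d, hd, h⟩ := exists_sub_const_mul_eq_mul_yFun E hD₀ hdF
  obtain ⟨S, hS, hODE⟩ := exists_polynomial_of_mul_eq E hD₀
    (by rw [map_sub, Derivation.map_algebraMap, sub_zero, hdF]) hd h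
  refine ⟨α, S, natDegree_le_four (monic_cubic E) (natDegree_cubic E)
    (natDegree_numeratorL δ E A B C) hODE, ?_, hODE⟩
  rw [← hS]
  ring

end ExactForm

/-! ### Values of rational functions at `P` and at `O` -/

section Values

variable {K : Type*} [Field K] (E : WeierstrassCurve K)

/-- If relations between the functions `u, v` specialize to relations between `u₀, v₀`, then the
value of a regular function at `(u₀, v₀)` is unique. -/
theorem HasValue.unique {E : WeierstrassCurve K} {u v : E.toAffine.FunctionField} {u₀ v₀ : K}
    (huv : ∀ p : MvPolynomial (Fin 2) K, MvPolynomial.aeval ![u, v] p = 0 →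
      MvPolynomial.eval ![u₀, v₀] p = 0)
    {F : E.toAffine.FunctionField} {c c' : K} (h : HasValue u v u₀ v₀ F c)
    (h' : HasValue u v u₀ v₀ F c') : c = c' := by
  obtain ⟨a, b, hb, hF, rfl⟩ := h
  obtain ⟨a', b', hb', hF', rfl⟩ := h'
  have := huv (a * b' - a' * b) (by
    rw [map_sub, map_mul, map_mul, ← hF, ← hF']; ring)
  rw [map_sub, map_mul, map_mul, sub_eq_zero] at this
  rw [div_eq_div_iff hb hb', this]

/-- A relation between `x` and `y` in the fraction field already holds in the coordinate ring, and
evaluation at a point of the curve is a ring homomorphism on that ring. -/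
theorem eval_eq_zero_of_aeval_eq_zero {x y : K} (hP : E.toAffine.Equation x y)
    (p : MvPolynomial (Fin 2) K) (hp : MvPolynomial.aeval ![xFun E, yFun E] p = 0) :
    MvPolynomial.eval ![x, y] p = 0 := by
  let X' : E.toAffine.CoordinateRing := WeierstrassCurve.Affine.CoordinateRing.mk E.toAffine
    (Polynomial.C Polynomial.X)
  let Y' : E.toAffine.CoordinateRing :=
    WeierstrassCurve.Affine.CoordinateRing.mk E.toAffine Polynomial.X
  have hx : algebraMap E.toAffine.CoordinateRing E.toAffine.FunctionField X' = xFun E := by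
    rw [xFun, IsScalarTower.algebraMap_apply K[X] E.toAffine.CoordinateRing]; rfl
  have h1 : MvPolynomial.aeval ![X', Y'] p = 0 := by
    apply IsFractionRing.injective E.toAffine.CoordinateRing E.toAffine.FunctionField
    rw [map_zero, ← hp, ← MvPolynomial.aeval_algebraMap_apply]
    congr 2
    ext i
    fin_cases i
    · exact hx
    · rfl
  let e : E.toAffine.CoordinateRing →+* K := AdjoinRoot.evalEval hP
  have h2 : ∀ g : K[X][X], e (AdjoinRoot.mk _ g) = g.evalEval x y :=
    fun g => AdjoinRoot.evalEval_mk hP g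
  have h3 := congrArg e h1
  rw [map_zero, MvPolynomial.aeval_def, MvPolynomial.hom_eval₂] at h3
  rw [← h3, MvPolynomial.eval, MvPolynomial.coe_eval₂Hom]
  congr 1
  · ext c
    symm
    change e (AdjoinRoot.mk _ (Polynomial.C (Polynomial.C c))) = c
    rw [h2, Polynomial.evalEval_C, Polynomial.eval_C]
  · ext i
    fin_cases i
    · symm
      change e (AdjoinRoot.mk _ (Polynomial.C Polynomial.X)) = x
      rw [h2, Polynomial.evalEval_C, Polynomial.eval_X]
    · symm
      change e (AdjoinRoot.mk _ Polynomial.X) = y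
      rw [h2, Polynomial.evalEval_X]

/-- The degree of the norm to `K[x]` is the order of the pole at `O`: `2` for `x` and `3` for `y`.
This is its ultrametric inequality, used in place of a valuation at `O`. -/
theorem degree_norm_add_le (a b : E.toAffine.CoordinateRing) :
    (Algebra.norm K[X] (a + b)).degree ≤
      max (Algebra.norm K[X] a).degree (Algebra.norm K[X] b).degree := by
  obtain ⟨p, q, rfl⟩ := WeierstrassCurve.Affine.CoordinateRing.exists_smul_basis_eq a
  obtain ⟨r, s, rfl⟩ := WeierstrassCurve.Affine.CoordinateRing.exists_smul_basis_eq b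
  rw [add_add_add_comm, ← add_smul, ← add_smul]
  simp only [WeierstrassCurve.Affine.CoordinateRing.degree_norm_smul_basis]
  apply max_le
  · rcases le_max_iff.mp (Polynomial.degree_add_le p r) with h | h
    · exact le_max_of_le_left (le_max_of_le_left (nsmul_le_nsmul_right h 2))
    · exact le_max_of_le_right (le_max_of_le_left (nsmul_le_nsmul_right h 2))
  · rcases le_max_iff.mp (Polynomial.degree_add_le q s) with h | h
    · exact le_max_of_le_left (le_max_of_le_right (by gcongr))
    · exact le_max_of_le_right (le_max_of_le_right (by gcongr))

theorem degree_norm_algebraMap (p : K[X]) :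
    (Algebra.norm K[X] (algebraMap K[X] E.toAffine.CoordinateRing p)).degree = 2 • p.degree := by
  have := WeierstrassCurve.Affine.CoordinateRing.degree_norm_smul_basis (W' := E.toAffine) p 0
  rw [zero_smul, add_zero, ← Algebra.algebraMap_eq_smul_one] at this
  rw [this]
  simp

theorem degree_norm_Y : (Algebra.norm K[X]
    (WeierstrassCurve.Affine.CoordinateRing.mk E.toAffine Polynomial.X)).degree = 3 := by
  have := WeierstrassCurve.Affine.CoordinateRing.degree_norm_smul_basis (W' := E.toAffine) 0 1
  rw [zero_smul, zero_add, one_smul] at this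
  rw [this]
  simp

/-- A polynomial in the coordinates `x/y`, `1/y` around `O` with constant term `c` is
`(c y ^ N + r) / y ^ N`, where `r` has a pole of order less than that of `y ^ N`. -/
theorem exists_mul_yFun_pow_eq [E.IsCharNeTwoNF] (p : MvPolynomial (Fin 2) K) :
    ∃ (N : ℕ) (r : E.toAffine.CoordinateRing), (Algebra.norm K[X] r).degree < (3 * N : ℕ) ∧
      MvPolynomial.aeval ![xFun E / yFun E, 1 / yFun E] p * yFun E ^ N =
        algebraMap K _ (MvPolynomial.eval ![0, 0] p) * yFun E ^ N + algebraMap _ _ r := by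
  have hy0 := yFun_ne_zero E
  set Y' : E.toAffine.CoordinateRing :=
    WeierstrassCurve.Affine.CoordinateRing.mk E.toAffine Polynomial.X with hY'
  have hY : algebraMap E.toAffine.CoordinateRing E.toAffine.FunctionField Y' = yFun E := rfl
  have hdY : ∀ N : ℕ, (Algebra.norm K[X] (Y' ^ N)).degree = (3 * N : ℕ) := by
    intro N
    rw [map_pow, Polynomial.degree_pow, degree_norm_Y]
    push_cast
    rw [mul_comm, nsmul_eq_mul]
  have hmono : ∀ {a : E.toAffine.CoordinateRing} {N : ℕ} (M : ℕ),
      (Algebra.norm K[X] a).degree < (3 * N : ℕ) →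
      (Algebra.norm K[X] (a * Y' ^ M)).degree < (3 * (N + M) : ℕ) := by
    intro a N M h
    rw [map_mul, Polynomial.degree_mul, hdY, mul_add, Nat.cast_add]
    by_cases ha : (Algebra.norm K[X] a).degree = ⊥
    · rw [ha, WithBot.bot_add]; exact WithBot.bot_lt_coe _
    · exact WithBot.add_lt_add_right (WithBot.coe_ne_bot) h
  have hX : algebraMap E.toAffine.CoordinateRing E.toAffine.FunctionField
      (algebraMap K[X] _ Polynomial.X) = xFun E := by
    rw [xFun, ← IsScalarTower.algebraMap_apply]
  have hconst : ∀ (c : K) (N : ℕ), (Algebra.norm K[X]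
      (algebraMap K[X] E.toAffine.CoordinateRing (.C c) * Y' ^ N)).degree ≤ (3 * N : ℕ) := by
    intro c N
    rw [map_mul, Polynomial.degree_mul, hdY, degree_norm_algebraMap]
    have : 2 • (Polynomial.C c : K[X]).degree ≤ 0 := by
      have := Polynomial.degree_C_le (a := c)
      calc _ ≤ 2 • (0 : WithBot ℕ) := nsmul_le_nsmul_right this 2
        _ = 0 := by simp
    calc _ ≤ (0 : WithBot ℕ) + (3 * N : ℕ) := by gcongr
      _ = _ := zero_add _
  have hCmap : ∀ c : K, algebraMap E.toAffine.CoordinateRing E.toAffine.FunctionField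
      (algebraMap K[X] _ (.C c)) = algebraMap K _ c := by
    intro c
    rw [← IsScalarTower.algebraMap_apply, algebraMap_eq_C]
  induction p using MvPolynomial.induction_on with
  | C a =>
    refine ⟨0, 0, ?_, ?_⟩
    · rw [← zero_smul K[X] (1 : E.toAffine.CoordinateRing), ← Algebra.algebraMap_eq_smul_one,
        degree_norm_algebraMap]
      simp
    · simp
  | add p q hp hq =>
    obtain ⟨N, r, hr, h⟩ := hp
    obtain ⟨M, s, hs, h'⟩ := hq
    refine ⟨N + M, r * Y' ^ M + s * Y' ^ N, ?_, ?_⟩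
    · refine (degree_norm_add_le E _ _).trans_lt (max_lt (hmono M hr) ?_)
      rw [add_comm N M]
      exact hmono N hs
    · simp only [map_add, map_mul, map_pow, hY, pow_add]
      linear_combination yFun E ^ M * h + yFun E ^ N * h'
  | mul_X p i hp =>
    obtain ⟨N, r, hr, h⟩ := hp
    set c := MvPolynomial.eval ![0, 0] p
    have hle : (Algebra.norm K[X] (algebraMap K[X] E.toAffine.CoordinateRing (.C c) * Y' ^ N +
        r)).degree ≤ (3 * N : ℕ) :=
      (degree_norm_add_le E _ _).trans (max_le (hconst c N) hr.le)
    fin_cases i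
    -- Multiplication by `x/y` adds `2` to the pole order of the numerator, multiplication by `1/y`
    -- adds nothing, while the bound grows by `3`. The new constant term is `0`, so the whole
    -- numerator becomes the remainder.
    · refine ⟨N + 1, (algebraMap K[X] _ (.C c) * Y' ^ N + r) * algebraMap K[X] _ .X, ?_, ?_⟩
      · rw [map_mul, Polynomial.degree_mul, degree_norm_algebraMap, Polynomial.degree_X]
        calc _ ≤ ((3 * N : ℕ) : WithBot ℕ) + 2 • 1 := by gcongr
          _ = ((3 * N + 2 : ℕ) : WithBot ℕ) := by push_cast; simp
          _ < _ := by exact_mod_cast (by omega)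
      · simp only [map_add, map_mul, map_pow, hY, hX, hCmap, pow_succ, MvPolynomial.aeval_X,
          MvPolynomial.eval_X]
        simp only [Fin.zero_eta, Matrix.cons_val_zero, mul_zero, map_zero, zero_mul, zero_add]
        field_simp
        linear_combination xFun E * h
    · refine ⟨N + 1, algebraMap K[X] _ (.C c) * Y' ^ N + r, ?_, ?_⟩
      · exact hle.trans_lt (by exact_mod_cast (by omega))
      · simp only [map_add, map_mul, map_pow, hY, hCmap, pow_succ, MvPolynomial.aeval_X,
          MvPolynomial.eval_X]
        simp only [Fin.mk_one, Matrix.cons_val_one, Matrix.cons_val_zero, mul_zero, map_zero,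
          zero_mul, zero_add]
        field_simp
        linear_combination h

/-- A non-zero constant term `c` would give `r = -c yᴺ`, with a pole of order exactly `3N` at `O`,
whereas `r` has smaller pole order. -/
theorem eval_zero_eq_zero_of_aeval_eq_zero [E.IsCharNeTwoNF] (p : MvPolynomial (Fin 2) K)
    (hp : MvPolynomial.aeval ![xFun E / yFun E, 1 / yFun E] p = 0) :
    MvPolynomial.eval ![0, 0] p = 0 := by
  obtain ⟨N, r, hr, h⟩ := exists_mul_yFun_pow_eq E p
  set c := MvPolynomial.eval ![0, 0] p
  by_contra hc
  have h1 : r = algebraMap K[X] E.toAffine.CoordinateRing (.C (-c)) *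
      WeierstrassCurve.Affine.CoordinateRing.mk E.toAffine Polynomial.X ^ N := by
    apply IsFractionRing.injective E.toAffine.CoordinateRing E.toAffine.FunctionField
    rw [hp, zero_mul] at h
    rw [map_mul, ← IsScalarTower.algebraMap_apply, ← algebraMap_eq_C, map_pow, map_neg]
    change _ = _ * yFun E ^ N
    linear_combination -h
  rw [h1, map_mul, Polynomial.degree_mul, degree_norm_algebraMap, map_pow, Polynomial.degree_pow,
    degree_norm_Y, Polynomial.degree_C (neg_ne_zero.mpr hc), smul_zero, zero_add, nsmul_eq_mul]
    at hr
  refine absurd hr (not_lt.mpr (le_of_eq ?_))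
  push_cast
  rw [mul_comm]

theorem HasValueAt.unique {E : WeierstrassCurve K} {x y : K} (hP : E.toAffine.Equation x y)
    {F : E.toAffine.FunctionField} {c c' : K} (h : HasValueAt E F x y c)
    (h' : HasValueAt E F x y c') : c = c' :=
  HasValue.unique (eval_eq_zero_of_aeval_eq_zero E hP) h h'

theorem HasValueAtO.unique {E : WeierstrassCurve K} [E.IsCharNeTwoNF]
    {F : E.toAffine.FunctionField} {c c' : K} (h : HasValueAtO E F c)
    (h' : HasValueAtO E F c') : c = c' :=
  HasValue.unique (eval_zero_eq_zero_of_aeval_eq_zero E) h h'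

theorem hasValueAt_of_mul_pow_eq {F : E.toAffine.FunctionField} {α : K} {S : K[X]} {x y : K}
    (hy : y ≠ 0)
    (h : F * yFun E ^ 3 = algebraMap K _ α * yFun E ^ 3 + algebraMap K[X] _ S) :
    HasValueAt E F x y (α + S.eval x / y ^ 3) := by
  refine ⟨.C α * .X 1 ^ 3 + Polynomial.aeval (.X 0) S, .X 1 ^ 3, ?_, ?_, ?_⟩
  · simpa using hy
  · rw [map_add, map_mul, map_pow, MvPolynomial.aeval_X, MvPolynomial.aeval_C,
      ← Polynomial.aeval_algHom_apply, MvPolynomial.aeval_X]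
    change F * yFun E ^ 3 = algebraMap K _ α * yFun E ^ 3 + Polynomial.aeval (xFun E) S
    rw [h, xFun, Polynomial.aeval_algebraMap_apply, Polynomial.aeval_X_left_apply]
  · have h1 : MvPolynomial.eval ![x, y] (Polynomial.aeval (MvPolynomial.X 0) S) = S.eval x := by
      rw [← MvPolynomial.coe_aeval_eq_eval]
      change MvPolynomial.aeval ![x, y] (Polynomial.aeval (MvPolynomial.X 0) S) = _
      rw [← Polynomial.aeval_algHom_apply, MvPolynomial.aeval_X]
      simp
    rw [map_add, h1]
    simp
    field_simp

theorem hasValueAtO_of_mul_pow_eq [E.IsCharNeTwoNF] {F : E.toAffine.FunctionField} {α : K}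
    {S : K[X]} (hS : S.natDegree ≤ 4)
    (h : F * yFun E ^ 3 = algebraMap K _ α * yFun E ^ 3 + algebraMap K[X] _ S) :
    HasValueAtO E F α := by
  have hy0 := yFun_ne_zero E
  have hy := yFun_sq E
  simp only [cubic, map_add, map_mul, map_pow, ← algebraMap_eq_C, algebraMap_X] at hy
  have hSx : algebraMap K[X] E.toAffine.FunctionField S =
      algebraMap K _ (S.coeff 0) + algebraMap K _ (S.coeff 1) * xFun E +
      algebraMap K _ (S.coeff 2) * xFun E ^ 2 + algebraMap K _ (S.coeff 3) * xFun E ^ 3 +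
      algebraMap K _ (S.coeff 4) * xFun E ^ 4 := by
    conv_lhs => rw [S.as_sum_range_C_mul_X_pow' (n := 5) (by omega)]
    simp only [Finset.sum_range_succ, Finset.sum_range_zero, map_add, map_mul, map_pow,
      ← algebraMap_eq_C, algebraMap_X]
    simp
  -- In `u = x/y`, `v = 1/y` the quotient `xⁱ/y³` is `uⁱ v³⁻ⁱ` for `i ≤ 3`. For `i = 4` the curve
  -- equation gives `x⁴/y³ = u (x³/y²) = u (1 - a₂u² - a₄uv - a₆v²)`. All of them vanish at the
  -- origin.
  refine ⟨.C α + .C (S.coeff 0) * .X 1 ^ 3 + .C (S.coeff 1) * .X 0 * .X 1 ^ 2 +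
    .C (S.coeff 2) * .X 0 ^ 2 * .X 1 + .C (S.coeff 3) * .X 0 ^ 3 +
    .C (S.coeff 4) * .X 0 * (1 - .C E.a₂ * .X 0 ^ 2 - .C E.a₄ * .X 0 * .X 1 - .C E.a₆ * .X 1 ^ 2),
    1, ?_, ?_, ?_⟩
  · simp
  · simp only [map_add, map_mul, map_sub, map_pow, map_one, MvPolynomial.aeval_X,
      MvPolynomial.aeval_C]
    simp only [Matrix.cons_val_zero, Matrix.cons_val_one, mul_one]
    apply mul_right_cancel₀ (pow_ne_zero 3 hy0)
    rw [h, hSx]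
    field_simp
    linear_combination (-xFun E * algebraMap K _ (S.coeff 4)) * hy
  · simp

end Values

/-! ### Families of holomorphic functions depending on a real parameter -/

section Families

/-- The partial derivative with respect to the complex variable. -/
def dz {ι : Type*} (H : ℂ → ι → ℂ) (z : ℂ) (s : ι) : ℂ := deriv (fun ζ => H ζ s) z

variable {V : Set ℂ}

/-- Convergence along `𝓝 z ×ˢ l` for every `z ∈ V` is locally uniform convergence on `V`. By
Weierstrass the limit is holomorphic and the derivatives converge in the same sense, so the
conclusion can be fed back as a hypothesis. -/
theorem differentiableOn_and_tendsto_dz_sub {ι : Type*} {l : Filter ι} [l.NeBot] (hV : IsOpen V)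
    {F : ℂ → ι → ℂ} {f : ℂ → ℂ} (hF : ∀ᶠ i in l, DifferentiableOn ℂ (fun z => F z i) V)
    (h : ∀ z ∈ V, Tendsto (fun p : ℂ × ι => F p.1 p.2 - f p.1) (𝓝 z ×ˢ l) (𝓝 0)) :
    DifferentiableOn ℂ f V ∧
      ∀ z ∈ V, Tendsto (fun p : ℂ × ι => dz F p.1 p.2 - deriv f p.1) (𝓝 z ×ˢ l) (𝓝 0) := by
  have key : ∀ (F : ℂ → ι → ℂ) (f : ℂ → ℂ), TendstoLocallyUniformlyOn (fun i z => F z i) f l V ↔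
      ∀ z ∈ V, Tendsto (fun p : ℂ × ι => F p.1 p.2 - f p.1) (𝓝 z ×ˢ l) (𝓝 0) := by
    intro F f
    rw [hV.tendstoLocallyUniformlyOn_iff_forall_tendsto]
    refine forall₂_congr fun z _ => ?_
    rw [uniformity_eq_comap_nhds_zero, tendsto_comap_iff, prod_comm, tendsto_map'_iff]
    rfl
  rw [← key] at h
  refine ⟨h.differentiableOn hF hV, ?_⟩
  exact (key (dz F) (deriv f)).mp (h.deriv hF hV)

/-- A continuous family of holomorphic functions on `V` with parameter in `J`. -/
structure HolFamily (V : Set ℂ) (J : Set ℝ) (H : ℂ → ℝ → ℂ) : Prop where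
  cont : ContinuousOn (Function.uncurry H) (V ×ˢ J)
  hol : ∀ s ∈ J, DifferentiableOn ℂ (fun z => H z s) V

/-- A continuously differentiable family of holomorphic functions on `V`, with derivative `Hs` with
respect to the parameter. -/
structure C1Family (V : Set ℂ) (J : Set ℝ) (H Hs : ℂ → ℝ → ℂ) : Prop extends
    HolFamily V J H where
  cont_deriv : ContinuousOn (Function.uncurry Hs) (V ×ˢ J)
  hasDeriv : ∀ z ∈ V, ∀ s ∈ J, HasDerivWithinAt (H z) (Hs z s) J s

variable {J : Set ℝ} {H Hs G Gs : ℂ → ℝ → ℂ}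

namespace HolFamily

/-- Joint continuity says that `H(·, s')` tends to `H(·, s)` locally uniformly as `s' → s`;
Weierstrass passes this on to the derivatives. -/
theorem dz (hV : IsOpen V) (hH : HolFamily V J H) : HolFamily V J (dz H) := by
  refine ⟨?_, fun s hs => (hH.hol s hs).deriv hV⟩
  rintro ⟨z, s⟩ ⟨hz, hs⟩
  have hne : (𝓝[J] s).NeBot := mem_closure_iff_nhdsWithin_neBot.mp (subset_closure hs)
  have h1 : ∀ z ∈ V, Tendsto (fun p : ℂ × ℝ => H p.1 p.2 - H p.1 s) (𝓝 z ×ˢ 𝓝[J] s) (𝓝 0) := by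
    intro z hz
    have hc := hH.cont (z, s) ⟨hz, hs⟩
    rw [ContinuousWithinAt, nhdsWithin_prod_eq, hV.nhdsWithin_eq hz] at hc
    have hc' : Tendsto (fun z' => H z' s) (𝓝 z) (𝓝 (H z s)) :=
      ((hH.hol s hs).differentiableAt (hV.mem_nhds hz)).continuousAt
    simpa [Function.uncurry_def] using hc.sub (hc'.comp tendsto_fst)
  have h2 := (differentiableOn_and_tendsto_dz_sub (l := 𝓝[J] s) hV (f := fun z => H z s)
    (eventually_mem_nhdsWithin.mono fun s hs => hH.hol s hs) h1).2 z hz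
  have h3 : Tendsto (fun z' => ManinMap.dz H z' s) (𝓝 z) (𝓝 (ManinMap.dz H z s)) :=
    (((hH.hol s hs).deriv hV).differentiableAt (hV.mem_nhds hz)).continuousAt
  have h4 := h2.add (h3.comp (tendsto_fst (g := 𝓝[J] s)))
  rw [ContinuousWithinAt, nhdsWithin_prod_eq, hV.nhdsWithin_eq hz]
  rw [zero_add] at h4
  refine h4.congr fun p => ?_
  exact sub_add_cancel _ _

theorem mul (hH : HolFamily V J H) (hG : HolFamily V J G) :
    HolFamily V J (fun z s => H z s * G z s) :=
  ⟨hH.cont.mul hG.cont, fun s hs => (hH.hol s hs).mul (hG.hol s hs)⟩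

theorem div (hH : HolFamily V J H) (hG : HolFamily V J G) (h0 : ∀ z ∈ V, ∀ s ∈ J, G z s ≠ 0) :
    HolFamily V J (fun z s => H z s / G z s) :=
  ⟨hH.cont.div hG.cont (fun p hp => h0 p.1 hp.1 p.2 hp.2),
    fun s hs => (hH.hol s hs).div (hG.hol s hs) fun z hz => h0 z hz s hs⟩

theorem of_differentiableOn {v : ℂ → ℂ} (hv : DifferentiableOn ℂ v V) :
    HolFamily V J (fun z _ => v z) :=
  ⟨hv.continuousOn.comp continuousOn_fst fun _ hp => hp.1, fun _ _ => hv⟩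

theorem hasDerivAt (hV : IsOpen V) (hH : HolFamily V J H) {z : ℂ} (hz : z ∈ V) {s : ℝ}
    (hs : s ∈ J) : HasDerivAt (fun ζ => H ζ s) (ManinMap.dz H z s) z :=
  ((hH.hol s hs).differentiableAt (hV.mem_nhds hz)).hasDerivAt

theorem continuousOn_right (hH : HolFamily V J H) {z : ℂ} (hz : z ∈ V) : ContinuousOn (H z) J :=
  hH.cont.comp (continuousOn_const.prodMk continuousOn_id) fun _ hs => ⟨hz, hs⟩

theorem hasDerivAt_integral (hV : IsOpen V) (hH : HolFamily V J H) {a b : ℝ} (hab : uIcc a b ⊆ J)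
    {z : ℂ} (hz : z ∈ V) :
    HasDerivAt (fun ζ => ∫ s in a..b, H ζ s) (∫ s in a..b, ManinMap.dz H z s) z := by
  obtain ⟨r, hr, hrV⟩ := Metric.nhds_basis_closedBall.mem_iff.mp (hV.mem_nhds hz)
  have hK : IsCompact (Metric.closedBall z r ×ˢ uIcc a b) :=
    (isCompact_closedBall z r).prod isCompact_uIcc
  obtain ⟨C, hC⟩ := hK.exists_bound_of_continuousOn ((hH.dz hV).cont.mono (prod_mono hrV hab))
  have hsub : ∀ s ∈ uIoc a b, s ∈ uIcc a b := fun s hs => uIoc_subset_uIcc hs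
  have hint : ∀ ζ ∈ V, IntervalIntegrable (H ζ) MeasureTheory.volume a b :=
    fun ζ hζ => ((hH.continuousOn_right hζ).mono hab).intervalIntegrable
  refine (intervalIntegral.hasDerivAt_integral_of_dominated_loc_of_deriv_le (bound := fun _ => C)
    (F' := fun ζ s => ManinMap.dz H ζ s) (s := Metric.closedBall z r)
    (Metric.closedBall_mem_nhds z hr) ?_ (hint z hz) ?_ ?_ ?_ ?_).2
  · filter_upwards [hV.mem_nhds hz] with ζ hζ using (hint ζ hζ).aestronglyMeasurable_restrict_uIoc
  · exact (((hH.dz hV).continuousOn_right hz).mono hab).intervalIntegrable.aestronglyMeasurable_restrict_uIoc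
  · exact Eventually.of_forall fun s hs ζ hζ => hC (ζ, s) ⟨hζ, hsub s hs⟩
  · exact intervalIntegrable_const
  · exact Eventually.of_forall fun s hs ζ hζ => hH.hasDerivAt hV (hrV hζ) (hab (hsub s hs))

end HolFamily

namespace C1Family

/-- The mean value inequality, applied to `H(z', σ) - σ Hs(z', s)`, bounds the error of the slope by
the oscillation of `Hs`, which is small uniformly in `z'` by joint continuity. -/
theorem tendsto_slope_sub (hV : IsOpen V) (hJ : OrdConnected J) (hH : C1Family V J H Hs) {z : ℂ}
    (hz : z ∈ V) {s : ℝ} (hs : s ∈ J) :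
    Tendsto (fun p : ℂ × ℝ => slope (H p.1) s p.2 - Hs p.1 s) (𝓝 z ×ˢ 𝓝[J \ {s}] s) (𝓝 0) := by
  rw [Metric.tendsto_nhds]
  intro ε hε
  have hc := hH.cont_deriv (z, s) ⟨hz, hs⟩
  rw [ContinuousWithinAt, nhdsWithin_prod_eq, hV.nhdsWithin_eq hz, Metric.tendsto_nhds] at hc
  obtain ⟨W, hW, U, hU, hWU⟩ := mem_prod_iff.mp (hc (ε / 4) (by positivity))
  obtain ⟨r, hr, hrU⟩ := Metric.mem_nhdsWithin_iff.mp hU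
  have hmem : (W ∩ V) ×ˢ (Metric.ball s r ∩ (J \ {s})) ∈ 𝓝 z ×ˢ 𝓝[J \ {s}] s :=
    prod_mem_prod (inter_mem hW (hV.mem_nhds hz))
      (inter_mem (mem_nhdsWithin_of_mem_nhds (Metric.ball_mem_nhds s hr)) self_mem_nhdsWithin)
  filter_upwards [hmem]
  rintro ⟨z', s'⟩ ⟨⟨hz', hzV⟩, hs', hsJ, hne⟩
  have hne' : s' - s ≠ 0 := sub_ne_zero.mpr hne
  have hbound : ∀ σ ∈ Metric.ball s r ∩ J, ‖Hs z' σ - Hs z' s‖ ≤ ε / 2 := by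
    intro σ hσ
    have h1 : dist (Hs z' σ) (Hs z s) < ε / 4 := hWU (show (z', σ) ∈ W ×ˢ U from ⟨hz', hrU hσ⟩)
    have h2 : dist (Hs z' s) (Hs z s) < ε / 4 :=
      hWU (show (z', s) ∈ W ×ˢ U from ⟨hz', hrU ⟨Metric.mem_ball_self hr, hs⟩⟩)
    rw [← dist_eq_norm]
    linarith [dist_triangle_right (Hs z' σ) (Hs z' s) (Hs z s)]
  have hconv : Convex ℝ (Metric.ball s r ∩ J) := (convex_ball s r).inter hJ.convex
  have hmvt := hconv.norm_image_sub_le_of_norm_hasDerivWithin_le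
    (f := fun σ => H z' σ - (σ : ℂ) * Hs z' s) (f' := fun σ => Hs z' σ - Hs z' s) (C := ε / 2)
    (x := s) (y := s') (fun σ hσ => by
      have h1 := (hH.hasDeriv z' hzV σ hσ.2).mono (inter_subset_right (s := Metric.ball s r))
      have h2 : HasDerivWithinAt (fun σ : ℝ => (σ : ℂ) * Hs z' s) (1 * Hs z' s)
          (Metric.ball s r ∩ J) σ :=
        (Complex.ofRealCLM.hasDerivAt (x := σ)).hasDerivWithinAt.mul_const _
      rw [one_mul] at h2
      exact h1.sub h2) hbound ⟨Metric.mem_ball_self hr, hs⟩ ⟨hs', hsJ⟩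
  rw [dist_zero_right]
  have hcast : ((s' - s : ℝ) : ℂ) ≠ 0 := by exact_mod_cast hne'
  have heq : slope (H z') s s' - Hs z' s =
      ((s' - s : ℝ) : ℂ)⁻¹ * ((H z' s' - s' * Hs z' s) - (H z' s - s * Hs z' s)) := by
    rw [slope_def_module, Complex.real_smul]
    push_cast at hcast ⊢
    field_simp
    ring
  rw [heq, norm_mul, norm_inv, Complex.norm_real]
  have hpos : 0 < ‖s' - s‖ := norm_pos_iff.mpr hne'
  calc _ ≤ ‖s' - s‖⁻¹ * (ε / 2 * ‖s' - s‖) := by gcongr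
    _ = ε / 2 := by field_simp
    _ < ε := by linarith

/-- Interchange of `∂_z` and `∂_s` without a `C²` hypothesis: the slopes in `s` are holomorphic in
`z` and converge locally uniformly to `Hs`, so their `z`-derivatives converge to that of `Hs`. -/
theorem holFamily_deriv_and_dz (hV : IsOpen V) (hJ : OrdConnected J)
    (hJ' : ∀ s ∈ J, (𝓝[J \ {s}] s).NeBot) (hH : C1Family V J H Hs) :
    HolFamily V J Hs ∧ C1Family V J (ManinMap.dz H) (ManinMap.dz Hs) := by
  have key : ∀ s ∈ J, DifferentiableOn ℂ (fun z => Hs z s) V ∧ ∀ z ∈ V,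
      HasDerivWithinAt (ManinMap.dz H z) (ManinMap.dz Hs z s) J s := by
    intro s hs
    have := hJ' s hs
    have hJs : ∀ᶠ s' in 𝓝[J \ {s}] s, s' ∈ J := eventually_mem_nhdsWithin.mono fun _ h => h.1
    have h1 := differentiableOn_and_tendsto_dz_sub (l := 𝓝[J \ {s}] s) hV
      (F := fun z s' => slope (H z) s s') (f := fun z => Hs z s)
      (hJs.mono fun s' hs' => by
        simp only [slope_def_module]
        exact ((hH.hol s' hs').sub (hH.hol s hs)).const_smul _)
      (fun z hz => hH.tendsto_slope_sub hV hJ hz hs)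
    refine ⟨h1.1, fun z hz => ?_⟩
    rw [hasDerivWithinAt_iff_tendsto_slope]
    have h2 := (h1.2 z hz).comp
      ((tendsto_const_nhds (x := z) (f := 𝓝[J \ {s}] s)).prodMk tendsto_id)
    have h3 := h2.add_const (ManinMap.dz Hs z s)
    rw [zero_add] at h3
    refine h3.congr' (hJs.mono fun s' hs' => ?_)
    change (ManinMap.dz (fun z s' => slope (H z) s s') z s' - deriv (fun z => Hs z s) z) + _ = _
    rw [ManinMap.dz, ManinMap.dz, sub_add_cancel]
    simp only [slope_def_module]
    exact (((hH.toHolFamily.hasDerivAt hV hz hs').sub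
      (hH.toHolFamily.hasDerivAt hV hz hs)).const_smul _).deriv
  have hs : HolFamily V J Hs := ⟨hH.cont_deriv, fun s hs => (key s hs).1⟩
  exact ⟨hs, ⟨hH.toHolFamily.dz hV, (hs.dz hV).cont, fun z hz s hs => (key s hs).2 z hz⟩⟩

end C1Family

theorem neBot_nhdsWithin_Ioc {s : ℝ} (hs : s ∈ Ioc (0 : ℝ) 1) :
    (𝓝[Ioc (0 : ℝ) 1 \ {s}] s).NeBot := by
  have h1 : (𝓝[Ioo 0 s] s).NeBot := by
    rw [nhdsWithin_Ioo_eq_nhdsLT hs.1]; infer_instance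
  exact h1.mono (nhdsWithin_mono _ fun t ht => ⟨⟨ht.1, ht.2.le.trans hs.2⟩, ht.2.ne⟩)

/-- The integral up to the endpoint of a continuous family of holomorphic functions. -/
theorem HolFamily.c1Family_integral (hV : IsOpen V) (hH : HolFamily V (Ioc 0 1) H) :
    C1Family V (Ioc 0 1) (fun z s => ∫ σ in s..1, H z σ) (fun z s => - H z s) := by
  have hsub : ∀ {s t : ℝ}, s ∈ Ioc (0 : ℝ) 1 → t ∈ Ioc (0 : ℝ) 1 → uIcc s t ⊆ Ioc 0 1 :=
    fun hs ht => OrdConnected.uIcc_subset ordConnected_Ioc hs ht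
  have h1 : (1 : ℝ) ∈ Ioc (0 : ℝ) 1 := ⟨one_pos, le_rfl⟩
  have hint : ∀ {z s t}, z ∈ V → s ∈ Ioc (0 : ℝ) 1 → t ∈ Ioc (0 : ℝ) 1 →
      IntervalIntegrable (H z) MeasureTheory.volume s t := fun hz hs ht =>
    ((hH.continuousOn_right hz).mono (hsub hs ht)).intervalIntegrable
  have hhol : ∀ s ∈ Ioc (0 : ℝ) 1, DifferentiableOn ℂ (fun z => ∫ σ in s..1, H z σ) V :=
    fun s hs z hz =>
      (hH.hasDerivAt_integral hV (hsub hs h1) hz).differentiableAt.differentiableWithinAt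
  refine ⟨⟨?_, hhol⟩, hH.cont.neg, ?_⟩
  · rintro ⟨z, s⟩ ⟨hz, hs⟩
    rw [ContinuousWithinAt, nhdsWithin_prod_eq, hV.nhdsWithin_eq hz]
    have hc := hH.cont (z, s) ⟨hz, hs⟩
    rw [ContinuousWithinAt, nhdsWithin_prod_eq, hV.nhdsWithin_eq hz] at hc
    have hb : ∀ᶠ p in 𝓝 z ×ˢ 𝓝[Ioc 0 1] s, ‖H p.1 p.2‖ ≤ ‖H z s‖ + 1 := by
      filter_upwards [hc.norm.eventually_lt_const (lt_add_one _)] with p hp using hp.le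
    obtain ⟨W, hW, U, hU, hWU⟩ := mem_prod_iff.mp hb
    obtain ⟨r, hr, hrU⟩ := Metric.mem_nhdsWithin_iff.mp hU
    -- In `∫_t^1 = ∫_s^1 - ∫_s^t` the first term is continuous in `z`, and the second is at most a
    -- constant times `|t - s|`.
    have h2 : Tendsto (fun p : ℂ × ℝ => ∫ σ in s..p.2, H p.1 σ) (𝓝 z ×ˢ 𝓝[Ioc 0 1] s) (𝓝 0) := by
      have h3 : Tendsto (fun p : ℂ × ℝ => (‖H z s‖ + 1) * |p.2 - s|) (𝓝 z ×ˢ 𝓝[Ioc 0 1] s)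
          (𝓝 0) := by
        have : Tendsto (fun t : ℝ => (‖H z s‖ + 1) * |t - s|) (𝓝 s) (𝓝 0) := by
          have : Continuous (fun t : ℝ => (‖H z s‖ + 1) * |t - s|) := by fun_prop
          simpa using this.tendsto s
        exact (this.mono_left nhdsWithin_le_nhds).comp tendsto_snd
      refine squeeze_zero_norm' ?_ h3
      filter_upwards [prod_mem_prod hW (inter_mem
        (mem_nhdsWithin_of_mem_nhds (Metric.ball_mem_nhds s hr)) self_mem_nhdsWithin)]
      rintro ⟨z', t⟩ ⟨hz', ht, htJ⟩
      refine intervalIntegral.norm_integral_le_of_norm_le_const fun σ hσ => ?_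
      have hσJ := hsub hs htJ (uIoc_subset_uIcc hσ)
      have hσr : σ ∈ Metric.ball s r := (convex_ball s r).ordConnected.uIcc_subset
        (Metric.mem_ball_self hr) ht (uIoc_subset_uIcc hσ)
      exact hWU (show (z', σ) ∈ W ×ˢ U from ⟨hz', hrU ⟨hσr, hσJ⟩⟩)
    have h4 : Tendsto (fun p : ℂ × ℝ => ∫ σ in s..1, H p.1 σ) (𝓝 z ×ˢ 𝓝[Ioc 0 1] s)
        (𝓝 (∫ σ in s..1, H z σ)) :=
      (((hhol s hs).differentiableAt (hV.mem_nhds hz)).continuousAt.tendsto).comp tendsto_fst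
    have h5 := h4.sub h2
    rw [sub_zero] at h5
    refine h5.congr' ?_
    filter_upwards [prod_mem_prod (hV.mem_nhds hz) self_mem_nhdsWithin]
    rintro ⟨z', t⟩ ⟨hz', ht⟩
    simp only [Function.uncurry_apply_pair]
    rw [← intervalIntegral.integral_add_adjacent_intervals (hint hz' hs ht) (hint hz' ht h1),
      add_sub_cancel_left]
  · intro z hz s hs
    have hc : ContinuousOn (H z) (Ioc 0 1) := hH.continuousOn_right hz
    rcases hs.2.lt_or_eq with hlt | rfl
    · have hca : ContinuousAt (H z) s := hc.continuousAt (Ioc_mem_nhds hs.1 hlt)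
      refine HasDerivAt.hasDerivWithinAt ?_
      exact intervalIntegral.integral_hasDerivAt_left (hint hz hs h1)
        (hc.stronglyMeasurableAtFilter_nhdsWithin measurableSet_Ioc s |>.filter_mono
          (by rw [nhdsWithin_eq_nhds.mpr (Ioc_mem_nhds hs.1 hlt)])) hca
    -- At the endpoint `1` the integrand is controlled only from the left, so the one-sided
    -- fundamental theorem is used.
    · have : HasDerivWithinAt (fun u => ∫ σ in u..1, H z σ) (-H z 1) (Iic 1) 1 := by
        have hcw : ContinuousWithinAt (H z) (Iic 1) 1 := (hc 1 h1).mono_of_mem_nhdsWithin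
          (mem_of_superset (inter_mem_nhdsWithin (Iic 1) (Ioi_mem_nhds one_pos))
            fun t ht => ⟨ht.2, ht.1⟩)
        refine intervalIntegral.integral_hasDerivWithinAt_left (hint hz h1 h1)
          (t := Iic 1) ?_ hcw
        exact ((hc.stronglyMeasurableAtFilter_nhdsWithin measurableSet_Ioc 1)).filter_mono
          (nhdsWithin_le_of_mem (mem_of_superset
            (inter_mem_nhdsWithin (Iic 1) (Ioi_mem_nhds one_pos)) fun t ht => ⟨ht.2, ht.1⟩))
      exact this.mono fun t ht => ht.2

end Families

/-! ### An explicit primitive of `dx/y` near `O` -/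

section PrimitiveAtInfinity

/-- The cubic `x³ + a x² + b x + c`, in the coordinate `q = 1/x` and divided by `x³`. -/
def revCubic (a b c q : ℂ) : ℂ := 1 + a * q + b * q ^ 2 + c * q ^ 3

/-- A branch of the inverse square root of `revCubic` near `0`. -/
def revCubicInvSqrt (a b c q : ℂ) : ℂ := Complex.exp (-(Complex.log (revCubic a b c q) / 2))

/-- The average of `revCubicInvSqrt` which solves the differential equation
`q T' + T / 2 = - revCubicInvSqrt`. -/
def primitiveFactor (a b c q : ℂ) : ℂ :=
  -2 * ∫ σ in (0 : ℝ)..1, revCubicInvSqrt a b c (q * (σ : ℂ) ^ 2)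

/-- The primitive of `dx/y` near `O` which vanishes at `O`. -/
def primitiveAtO (a b c x y : ℂ) : ℂ :=
  x / y * (revCubic a b c x⁻¹ * revCubicInvSqrt a b c x⁻¹ * primitiveFactor a b c x⁻¹)

/-- The radius depends only on a bound for the coefficients, hence serves all nearby fibres at once.
Each of the three terms is at most `|M| ‖q‖`, which explains the factor `6`. -/
theorem exists_radius_revCubic (M : ℝ) : ∃ r > 0, ∀ a b c : ℂ, ‖a‖ ≤ M → ‖b‖ ≤ M → ‖c‖ ≤ M →
    ∀ q : ℂ, ‖q‖ < r → ‖revCubic a b c q - 1‖ ≤ 1 / 2 := by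
  refine ⟨1 / (6 * (|M| + 1)), by positivity, fun a b c ha hb hc q hq => ?_⟩
  have hM : 0 ≤ |M| := abs_nonneg M
  have hMM := le_abs_self M
  have hq' : ‖q‖ * (6 * (|M| + 1)) < 1 := by rwa [lt_div_iff₀ (by positivity)] at hq
  have hq0 := norm_nonneg q
  have hq1 : ‖q‖ ≤ 1 := by nlinarith
  have hq2 : ‖q‖ ^ 2 ≤ ‖q‖ := by nlinarith
  have hq3 : ‖q‖ ^ 3 ≤ ‖q‖ := by nlinarith [pow_nonneg hq0 2]
  have h1 : revCubic a b c q - 1 = a * q + b * q ^ 2 + c * q ^ 3 := by unfold revCubic; ring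
  rw [h1]
  calc ‖a * q + b * q ^ 2 + c * q ^ 3‖ ≤ ‖a‖ * ‖q‖ + ‖b‖ * ‖q‖ ^ 2 + ‖c‖ * ‖q‖ ^ 3 := by
        refine (norm_add₃_le).trans ?_
        simp
    _ ≤ |M| * ‖q‖ + |M| * ‖q‖ + |M| * ‖q‖ := by
        gcongr
        · exact ha.trans hMM
        · exact hb.trans hMM
        · exact hc.trans hMM
    _ ≤ 1 / 2 := by nlinarith

variable {a b c : ℂ} {r : ℝ}

theorem revCubic_mem_slitPlane {q : ℂ} (h : ‖revCubic a b c q - 1‖ ≤ 1 / 2) :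
    revCubic a b c q ∈ Complex.slitPlane := by
  left
  have := (Complex.abs_re_le_norm (revCubic a b c q - 1)).trans h
  rw [Complex.sub_re, Complex.one_re] at this
  linarith [(abs_le.mp this).1]

theorem half_le_norm_revCubic {q : ℂ} (h : ‖revCubic a b c q - 1‖ ≤ 1 / 2) :
    1 / 2 ≤ ‖revCubic a b c q‖ := by
  have := norm_sub_norm_le 1 (revCubic a b c q)
  rw [norm_one, norm_sub_rev] at this
  linarith

theorem norm_revCubic_le {q : ℂ} (h : ‖revCubic a b c q - 1‖ ≤ 1 / 2) :
    ‖revCubic a b c q‖ ≤ 3 / 2 := by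
  have := norm_sub_norm_le (revCubic a b c q) 1
  rw [norm_one] at this
  linarith

theorem revCubicInvSqrt_sq_mul {q : ℂ} (h : ‖revCubic a b c q - 1‖ ≤ 1 / 2) :
    revCubicInvSqrt a b c q ^ 2 * revCubic a b c q = 1 := by
  have h0 := Complex.slitPlane_ne_zero (revCubic_mem_slitPlane h)
  rw [revCubicInvSqrt, ← Complex.exp_nat_mul]
  push_cast
  rw [show 2 * -(Complex.log (revCubic a b c q) / 2) = -Complex.log (revCubic a b c q) by ring,
    Complex.exp_neg, Complex.exp_log h0, inv_mul_cancel₀ h0]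

theorem norm_revCubicInvSqrt_le {q : ℂ} (h : ‖revCubic a b c q - 1‖ ≤ 1 / 2) :
    ‖revCubicInvSqrt a b c q‖ ≤ 2 := by
  have h1 := congrArg norm (revCubicInvSqrt_sq_mul h)
  rw [norm_mul, norm_pow, norm_one] at h1
  have h2 := half_le_norm_revCubic h
  have h3 := norm_nonneg (revCubicInvSqrt a b c q)
  by_contra! hlt
  nlinarith [pow_lt_pow_left₀ hlt (by norm_num) two_ne_zero]

theorem hasDerivAt_revCubic (q : ℂ) :
    HasDerivAt (revCubic a b c) (a + 2 * b * q + 3 * c * q ^ 2) q := by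
  have h := (((hasDerivAt_id q).const_mul a).const_add 1).add
    (((hasDerivAt_pow 2 q).const_mul b).add ((hasDerivAt_pow 3 q).const_mul c))
  refine (h.congr_deriv ?_).congr_of_eventuallyEq (Eventually.of_forall fun q => ?_)
  · push_cast; ring
  · simp [revCubic]; ring

theorem hasDerivAt_revCubicInvSqrt {q : ℂ} (h : ‖revCubic a b c q - 1‖ ≤ 1 / 2) :
    HasDerivAt (revCubicInvSqrt a b c) (-(a + 2 * b * q + 3 * c * q ^ 2) / (2 * revCubic a b c q) *
      revCubicInvSqrt a b c q) q := by
  have h1 := (((hasDerivAt_revCubic (a := a) (b := b) (c := c) q).clog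
    (revCubic_mem_slitPlane h)).div_const 2).neg.cexp
  refine h1.congr_deriv ?_
  have h0 := Complex.slitPlane_ne_zero (revCubic_mem_slitPlane h)
  rw [revCubicInvSqrt]
  simp only [Pi.neg_apply]
  field_simp

theorem norm_mul_sq_lt {q : ℂ} (hq : ‖q‖ < r) {σ : ℝ} (hσ : σ ∈ Icc (0 : ℝ) 1) :
    ‖q * (σ : ℂ) ^ 2‖ < r := by
  refine lt_of_le_of_lt ?_ hq
  rw [norm_mul, norm_pow, Complex.norm_real, Real.norm_of_nonneg hσ.1]
  exact mul_le_of_le_one_right (norm_nonneg q) (pow_le_one₀ hσ.1 hσ.2)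

theorem norm_primitiveFactor_le (hr : ∀ q, ‖q‖ < r → ‖revCubic a b c q - 1‖ ≤ 1 / 2) {q : ℂ}
    (hq : ‖q‖ < r) : ‖primitiveFactor a b c q‖ ≤ 4 := by
  have h1 : ‖∫ σ in (0 : ℝ)..1, revCubicInvSqrt a b c (q * (σ : ℂ) ^ 2)‖ ≤ 2 * |(1 : ℝ) - 0| := by
    refine intervalIntegral.norm_integral_le_of_norm_le_const fun σ hσ => ?_
    rw [uIoc_of_le zero_le_one] at hσ
    exact norm_revCubicInvSqrt_le (hr _ (norm_mul_sq_lt hq ⟨hσ.1.le, hσ.2⟩))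
  rw [primitiveFactor, norm_mul, norm_neg, Complex.norm_ofNat]
  norm_num at h1 ⊢
  linarith

/-- With `k = revCubicInvSqrt`, integrate `d/dσ (σ k(qσ²)) = k(qσ²) + 2qσ² k'(qσ²)` over `[0, 1]`:
the left side gives `k(q)`, and the right side is `-(q T' + T/2)` for `T = -2 ∫ k(qσ²) dσ`. -/
theorem exists_hasDerivAt_primitiveFactor
    (hr : ∀ q, ‖q‖ < r → ‖revCubic a b c q - 1‖ ≤ 1 / 2) {q : ℂ} (hq : ‖q‖ < r) :
    ∃ d, HasDerivAt (primitiveFactor a b c) d q ∧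
      q * d + primitiveFactor a b c q / 2 = - revCubicInvSqrt a b c q := by
  set k := revCubicInvSqrt a b c with hk
  have hdiff : DifferentiableOn ℂ k (Metric.ball 0 r) := fun x hx =>
    (hasDerivAt_revCubicInvSqrt (hr x (mem_ball_zero_iff.mp hx))).differentiableAt.differentiableWithinAt
  have hk' : ∀ x, ‖x‖ < r → HasDerivAt k (deriv k x) x := fun x hx =>
    (hdiff.differentiableAt (Metric.isOpen_ball.mem_nhds (mem_ball_zero_iff.mpr hx))).hasDerivAt
  have hdk : ContinuousOn (deriv k) (Metric.ball 0 r) :=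
    (hdiff.deriv Metric.isOpen_ball).continuousOn
  have hcont : ContinuousOn (fun p : ℂ × ℝ => p.1 * (p.2 : ℂ) ^ 2) (Metric.ball 0 r ×ˢ Icc 0 1) := by
    fun_prop
  have hmaps : MapsTo (fun p : ℂ × ℝ => p.1 * (p.2 : ℂ) ^ 2) (Metric.ball 0 r ×ˢ Icc 0 1)
      (Metric.ball 0 r) := fun p hp =>
    mem_ball_zero_iff.mpr (norm_mul_sq_lt (mem_ball_zero_iff.mp hp.1) hp.2)
  have hder : ∀ σ ∈ Icc (0 : ℝ) 1, ∀ x : ℂ, ‖x‖ < r →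
      HasDerivAt (fun z : ℂ => k (z * (σ : ℂ) ^ 2)) (deriv k (x * (σ : ℂ) ^ 2) * (σ : ℂ) ^ 2) x := by
    intro σ hσ x hx
    refine HasDerivAt.comp (h₂ := k) x (hk' _ (norm_mul_sq_lt hx hσ)) ?_
    simpa using (hasDerivAt_id x).mul_const ((σ : ℂ) ^ 2)
  have hfam : HolFamily (Metric.ball 0 r) (Icc 0 1) (fun z σ => k (z * (σ : ℂ) ^ 2)) := by
    refine ⟨hdiff.continuousOn.comp hcont hmaps, fun σ hσ x hx => ?_⟩
    exact (hder σ hσ x (mem_ball_zero_iff.mp hx)).differentiableAt.differentiableWithinAt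
  have hint := hfam.hasDerivAt_integral Metric.isOpen_ball (a := 0) (b := 1)
    (by rw [uIcc_of_le zero_le_one]) (mem_ball_zero_iff.mpr hq)
  refine ⟨_, hint.const_mul (-2), ?_⟩
  have hdz : ∀ σ ∈ Icc (0 : ℝ) 1, dz (fun z (σ : ℝ) => k (z * (σ : ℂ) ^ 2)) q σ =
      deriv k (q * (σ : ℂ) ^ 2) * (σ : ℂ) ^ 2 := fun σ hσ => (hder σ hσ q hq).deriv
  have hcs : ContinuousOn (fun σ : ℝ => q * (σ : ℂ) ^ 2) (Icc 0 1) := by fun_prop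
  have hms : MapsTo (fun σ : ℝ => q * (σ : ℂ) ^ 2) (Icc 0 1) (Metric.ball 0 r) := fun σ hσ =>
    mem_ball_zero_iff.mpr (norm_mul_sq_lt hq hσ)
  have hc1 : ContinuousOn (fun σ : ℝ => deriv k (q * (σ : ℂ) ^ 2) * (σ : ℂ) ^ 2) (Icc 0 1) :=
    (hdk.comp hcs hms).mul (by fun_prop)
  have hc2 : ContinuousOn (fun σ : ℝ => k (q * (σ : ℂ) ^ 2)) (Icc 0 1) :=
    hdiff.continuousOn.comp hcs hms
  have hu : uIcc (0 : ℝ) 1 = Icc 0 1 := uIcc_of_le zero_le_one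
  have hftc : ∫ σ in (0 : ℝ)..1, (2 * q * (deriv k (q * (σ : ℂ) ^ 2) * (σ : ℂ) ^ 2) +
      k (q * (σ : ℂ) ^ 2)) = k q := by
    rw [intervalIntegral.integral_eq_sub_of_hasDerivAt
      (f := fun σ : ℝ => (σ : ℂ) * k (q * (σ : ℂ) ^ 2))]
    · simp
    · intro σ hσ
      rw [hu] at hσ
      have h1 : HasDerivAt (fun σ : ℝ => (σ : ℂ)) 1 σ := Complex.ofRealCLM.hasDerivAt
      have h2 : HasDerivAt (fun σ : ℝ => q * (σ : ℂ) ^ 2) (q * (2 * σ)) σ := by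
        refine ((h1.pow 2).const_mul q).congr_deriv ?_
        simp
      have h3 := HasDerivAt.comp (h₂ := k) σ (hk' _ (norm_mul_sq_lt hq hσ)) h2
      refine (h1.mul h3).congr_deriv ?_
      simp only [Function.comp_apply]
      ring
    · refine ContinuousOn.intervalIntegrable ?_
      rw [hu]
      exact (continuousOn_const.mul hc1).add hc2
  rw [intervalIntegral.integral_congr (g := fun σ : ℝ => deriv k (q * (σ : ℂ) ^ 2) * (σ : ℂ) ^ 2)
    (fun σ hσ => hdz σ (hu ▸ hσ))]
  rw [intervalIntegral.integral_add, intervalIntegral.integral_const_mul] at hftc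
  · rw [primitiveFactor, ← hk]
    linear_combination -hftc
  · exact ((continuousOn_const.mul hc1).mono hu.le).intervalIntegrable
  · exact (hc2.mono hu.le).intervalIntegrable

/-- With `q = 1/x` and `y² = φ(q) x³`, the factor `(x/y) φ k` squares to `q`. It is the branch of
`√q` selected by `y`, so no root of `q` has to be chosen. The primitive is `√q T(q)`, and `q T' +
T/2 = -k` turns its differential into `-k dq/√q = dx/y`. -/
theorem hasDerivWithinAt_primitiveAtO (hr : ∀ q, ‖q‖ < r → ‖revCubic a b c q - 1‖ ≤ 1 / 2)
    {X Y : ℝ → ℂ} {Xs Ys : ℂ} {J : Set ℝ} {s : ℝ} (hX : HasDerivWithinAt X Xs J s)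
    (hY : HasDerivWithinAt Y Ys J s) (hX0 : X s ≠ 0) (hXr : ‖(X s)⁻¹‖ < r) (hY0 : Y s ≠ 0)
    (heq : Y s ^ 2 = X s ^ 3 + a * X s ^ 2 + b * X s + c)
    (heq' : 2 * Y s * Ys = (3 * X s ^ 2 + 2 * a * X s + b) * Xs) :
    HasDerivWithinAt (fun s => primitiveAtO a b c (X s) (Y s)) (Xs / Y s) J s := by
  obtain ⟨d, hd, hode⟩ := exists_hasDerivAt_primitiveFactor hr hXr
  have hq := hX.inv hX0
  have h1 := ((hasDerivAt_revCubic (a := a) (b := b) (c := c) (X s)⁻¹).comp_hasDerivWithinAt s hq)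
  have h2 := ((hasDerivAt_revCubicInvSqrt (hr _ hXr)).comp_hasDerivWithinAt s hq)
  have h3 := hd.comp_hasDerivWithinAt s hq
  refine ((hX.div hY hY0).mul ((h1.mul h2).mul h3)).congr_deriv ?_
  have hφ0 := Complex.slitPlane_ne_zero (revCubic_mem_slitPlane (hr _ hXr))
  have hk := revCubicInvSqrt_sq_mul (hr _ hXr)
  simp only [Function.comp_apply, Pi.div_apply, Pi.mul_apply]
  have hφ : revCubic a b c (X s)⁻¹ * X s ^ 3 = Y s ^ 2 := by
    rw [heq, revCubic]; field_simp
  generalize primitiveFactor a b c (X s)⁻¹ = T at *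
  generalize revCubicInvSqrt a b c (X s)⁻¹ = k at *
  have hφ' : (X s)⁻¹ * (a + 2 * b * (X s)⁻¹ + 3 * c * (X s)⁻¹ ^ 2) =
      3 * revCubic a b c (X s)⁻¹ - (3 + 2 * a * (X s)⁻¹ + b * (X s)⁻¹ ^ 2) := by
    rw [revCubic]; ring
  generalize a + 2 * b * (X s)⁻¹ + 3 * c * (X s)⁻¹ ^ 2 = φ' at *
  generalize revCubic a b c (X s)⁻¹ = φ at *
  have hYs : Ys = (3 * X s ^ 2 + 2 * a * X s + b) * Xs / (2 * Y s) := by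
    field_simp; linear_combination heq'
  have e1 : (Xs * Y s - X s * Ys) / Y s ^ 2 =
      Xs / Y s * (-1 / 2 + (X s)⁻¹ * φ' / (2 * φ)) := by
    rw [hφ', hYs]
    field_simp
    rw [← hφ]
    field_simp
    ring
  rw [e1]
  have hd' : (X s)⁻¹ * d = -k - T / 2 := by linear_combination hode
  generalize hXi : (X s)⁻¹ = q at *
  have hXs2 : -Xs / X s ^ 2 = -Xs * q ^ 2 := by rw [← hXi]; field_simp
  have hXq : X s * q = 1 := by rw [← hXi]; field_simp
  rw [hXs2]
  have e3 : (-1 / 2 + q * φ' / (2 * φ)) * (φ * k * T) =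
      -1 / 2 * φ * k * T + q * φ' * k * T / 2 := by field_simp
  have e5 : φ * (φ' * k / (2 * φ)) = φ' * k / 2 := by field_simp
  linear_combination (Xs / Y s) * e3 + (Xs / Y s) * hk +
    X s / Y s * Xs * q ^ 2 * T * e5 - (Xs / Y s) * φ * k * hd' +
    (Xs / Y s) * q * (-φ' * k * T / 2 - φ * k * d) * hXq

theorem norm_primitiveAtO_le (hr : ∀ q, ‖q‖ < r → ‖revCubic a b c q - 1‖ ≤ 1 / 2) {x y : ℂ}
    (hx : ‖x⁻¹‖ < r) : ‖primitiveAtO a b c x y‖ ≤ 12 * ‖x / y‖ := by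
  rw [primitiveAtO, norm_mul, norm_mul, norm_mul]
  have h1 := norm_revCubic_le (hr _ hx)
  have h2 := norm_revCubicInvSqrt_le (hr _ hx)
  have h3 := norm_primitiveFactor_le hr hx
  calc _ ≤ ‖x / y‖ * (3 / 2 * 2 * 4) := by gcongr
    _ = _ := by ring

end PrimitiveAtInfinity

/-! ### Convergence of the integral at `O`, with a uniform bound -/

section Tail

theorem two_mul_mul_eq_of_hasDerivWithinAt {a b c : ℂ} {X Y : ℝ → ℂ} {Xs Ys : ℂ} {J : Set ℝ} {s : ℝ}
    (hJ : UniqueDiffWithinAt ℝ J s) (hs : s ∈ J) (hX : HasDerivWithinAt X Xs J s)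
    (hY : HasDerivWithinAt Y Ys J s)
    (heq : ∀ s ∈ J, Y s ^ 2 = X s ^ 3 + a * X s ^ 2 + b * X s + c) :
    2 * Y s * Ys = (3 * X s ^ 2 + 2 * a * X s + b) * Xs := by
  have h1 := hY.pow 2
  have h2 := (((hX.pow 3).add ((hX.pow 2).const_mul a)).add (hX.const_mul b)).add_const c
  have h3 := (h2.congr (f₁ := fun s => Y s ^ 2) (fun t ht => heq t ht) (heq s hs))
  have h4 := hJ.eq_deriv _ h1 h3
  push_cast at h4
  linear_combination h4

/-- Wherever `|X| > 1/r`, the function `T` and the primitive at `O` have opposite derivatives, so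
their sum is constant. The primitive tends to `0` at `O`, hence `T` converges and its distance to
the limit is the size of the primitive. The bound mentions the fibre only through `x/y`, and so
yields uniformity in families. -/
theorem tail_integral {a b c : ℂ} {r : ℝ} (hr0 : 0 < r)
    (hr : ∀ q, ‖q‖ < r → ‖revCubic a b c q - 1‖ ≤ 1 / 2) {X Y Xs Ys T : ℝ → ℂ}
    (hX : ∀ s ∈ Ioc (0 : ℝ) 1, HasDerivWithinAt X (Xs s) (Ioc 0 1) s)
    (hY : ∀ s ∈ Ioc (0 : ℝ) 1, HasDerivWithinAt Y (Ys s) (Ioc 0 1) s)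
    (heq : ∀ s ∈ Ioc (0 : ℝ) 1, Y s ^ 2 = X s ^ 3 + a * X s ^ 2 + b * X s + c)
    (hY0 : ∀ s ∈ Ioc (0 : ℝ) 1, Y s ≠ 0)
    (hT : ∀ s ∈ Ioc (0 : ℝ) 1, HasDerivWithinAt T (-(Xs s / Y s)) (Ioc 0 1) s)
    (hstart : Tendsto X (𝓝[>] 0) (Bornology.cobounded ℂ)) :
    ∃ w, Tendsto T (𝓝[>] 0) (𝓝 w) ∧ ∀ s₀ ∈ Ioc (0 : ℝ) 1, (∀ s ∈ Ioc 0 s₀, r⁻¹ < ‖X s‖) →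
      ‖T s₀ - w‖ ≤ 12 * ‖X s₀ / Y s₀‖ := by
  have hlarge : ∀ {x : ℂ}, r⁻¹ < ‖x‖ → x ≠ 0 ∧ ‖x⁻¹‖ < r := by
    intro x hx
    have hx0 : 0 < ‖x‖ := (inv_pos.mpr hr0).trans hx
    refine ⟨norm_pos_iff.mp hx0, ?_⟩
    rw [norm_inv]
    exact inv_lt_of_inv_lt₀ hr0 hx
  have hconst : ∀ s₀ ∈ Ioc (0 : ℝ) 1, (∀ s ∈ Ioc 0 s₀, r⁻¹ < ‖X s‖) → ∀ s ∈ Ioc 0 s₀,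
      T s + primitiveAtO a b c (X s) (Y s) = T s₀ + primitiveAtO a b c (X s₀) (Y s₀) := by
    intro s₀ hs₀ hbig s hs
    have hsub : Ioc 0 s₀ ⊆ Ioc (0 : ℝ) 1 := Ioc_subset_Ioc_right hs₀.2
    have hder : ∀ σ ∈ Ioc 0 s₀, HasDerivWithinAt
        (fun s => T s + primitiveAtO a b c (X s) (Y s)) 0 (Ioc 0 s₀) σ := by
      intro σ hσ
      have h1 := hasDerivWithinAt_primitiveAtO hr (hX σ (hsub hσ)) (hY σ (hsub hσ))
        (hlarge (hbig σ hσ)).1 (hlarge (hbig σ hσ)).2 (hY0 σ (hsub hσ)) (heq σ (hsub hσ))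
        (two_mul_mul_eq_of_hasDerivWithinAt (uniqueDiffOn_Ioc 0 1 σ (hsub hσ)) (hsub hσ)
          (hX σ (hsub hσ)) (hY σ (hsub hσ)) heq)
      have h2 := ((hT σ (hsub hσ)).add h1).mono hsub
      rwa [neg_add_cancel] at h2
    have := (convex_Ioc 0 s₀).norm_image_sub_le_of_norm_hasDerivWithin_le (C := 0) hder
      (by simp) (⟨hs₀.1, le_rfl⟩ : s₀ ∈ Ioc 0 s₀) hs
    rw [zero_mul, norm_le_zero_iff, sub_eq_zero] at this
    exact this
  have hev : ∀ᶠ s in 𝓝[>] (0 : ℝ), r⁻¹ < ‖X s‖ :=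
    (tendsto_norm_cobounded_atTop.comp hstart).eventually_gt_atTop _
  obtain ⟨s₁, hs₁, hs₁'⟩ := mem_nhdsGT_iff_exists_Ioc_subset.mp hev
  have hs₁pos : 0 < s₁ := hs₁
  have hs₂ : min s₁ 1 ∈ Ioc (0 : ℝ) 1 := ⟨lt_min hs₁pos one_pos, min_le_right _ _⟩
  have hbig₂ : ∀ s ∈ Ioc 0 (min s₁ 1), r⁻¹ < ‖X s‖ := fun s hs =>
    hs₁' ⟨hs.1, hs.2.trans (min_le_left _ _)⟩
  have hmem : ∀ᶠ s in 𝓝[>] (0 : ℝ), s ∈ Ioc 0 (min s₁ 1) := Ioc_mem_nhdsGT hs₂.1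
  -- `(x/y)² = q/φ(q)` with `q = 1/x` and `|φ(q)| ≥ 1/2`, hence `|x/y| ≤ √(2|q|)`.
  have hXY : Tendsto (fun s => ‖X s / Y s‖) (𝓝[>] 0) (𝓝 0) := by
    have hq : Tendsto (fun s => Real.sqrt (2 * ‖(X s)⁻¹‖)) (𝓝[>] 0) (𝓝 0) := by
      have h1 := ((tendsto_inv₀_cobounded (α := ℂ)).comp hstart).norm.const_mul 2
      have h2 := h1.sqrt
      simpa using h2
    refine squeeze_zero' (Eventually.of_forall fun _ => norm_nonneg _) ?_ hq
    filter_upwards [hmem] with s hs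
    have hsJ : s ∈ Ioc (0 : ℝ) 1 := ⟨hs.1, hs.2.trans hs₂.2⟩
    obtain ⟨hX0, hXr⟩ := hlarge (hbig₂ s hs)
    apply Real.le_sqrt_of_sq_le
    have hφ := half_le_norm_revCubic (hr _ hXr)
    have hφ0 := Complex.slitPlane_ne_zero (revCubic_mem_slitPlane (hr _ hXr))
    have h3 : (X s / Y s) ^ 2 = (X s)⁻¹ / revCubic a b c (X s)⁻¹ := by
      have h4 : revCubic a b c (X s)⁻¹ * X s ^ 3 = Y s ^ 2 := by
        rw [heq s hsJ, revCubic]; field_simp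
      rw [div_pow, ← h4]
      field_simp
    rw [← norm_pow, h3, norm_div, div_le_iff₀ (by linarith)]
    nlinarith [norm_nonneg (X s)⁻¹]
  have hG : Tendsto (fun s => primitiveAtO a b c (X s) (Y s)) (𝓝[>] 0) (𝓝 0) := by
    have h12 := hXY.const_mul 12
    rw [mul_zero] at h12
    refine squeeze_zero_norm' ?_ h12
    filter_upwards [hmem] with s hs
    exact norm_primitiveAtO_le hr (hlarge (hbig₂ s hs)).2
  set w := T (min s₁ 1) + primitiveAtO a b c (X (min s₁ 1)) (Y (min s₁ 1)) with hw
  have hTw : Tendsto T (𝓝[>] 0) (𝓝 w) := by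
    have h1 := (tendsto_const_nhds (x := w)).sub hG
    rw [sub_zero] at h1
    refine h1.congr' ?_
    filter_upwards [hmem] with s hs
    rw [hw, ← hconst _ hs₂ hbig₂ s hs, add_sub_cancel_right]
  refine ⟨w, hTw, fun s₀ hs₀ hbig => ?_⟩
  have hw' : w = T s₀ + primitiveAtO a b c (X s₀) (Y s₀) := by
    have h1 := hTw.add hG
    rw [add_zero] at h1
    refine tendsto_nhds_unique h1 (tendsto_const_nhds.congr' ?_)
    filter_upwards [Ioc_mem_nhdsGT hs₀.1] with s hs
    exact (hconst s₀ hs₀ hbig s hs).symm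
  rw [hw', sub_add_cancel_left, norm_neg]
  exact norm_primitiveAtO_le hr (hlarge (hbig s₀ ⟨hs₀.1, le_rfl⟩)).2

end Tail

/-! ### Asymptotics at `O` along a family of paths -/

section PathData

/-- A family of paths from `O` in the curves `y² = x³ + a x² + b x + c`, varying holomorphically
with `z ∈ V`. -/
structure PathData (V : Set ℂ) (a b c : ℂ → ℂ) (X Xs Y Ys : ℂ → ℝ → ℂ) : Prop where
  isOpen : IsOpen V
  diff_a : DifferentiableOn ℂ a V
  diff_b : DifferentiableOn ℂ b V
  diff_c : DifferentiableOn ℂ c V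
  famX : C1Family V (Ioc 0 1) X Xs
  famY : C1Family V (Ioc 0 1) Y Ys
  eqn : ∀ z ∈ V, ∀ s ∈ Ioc (0 : ℝ) 1,
    Y z s ^ 2 = X z s ^ 3 + a z * X z s ^ 2 + b z * X z s + c z
  ne_zero : ∀ z ∈ V, ∀ s ∈ Ioc (0 : ℝ) 1, Y z s ≠ 0
  start : ∀ z ∈ V, Tendsto (Function.uncurry X) (𝓝 z ×ˢ 𝓝[>] 0) (Bornology.cobounded ℂ)

namespace PathData

variable {V : Set ℂ} {a b c : ℂ → ℂ} {X Xs Y Ys : ℂ → ℝ → ℂ}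

theorem eqn_deriv_s (h : PathData V a b c X Xs Y Ys) {z : ℂ} (hz : z ∈ V) {s : ℝ}
    (hs : s ∈ Ioc (0 : ℝ) 1) :
    2 * Y z s * Ys z s = (3 * X z s ^ 2 + 2 * a z * X z s + b z) * Xs z s :=
  two_mul_mul_eq_of_hasDerivWithinAt (uniqueDiffOn_Ioc 0 1 s hs) hs (h.famX.hasDeriv z hz s hs)
    (h.famY.hasDeriv z hz s hs) (h.eqn z hz)

theorem eqn_deriv_z (h : PathData V a b c X Xs Y Ys) {z : ℂ} (hz : z ∈ V) {s : ℝ}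
    (hs : s ∈ Ioc (0 : ℝ) 1) :
    2 * Y z s * dz Y z s = (3 * X z s ^ 2 + 2 * a z * X z s + b z) * dz X z s +
      (deriv a z * X z s ^ 2 + deriv b z * X z s + deriv c z) := by
  have hV := h.isOpen.mem_nhds hz
  have hX := h.famX.toHolFamily.hasDerivAt h.isOpen hz hs
  have hY := h.famY.toHolFamily.hasDerivAt h.isOpen hz hs
  have ha := (h.diff_a.differentiableAt hV).hasDerivAt
  have hb := (h.diff_b.differentiableAt hV).hasDerivAt
  have hc := (h.diff_c.differentiableAt hV).hasDerivAt
  have h1 := hY.pow 2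
  have h2 := (((hX.pow 3).add (ha.mul (hX.pow 2))).add (hb.mul hX)).add hc
  have h3 := h2.congr_of_eventuallyEq (f₁ := fun z => Y z s ^ 2) (by
    filter_upwards [hV] with z hz using h.eqn z hz s hs)
  have h4 := h1.unique h3
  push_cast at h4
  simp only [Pi.pow_apply] at h4
  linear_combination h4

theorem eventually_mem (h : PathData V a b c X Xs Y Ys) {z : ℂ} (hz : z ∈ V) :
    ∀ᶠ p : ℂ × ℝ in 𝓝 z ×ˢ 𝓝[>] 0, p.1 ∈ V ∧ p.2 ∈ Ioc (0 : ℝ) 1 ∧ X p.1 p.2 ≠ 0 := by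
  have h1 := (h.start z hz).eventually (Bornology.eventually_ne_cobounded 0)
  filter_upwards [h1, prod_mem_prod (h.isOpen.mem_nhds hz) (Ioc_mem_nhdsGT (one_pos (α := ℝ)))]
    with p hp hp'
  exact ⟨hp'.1, hp'.2, hp⟩

theorem tendsto_inv_X (h : PathData V a b c X Xs Y Ys) {z : ℂ} (hz : z ∈ V) :
    Tendsto (fun p : ℂ × ℝ => (X p.1 p.2)⁻¹) (𝓝 z ×ˢ 𝓝[>] 0) (𝓝 0) :=
  tendsto_inv₀_cobounded.comp (h.start z hz)

theorem tendsto_coeff {f : ℂ → ℂ} (hV : IsOpen V) (hf : DifferentiableOn ℂ f V) {z : ℂ}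
    (hz : z ∈ V) : Tendsto (fun p : ℂ × ℝ => f p.1) (𝓝 z ×ˢ 𝓝[>] 0) (𝓝 (f z)) :=
  ((hf.differentiableAt (hV.mem_nhds hz)).continuousAt.tendsto).comp tendsto_fst

theorem tendsto_revCubic (h : PathData V a b c X Xs Y Ys) {z : ℂ} (hz : z ∈ V) :
    Tendsto (fun p : ℂ × ℝ => revCubic (a p.1) (b p.1) (c p.1) (X p.1 p.2)⁻¹)
      (𝓝 z ×ˢ 𝓝[>] 0) (𝓝 1) := by
  have hq := h.tendsto_inv_X hz
  have ha := tendsto_coeff h.isOpen h.diff_a hz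
  have hb := tendsto_coeff h.isOpen h.diff_b hz
  have hc := tendsto_coeff h.isOpen h.diff_c hz
  have := (((tendsto_const_nhds (x := (1 : ℂ))).add (ha.mul hq)).add (hb.mul (hq.pow 2))).add
    (hc.mul (hq.pow 3))
  simpa [revCubic] using this

theorem revCubic_mul (h : PathData V a b c X Xs Y Ys) {z : ℂ} (hz : z ∈ V) {s : ℝ}
    (hs : s ∈ Ioc (0 : ℝ) 1) (hX : X z s ≠ 0) :
    revCubic (a z) (b z) (c z) (X z s)⁻¹ * X z s ^ 3 = Y z s ^ 2 := by
  rw [h.eqn z hz s hs, revCubic]; field_simp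

theorem revCubic_ne_zero (h : PathData V a b c X Xs Y Ys) {z : ℂ} (hz : z ∈ V) {s : ℝ}
    (hs : s ∈ Ioc (0 : ℝ) 1) (hX : X z s ≠ 0) :
    revCubic (a z) (b z) (c z) (X z s)⁻¹ ≠ 0 := by
  intro h0
  have := h.revCubic_mul hz hs hX
  rw [h0, zero_mul] at this
  exact h.ne_zero z hz s hs (pow_eq_zero_iff two_ne_zero |>.mp this.symm)

/-- The local parameter `x/y` at `O` tends to `0` along the paths. -/
theorem tendsto_X_div_Y (h : PathData V a b c X Xs Y Ys) {z : ℂ} (hz : z ∈ V) :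
    Tendsto (fun p : ℂ × ℝ => X p.1 p.2 / Y p.1 p.2) (𝓝 z ×ˢ 𝓝[>] 0) (𝓝 0) := by
  have h1 := ((h.tendsto_inv_X hz).div (h.tendsto_revCubic hz) one_ne_zero).norm.sqrt
  simp only [zero_div, norm_zero, Real.sqrt_zero] at h1
  rw [tendsto_zero_iff_norm_tendsto_zero]
  refine h1.congr' ?_
  filter_upwards [h.eventually_mem hz] with p hp
  have h2 : (X p.1 p.2)⁻¹ / revCubic (a p.1) (b p.1) (c p.1) (X p.1 p.2)⁻¹ =
      (X p.1 p.2 / Y p.1 p.2) ^ 2 := by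
    have h3 := h.revCubic_mul hp.1 hp.2.1 hp.2.2
    have h4 := h.revCubic_ne_zero hp.1 hp.2.1 hp.2.2
    have h5 := hp.2.2
    rw [div_pow, ← h3]
    field_simp
  rw [Pi.div_apply, h2, norm_pow, Real.sqrt_sq (norm_nonneg _)]

theorem tendsto_dz {H : ℂ → ℝ → ℂ} (hV : IsOpen V) (hH : HolFamily V (Ioc 0 1) H)
    (h0 : ∀ z ∈ V, Tendsto (fun p : ℂ × ℝ => H p.1 p.2) (𝓝 z ×ˢ 𝓝[>] 0) (𝓝 0)) {z : ℂ}
    (hz : z ∈ V) : Tendsto (fun p : ℂ × ℝ => dz H p.1 p.2) (𝓝 z ×ˢ 𝓝[>] 0) (𝓝 0) := by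
  have := (differentiableOn_and_tendsto_dz_sub (l := 𝓝[>] (0 : ℝ)) hV (F := H) (f := fun _ => 0)
    (by filter_upwards [Ioc_mem_nhdsGT (one_pos (α := ℝ))] with s hs using hH.hol s hs)
    (by simpa using h0)).2 z hz
  simpa using this

/-- The numerator has a pole of order at most `4` at `O`, the denominator one of order `6`. -/
theorem tendsto_quadratic_div {d e f : ℂ → ℂ} (h : PathData V a b c X Xs Y Ys)
    (hd : DifferentiableOn ℂ d V) (he : DifferentiableOn ℂ e V) (hf : DifferentiableOn ℂ f V)
    {z : ℂ} (hz : z ∈ V) :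
    Tendsto (fun p : ℂ × ℝ => (d p.1 * X p.1 p.2 ^ 2 + e p.1 * X p.1 p.2 + f p.1) /
      Y p.1 p.2 ^ 2) (𝓝 z ×ˢ 𝓝[>] 0) (𝓝 0) := by
  have hq := h.tendsto_inv_X hz
  have h1 := ((((tendsto_coeff h.isOpen hd hz).mul hq).add
    ((tendsto_coeff h.isOpen he hz).mul (hq.pow 2))).add
    ((tendsto_coeff h.isOpen hf hz).mul (hq.pow 3))).div (h.tendsto_revCubic hz) one_ne_zero
  simp only [mul_zero, ne_eq, OfNat.ofNat_ne_zero, not_false_eq_true, zero_pow, add_zero,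
    zero_div] at h1
  refine h1.congr' ?_
  filter_upwards [h.eventually_mem hz] with p hp
  have h3 := h.revCubic_mul hp.1 hp.2.1 hp.2.2
  have h4 := h.revCubic_ne_zero hp.1 hp.2.1 hp.2.2
  have h5 := hp.2.2
  rw [← h3, Pi.div_apply]
  field_simp

/-- Weierstrass applies to `u = X/Y`, which tends to `0`, but not to `X`. Writing `f_z` for the
derivative of the coefficients, `∂u = (∂X/Y)(1 - X f'/(2Y²)) - u f_z/(2Y²)`. The bracket tends to `1
- 3/2 = -1/2`, so the equation can be solved for `∂X/Y`. -/
theorem tendsto_dz_X_div_Y (h : PathData V a b c X Xs Y Ys) {z : ℂ} (hz : z ∈ V) :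
    Tendsto (fun p : ℂ × ℝ => dz X p.1 p.2 / Y p.1 p.2) (𝓝 z ×ˢ 𝓝[>] 0) (𝓝 0) := by
  have hV := h.isOpen
  have hu := h.tendsto_X_div_Y hz
  have hdu := tendsto_dz hV (h.famX.toHolFamily.div h.famY.toHolFamily h.ne_zero)
    (fun z hz => h.tendsto_X_div_Y hz) hz
  have hq := h.tendsto_inv_X hz
  have hfz := h.tendsto_quadratic_div (h.diff_a.deriv hV) (h.diff_b.deriv hV) (h.diff_c.deriv hV) hz
  -- the logarithmic derivative `x f' / (2 f)` tends to `3/2`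
  have hlog : Tendsto (fun p : ℂ × ℝ => 1 - (3 + 2 * a p.1 * (X p.1 p.2)⁻¹ +
      b p.1 * (X p.1 p.2)⁻¹ ^ 2) / (2 * revCubic (a p.1) (b p.1) (c p.1) (X p.1 p.2)⁻¹))
      (𝓝 z ×ˢ 𝓝[>] 0) (𝓝 (-1 / 2)) := by
    have h1 := (((tendsto_const_nhds (x := (3 : ℂ))).add
      (((tendsto_coeff hV h.diff_a hz).const_mul 2).mul hq)).add
      ((tendsto_coeff hV h.diff_b hz).mul (hq.pow 2))).div
      ((h.tendsto_revCubic hz).const_mul 2) (by norm_num)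
    have h2 := (tendsto_const_nhds (x := (1 : ℂ))).sub h1
    rw [show (-1 / 2 : ℂ) = 1 - (3 + 2 * a z * 0 + b z * 0 ^ 2) / (2 * 1) by ring]
    exact h2
  have h1 := (hdu.add ((hu.mul hfz).div_const 2)).div hlog (by norm_num)
  simp only [mul_zero, zero_div, add_zero] at h1
  have hne := hlog.eventually_ne (show (-1 / 2 : ℂ) ≠ 0 by norm_num)
  refine h1.congr' ?_
  filter_upwards [h.eventually_mem hz, hne] with p hp hpne
  obtain ⟨hpV, hpJ, hX0⟩ := hp
  have h3 := h.revCubic_mul hpV hpJ hX0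
  have h4 := h.revCubic_ne_zero hpV hpJ hX0
  have hY0 := h.ne_zero p.1 hpV p.2 hpJ
  have hd : dz (fun z s => X z s / Y z s) p.1 p.2 =
      (dz X p.1 p.2 * Y p.1 p.2 - X p.1 p.2 * dz Y p.1 p.2) / Y p.1 p.2 ^ 2 :=
    ((h.famX.toHolFamily.hasDerivAt hV hpV hpJ).div (h.famY.toHolFamily.hasDerivAt hV hpV hpJ)
      hY0).deriv
  have hE := h.eqn_deriv_z hpV hpJ
  have hlog' : (3 + 2 * a p.1 * (X p.1 p.2)⁻¹ + b p.1 * (X p.1 p.2)⁻¹ ^ 2) /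
      (2 * revCubic (a p.1) (b p.1) (c p.1) (X p.1 p.2)⁻¹) =
      X p.1 p.2 * (3 * X p.1 p.2 ^ 2 + 2 * a p.1 * X p.1 p.2 + b p.1) / (2 * Y p.1 p.2 ^ 2) := by
    rw [← h3]; field_simp
  rw [Pi.div_apply, div_eq_iff hpne, hd, hlog']
  have hdY : dz Y p.1 p.2 = ((3 * X p.1 p.2 ^ 2 + 2 * a p.1 * X p.1 p.2 + b p.1) * dz X p.1 p.2 +
      (deriv a p.1 * X p.1 p.2 ^ 2 + deriv b p.1 * X p.1 p.2 + deriv c p.1)) / (2 * Y p.1 p.2) := by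
    field_simp; linear_combination hE
  rw [hdY]
  field_simp
  ring

end PathData
end PathData

/-! ### `L` applied to the integral equals a boundary term -/

section Core

variable {V : Set ℂ} {J : Set ℝ} {H Hs G Gs : ℂ → ℝ → ℂ}

namespace C1Family

theorem div (hH : C1Family V J H Hs) (hG : C1Family V J G Gs)
    (h0 : ∀ z ∈ V, ∀ s ∈ J, G z s ≠ 0) :
    C1Family V J (fun z s => H z s / G z s)
      (fun z s => (Hs z s * G z s - H z s * Gs z s) / G z s ^ 2) :=
  ⟨hH.toHolFamily.div hG.toHolFamily h0,
    ((hH.cont_deriv.mul hG.cont).sub (hH.cont.mul hG.cont_deriv)).div (hG.cont.pow 2)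
      (fun p hp => pow_ne_zero 2 (h0 p.1 hp.1 p.2 hp.2)),
    fun z hz s hs => (hH.hasDeriv z hz s hs).div (hG.hasDeriv z hz s hs) (h0 z hz s hs)⟩

theorem const_mul {v : ℂ → ℂ} (hv : DifferentiableOn ℂ v V) (hH : C1Family V J H Hs) :
    C1Family V J (fun z s => v z * H z s) (fun z s => v z * Hs z s) :=
  ⟨(HolFamily.of_differentiableOn hv).mul hH.toHolFamily,
    (HolFamily.of_differentiableOn (J := J) hv).cont.mul hH.cont_deriv,
    fun z hz s hs => (hH.hasDeriv z hz s hs).const_mul _⟩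

theorem holFamily_deriv (hV : IsOpen V) (hH : C1Family V (Ioc 0 1) H Hs) :
    HolFamily V (Ioc 0 1) Hs :=
  (hH.holFamily_deriv_and_dz hV ordConnected_Ioc fun _ hs => neBot_nhdsWithin_Ioc hs).1

theorem dz (hV : IsOpen V) (hH : C1Family V (Ioc 0 1) H Hs) :
    C1Family V (Ioc 0 1) (ManinMap.dz H) (ManinMap.dz Hs) :=
  (hH.holFamily_deriv_and_dz hV ordConnected_Ioc fun _ hs => neBot_nhdsWithin_Ioc hs).2

end C1Family

/-- The operator `L = A δ² + B δ + C`, with `δ = v ∂/∂z`, on families of functions. -/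
def familyL (v : ℂ → ℂ) (A B C : ℂ) (H : ℂ → ℝ → ℂ) (z : ℂ) (s : ℝ) : ℂ :=
  A * (v z * dz (fun ζ s => v ζ * dz H ζ s) z s) + B * (v z * dz H z s) + C * H z s

/-- `L` acts in `z` only, so it commutes with `∂_s` by the interchange of derivatives. -/
theorem C1Family.hasDerivWithinAt_familyL (hV : IsOpen V) {v : ℂ → ℂ}
    (hv : DifferentiableOn ℂ v V) (hH : C1Family V (Ioc 0 1) H Hs) (A B C : ℂ) {z : ℂ} (hz : z ∈ V)
    {s : ℝ} (hs : s ∈ Ioc (0 : ℝ) 1) :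
    HasDerivWithinAt (familyL v A B C H z) (familyL v A B C Hs z s) (Ioc 0 1) s := by
  have h1 := (hH.dz hV).const_mul hv
  have h2 := (h1.dz hV).const_mul hv
  exact (((h2.hasDeriv z hz s hs).const_mul A).add ((h1.hasDeriv z hz s hs).const_mul B)).add
    ((hH.hasDeriv z hz s hs).const_mul C)

theorem familyL_neg (v : ℂ → ℂ) (A B C : ℂ) (H : ℂ → ℝ → ℂ) (z : ℂ) (s : ℝ) :
    familyL v A B C (fun z s => -H z s) z s = -familyL v A B C H z s := by
  have h1 : ∀ (G : ℂ → ℝ → ℂ), dz (fun z s => -G z s) = fun z s => -dz G z s := by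
    intro G; ext z s; exact deriv.fun_neg
  simp only [familyL, h1, mul_neg]
  ring

/-- Weierstrass, used twice, gives convergence of the first and second `z`-derivatives of `H` to
those of `w`; in particular `w` is holomorphic. -/
theorem tendsto_familyL (hV : IsOpen V) {v : ℂ → ℂ} (hv : DifferentiableOn ℂ v V)
    (hH : HolFamily V (Ioc 0 1) H) {w : ℂ → ℂ}
    (h : ∀ z ∈ V, Tendsto (fun p : ℂ × ℝ => H p.1 p.2 - w p.1) (𝓝 z ×ˢ 𝓝[>] 0) (𝓝 0))
    (A B C : ℂ) {z : ℂ} (hz : z ∈ V) :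
    Tendsto (familyL v A B C H z) (𝓝[>] 0)
      (𝓝 (A * (v z * deriv (fun ζ => v ζ * deriv w ζ) z) + B * (v z * deriv w z) + C * w z)) := by
  have hJ : ∀ᶠ s in 𝓝[>] (0 : ℝ), s ∈ Ioc (0 : ℝ) 1 := Ioc_mem_nhdsGT one_pos
  have hpt : ∀ {F : ℂ → ℝ → ℂ} {f : ℂ → ℂ},
      Tendsto (fun p : ℂ × ℝ => F p.1 p.2 - f p.1) (𝓝 z ×ˢ 𝓝[>] 0) (𝓝 0) →
      Tendsto (F z) (𝓝[>] 0) (𝓝 (f z)) := by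
    intro F f hF
    have h1 := (hF.comp ((tendsto_const_nhds (x := z)).prodMk tendsto_id)).add_const (f z)
    rw [zero_add] at h1
    exact h1.congr fun s => sub_add_cancel _ _
  obtain ⟨hw, h1⟩ := differentiableOn_and_tendsto_dz_sub (l := 𝓝[>] (0 : ℝ)) hV
    (hJ.mono fun s hs => hH.hol s hs) h
  obtain ⟨hw', h2⟩ := differentiableOn_and_tendsto_dz_sub (l := 𝓝[>] (0 : ℝ)) hV
    (hJ.mono fun s hs => (hH.dz hV).hol s hs) h1
  have hvz := (hv.differentiableAt (hV.mem_nhds hz)).hasDerivAt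
  have hd : deriv (fun ζ => v ζ * deriv w ζ) z = deriv v z * deriv w z + v z * deriv (deriv w) z :=
    (hvz.mul (hw'.differentiableAt (hV.mem_nhds hz)).hasDerivAt).deriv
  have e0 := hpt (h z hz)
  have e1 := hpt (h1 z hz)
  have e2 := hpt (h2 z hz)
  rw [hd]
  have e3 := (((((e1.const_mul (deriv v z)).add (e2.const_mul (v z))).const_mul (v z)).const_mul
    A).add ((e1.const_mul (v z)).const_mul B)).add (e0.const_mul C)
  refine e3.congr' ?_
  filter_upwards [hJ] with s hs
  have hd' : dz (fun ζ s => v ζ * dz H ζ s) z s = deriv v z * dz H z s + v z * dz (dz H) z s :=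
    (hvz.mul ((hH.dz hV).hasDerivAt hV hz hs)).deriv
  rw [familyL, hd']

namespace PathData

variable {a b c v : ℂ → ℂ} {X Xs Y Ys : ℂ → ℝ → ℂ}

/-- `δx / y` along a family of paths, where `δ = v ∂/∂z`. -/
def deltaXDivY (v : ℂ → ℂ) (X Y : ℂ → ℝ → ℂ) (z : ℂ) (s : ℝ) : ℂ := v z * (dz X z s / Y z s)

/-- `δf` for the cubic `f = x³ + a x² + b x + c`, where `δ = v ∂/∂z` acts on the coefficients. -/
def deltaF (v a b c : ℂ → ℂ) (z x : ℂ) : ℂ :=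
  v z * deriv a z * x ^ 2 + v z * deriv b z * x + v z * deriv c z

/-- `δ²f` for the cubic `f = x³ + a x² + b x + c`, where `δ = v ∂/∂z` acts on the coefficients. -/
def deltaSqF (v a b c : ℂ → ℂ) (z x : ℂ) : ℂ :=
  v z * deriv (fun ζ => v ζ * deriv a ζ) z * x ^ 2 +
    v z * deriv (fun ζ => v ζ * deriv b ζ) z * x + v z * deriv (fun ζ => v ζ * deriv c ζ) z

/-- The boundary term at the parameter `s` for the operator `L = A δ² + B δ + C` applied to the
integral of `dx/y`, where the primitive of `L(dx/y)` is `S(x) / y³` up to a constant. -/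
def boundary (v a b c : ℂ → ℂ) (A B : ℂ) (S : ℂ[X]) (X Y : ℂ → ℝ → ℂ) (z : ℂ) (s : ℝ) : ℂ :=
  S.eval (X z s) / Y z s ^ 3 +
    A * (-(deltaXDivY v X Y z s * deltaF v a b c z (X z s) / (2 * Y z s ^ 2)) +
      v z * dz (deltaXDivY v X Y) z s) + B * deltaXDivY v X Y z s

theorem holFamily_integrand (h : PathData V a b c X Xs Y Ys) :
    HolFamily V (Ioc 0 1) (fun z s => Xs z s / Y z s) :=
  (h.famX.holFamily_deriv h.isOpen).div h.famY.toHolFamily h.ne_zero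

theorem c1Family_deltaXDivY (h : PathData V a b c X Xs Y Ys) (hv : DifferentiableOn ℂ v V) :
    C1Family V (Ioc 0 1) (deltaXDivY v X Y)
      (fun z s => v z * ((dz Xs z s * Y z s - dz X z s * Ys z s) / Y z s ^ 2)) :=
  ((h.famX.dz h.isOpen).div h.famY h.ne_zero).const_mul hv

/-- The `s`- and `z`-derivatives of the curve equation both involve `f'(X)`. Eliminating it leaves
only the derivative of the coefficients. -/
theorem cross_eq (h : PathData V a b c X Xs Y Ys) {z : ℂ} (hz : z ∈ V) {s : ℝ}
    (hs : s ∈ Ioc (0 : ℝ) 1) :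
    2 * Y z s * (Xs z s * dz Y z s - dz X z s * Ys z s) =
      Xs z s * (deriv a z * X z s ^ 2 + deriv b z * X z s + deriv c z) := by
  linear_combination Xs z s * h.eqn_deriv_z hz hs - dz X z s * h.eqn_deriv_s hz hs

/-- The mixed derivative of the integral and of its boundary term. -/
theorem deriv_deltaXDivY_eq (h : PathData V a b c X Xs Y Ys) {z : ℂ} (hz : z ∈ V) {s : ℝ}
    (hs : s ∈ Ioc (0 : ℝ) 1) :
    v z * ((dz Xs z s * Y z s - dz X z s * Ys z s) / Y z s ^ 2) =
      v z * dz (fun z s => Xs z s / Y z s) z s +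
        deltaF v a b c z (X z s) * Xs z s / (2 * Y z s ^ 3) := by
  have hY0 := h.ne_zero z hz s hs
  have h1 : dz (fun z s => Xs z s / Y z s) z s =
      (dz Xs z s * Y z s - Xs z s * dz Y z s) / Y z s ^ 2 :=
    (((h.famX.holFamily_deriv h.isOpen).hasDerivAt h.isOpen hz hs).div
      (h.famY.toHolFamily.hasDerivAt h.isOpen hz hs) hY0).deriv
  rw [h1, deltaF]
  field_simp
  linear_combination v z * h.cross_eq hz hs

/-- In each application of `δ` to `X_s/Y` an exact term `∂_s(…)` splits off from the derivative at
fixed `x`. These terms, together with the primitive `S/Y³` of the part `L(1/y) dx` at fixed `x`,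
make up `boundary`. -/
theorem hasDerivWithinAt_boundary (h : PathData V a b c X Xs Y Ys) (hv : DifferentiableOn ℂ v V)
    {z : ℂ} (hz : z ∈ V) {A B C : ℂ} {S : ℂ[X]}
    (hS : ∀ x : ℂ, 2 * (x ^ 3 + a z * x ^ 2 + b z * x + c z) * S.derivative.eval x -
      3 * (3 * x ^ 2 + 2 * a z * x + b z) * S.eval x =
      2 * (A * (3 / 4 * deltaF v a b c z x ^ 2 -
          1 / 2 * (x ^ 3 + a z * x ^ 2 + b z * x + c z) * deltaSqF v a b c z x) -
        1 / 2 * B * (x ^ 3 + a z * x ^ 2 + b z * x + c z) * deltaF v a b c z x +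
        C * (x ^ 3 + a z * x ^ 2 + b z * x + c z) ^ 2)) {s : ℝ} (hs : s ∈ Ioc (0 : ℝ) 1) :
    HasDerivWithinAt (boundary v a b c A B S X Y z)
      (familyL v A B C (fun z s => Xs z s / Y z s) z s) (Ioc 0 1) s := by
  have hV := h.isOpen
  have hVz := hV.mem_nhds hz
  have hY0 := h.ne_zero z hz s hs
  have hT := h.c1Family_deltaXDivY hv
  have hg := h.holFamily_integrand
  have hX := h.famX.hasDeriv z hz s hs
  have hY := h.famY.hasDeriv z hz s hs
  have hda : DifferentiableOn ℂ (fun ζ => v ζ * deriv a ζ) V := hv.mul (h.diff_a.deriv hV)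
  have hdb : DifferentiableOn ℂ (fun ζ => v ζ * deriv b ζ) V := hv.mul (h.diff_b.deriv hV)
  have hdc : DifferentiableOn ℂ (fun ζ => v ζ * deriv c ζ) V := hv.mul (h.diff_c.deriv hV)
  -- the mixed second derivative of `δx / y`
  have hmix : dz (fun z s => v z * ((dz Xs z s * Y z s - dz X z s * Ys z s) / Y z s ^ 2)) z s =
      dz (fun ζ s => v ζ * dz (fun z s => Xs z s / Y z s) ζ s) z s +
        (((deriv (fun ζ => v ζ * deriv a ζ) z * X z s ^ 2 +
          v z * deriv a z * (2 * X z s * dz X z s) +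
          (deriv (fun ζ => v ζ * deriv b ζ) z * X z s + v z * deriv b z * dz X z s) +
          deriv (fun ζ => v ζ * deriv c ζ) z) * Xs z s +
          deltaF v a b c z (X z s) * dz Xs z s) * (2 * Y z s ^ 3) -
          deltaF v a b c z (X z s) * Xs z s * (2 * (3 * Y z s ^ 2 * dz Y z s))) /
          (2 * Y z s ^ 3) ^ 2 := by
    have hXz := h.famX.toHolFamily.hasDerivAt hV hz hs
    have hYz := h.famY.toHolFamily.hasDerivAt hV hz hs
    have hXsz := (h.famX.holFamily_deriv hV).hasDerivAt hV hz hs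
    have ha' := (hda.differentiableAt hVz).hasDerivAt
    have hb' := (hdb.differentiableAt hVz).hasDerivAt
    have hc' := (hdc.differentiableAt hVz).hasDerivAt
    have h1 := ((HolFamily.of_differentiableOn (J := Ioc 0 1) hv).mul (hg.dz hV)).hasDerivAt hV hz hs
    have h2 := (((ha'.mul (hXz.pow 2)).add (hb'.mul hXz)).add hc').mul hXsz
    have h3 := h2.div ((hYz.pow 3).const_mul 2)
      (mul_ne_zero two_ne_zero (pow_ne_zero 3 hY0))
    have h4 := (h1.add h3).congr_of_eventuallyEq
      (f₁ := fun z => v z * ((dz Xs z s * Y z s - dz X z s * Ys z s) / Y z s ^ 2)) (by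
        filter_upwards [hVz] with ζ hζ
        rw [h.deriv_deltaXDivY_eq hζ hs]
        rfl)
    rw [dz, h4.deriv]
    simp only [Pi.add_apply, Pi.mul_apply, Pi.pow_apply, deltaF]
    push_cast
    ring
  have hTs := hT.hasDeriv z hz s hs
  have hTzs := (hT.dz hV).hasDeriv z hz s hs
  have hD : HasDerivWithinAt (fun s => deltaF v a b c z (X z s))
      ((2 * (v z * deriv a z) * X z s + v z * deriv b z) * Xs z s) (Ioc 0 1) s := by
    have := (((hX.pow 2).const_mul (v z * deriv a z)).add
      (hX.const_mul (v z * deriv b z))).add_const (v z * deriv c z)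
    refine this.congr_deriv ?_
    push_cast
    ring
  have hSX := (S.hasDerivAt (X z s)).comp_hasDerivWithinAt s hX
  have hall := ((hSX.div (hY.pow 3) (pow_ne_zero 3 hY0)).add
    ((((hTs.mul hD).div ((hY.pow 2).const_mul 2)
      (mul_ne_zero two_ne_zero (pow_ne_zero 2 hY0))).neg.add (hTzs.const_mul (v z))).const_mul
        A)).add (hTs.const_mul B)
  refine hall.congr_deriv ?_
  have hcross := h.cross_eq hz hs
  have hT' := h.deriv_deltaXDivY_eq (v := v) hz hs
  have hS' := hS (X z s)
  rw [← h.eqn z hz s hs] at hS'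
  have hYs : Ys z s = (3 * X z s ^ 2 + 2 * a z * X z s + b z) * Xs z s / (2 * Y z s) := by
    field_simp; linear_combination h.eqn_deriv_s hz hs
  -- The derivative of `S/Y³` along the path is `X_s (2fS' - 3f'S)/(2Y⁵)`, to which the equation for
  -- `S` applies.
  have hprim : (S.derivative.eval (X z s) * Xs z s * Y z s ^ 3 -
      S.eval (X z s) * (3 * Y z s ^ 2 * Ys z s)) / (Y z s ^ 3) ^ 2 =
      Xs z s * (2 * Y z s ^ 2 * S.derivative.eval (X z s) -
        3 * (3 * X z s ^ 2 + 2 * a z * X z s + b z) * S.eval (X z s)) / (2 * Y z s ^ 5) := by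
    rw [hYs]
    field_simp
  rw [hmix]
  simp only [familyL, Function.comp_apply, Pi.pow_apply, Pi.mul_apply]
  push_cast
  rw [pow_one, hprim, hS']
  generalize dz (fun ζ s => v ζ * dz (fun z s => Xs z s / Y z s) ζ s) z s = G2 at *
  generalize hG1 : dz (fun z s => Xs z s / Y z s) z s = G1 at *
  -- The right side is `-X_s` times `δ²(1/y)` at fixed `x`.
  have hsecond : -((v z * ((dz Xs z s * Y z s - dz X z s * Ys z s) / Y z s ^ 2) *
      deltaF v a b c z (X z s) + deltaXDivY v X Y z s *
      ((2 * (v z * deriv a z) * X z s + v z * deriv b z) * Xs z s)) * (2 * Y z s ^ 2) -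
      deltaXDivY v X Y z s * deltaF v a b c z (X z s) * (2 * (2 * Y z s * Ys z s))) /
      (2 * Y z s ^ 2) ^ 2 +
      v z * ((((deriv (fun ζ => v ζ * deriv a ζ) z * X z s ^ 2 +
          v z * deriv a z * (2 * X z s * dz X z s) +
          (deriv (fun ζ => v ζ * deriv b ζ) z * X z s + v z * deriv b z * dz X z s) +
          deriv (fun ζ => v ζ * deriv c ζ) z) * Xs z s +
          deltaF v a b c z (X z s) * dz Xs z s) * (2 * Y z s ^ 3) -
          deltaF v a b c z (X z s) * Xs z s * (2 * (3 * Y z s ^ 2 * dz Y z s))) /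
          (2 * Y z s ^ 3) ^ 2) =
      Xs z s * (deltaSqF v a b c z (X z s) / (2 * Y z s ^ 3) -
        3 * deltaF v a b c z (X z s) ^ 2 / (4 * Y z s ^ 5)) := by
    have hD' : v z * (Xs z s * (deriv a z * X z s ^ 2 + deriv b z * X z s + deriv c z)) =
        Xs z s * deltaF v a b c z (X z s) := by rw [deltaF]; ring
    rw [← hcross] at hD'
    rw [deltaXDivY, deltaSqF]
    generalize deltaF v a b c z (X z s) = D at *
    field_simp
    linear_combination (-6 * D) * hD'
  -- In `L(1/y)`, computed at fixed `x`, the `A`- and `B`-parts cancel and `C/y` is left.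
  have hlast : Xs z s * (2 * (A * (3 / 4 * deltaF v a b c z (X z s) ^ 2 -
      1 / 2 * Y z s ^ 2 * deltaSqF v a b c z (X z s)) -
      1 / 2 * B * Y z s ^ 2 * deltaF v a b c z (X z s) + C * (Y z s ^ 2) ^ 2)) / (2 * Y z s ^ 5) +
      A * (Xs z s * (deltaSqF v a b c z (X z s) / (2 * Y z s ^ 3) -
        3 * deltaF v a b c z (X z s) ^ 2 / (4 * Y z s ^ 5))) +
      B * (deltaF v a b c z (X z s) * Xs z s / (2 * Y z s ^ 3)) = C * (Xs z s / Y z s) := by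
    field_simp
    ring
  linear_combination A * hsecond + B * hT' + hlast

theorem tendsto_deltaXDivY (h : PathData V a b c X Xs Y Ys) (hv : DifferentiableOn ℂ v V) {z : ℂ}
    (hz : z ∈ V) :
    Tendsto (fun p : ℂ × ℝ => deltaXDivY v X Y p.1 p.2) (𝓝 z ×ˢ 𝓝[>] 0) (𝓝 0) := by
  simpa [deltaXDivY] using (tendsto_coeff h.isOpen hv hz).mul (h.tendsto_dz_X_div_Y hz)

/-- The boundary term vanishes at `O`. -/
theorem tendsto_boundary (h : PathData V a b c X Xs Y Ys) (hv : DifferentiableOn ℂ v V) {z : ℂ}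
    (hz : z ∈ V) (A B : ℂ) {S : ℂ[X]} (hS : S.natDegree ≤ 4) :
    Tendsto (boundary v a b c A B S X Y z) (𝓝[>] 0) (𝓝 0) := by
  have hV := h.isOpen
  have hp : Tendsto (fun s : ℝ => (z, s)) (𝓝[>] 0) (𝓝 z ×ˢ 𝓝[>] 0) :=
    tendsto_const_nhds.prodMk tendsto_id
  have hT := (h.tendsto_deltaXDivY hv hz).comp hp
  have hTz := (tendsto_dz hV (h.c1Family_deltaXDivY hv).toHolFamily
    (fun z hz => h.tendsto_deltaXDivY hv hz) hz).comp hp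
  have hq := (h.tendsto_inv_X hz).comp hp
  have hφ := (h.tendsto_revCubic hz).comp hp
  have hu := (h.tendsto_X_div_Y hz).comp hp
  have hD := (h.tendsto_quadratic_div (hv.mul (h.diff_a.deriv hV)) (hv.mul (h.diff_b.deriv hV))
    (hv.mul (h.diff_c.deriv hV)) hz).comp hp
  have hSY : Tendsto (fun s => S.eval (X z s) / Y z s ^ 3) (𝓝[>] 0) (𝓝 0) := by
    have h1 := (hu.div hφ one_ne_zero).mul ((((((tendsto_const_nhds (x := S.coeff 4)).add
      (hq.const_mul (S.coeff 3))).add ((hq.pow 2).const_mul (S.coeff 2))).add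
      ((hq.pow 3).const_mul (S.coeff 1))).add ((hq.pow 4).const_mul (S.coeff 0))))
    simp only [zero_div, zero_mul] at h1
    refine h1.congr' ?_
    filter_upwards [hp.eventually (h.eventually_mem hz)] with s hs
    obtain ⟨-, hsJ, hX0⟩ := hs
    have h3 := h.revCubic_mul hz hsJ hX0
    have h4 := h.revCubic_ne_zero hz hsJ hX0
    have hY0 := h.ne_zero z hz s hsJ
    have hSx : S.eval (X z s) = S.coeff 0 + S.coeff 1 * X z s + S.coeff 2 * X z s ^ 2 +
        S.coeff 3 * X z s ^ 3 + S.coeff 4 * X z s ^ 4 := by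
      rw [Polynomial.eval_eq_sum_range' (n := 5) (by omega)]
      simp [Finset.sum_range_succ]
    simp only [Function.comp_apply, Pi.div_apply]
    -- Degree `4` is the limit case: `x⁴/y³ = (x/y)/φ(1/x)` still tends to `0`.
    have h6 : X z s / Y z s / revCubic (a z) (b z) (c z) (X z s)⁻¹ = X z s ^ 4 / Y z s ^ 3 := by
      rw [show Y z s ^ 3 = Y z s * Y z s ^ 2 by ring, ← h3]
      field_simp
    rw [h6, hSx]
    field_simp
    ring
  have h2 := (hSY.add ((((hT.mul hD).div_const 2).neg.add (hTz.const_mul (v z))).const_mul A)).add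
    (hT.const_mul B)
  simp only [mul_zero, zero_div, neg_zero, add_zero] at h2
  refine h2.congr fun s => ?_
  simp only [boundary, deltaF, Function.comp_apply, Pi.mul_apply]
  ring

/-- `L` applied to the integral of `dx/y` from `O` is the boundary term at the endpoint. -/
theorem applyL_eq_boundary (h : PathData V a b c X Xs Y Ys) (hv : DifferentiableOn ℂ v V)
    {w : ℂ → ℂ}
    (hw : ∀ z ∈ V, Tendsto (fun s => ∫ σ in s..1, Xs z σ / Y z σ) (𝓝[>] 0) (𝓝 (w z)))
    {z : ℂ} (hz : z ∈ V) {A B C : ℂ} {S : ℂ[X]} (hS4 : S.natDegree ≤ 4)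
    (hS : ∀ x : ℂ, 2 * (x ^ 3 + a z * x ^ 2 + b z * x + c z) * S.derivative.eval x -
      3 * (3 * x ^ 2 + 2 * a z * x + b z) * S.eval x =
      2 * (A * (3 / 4 * deltaF v a b c z x ^ 2 -
          1 / 2 * (x ^ 3 + a z * x ^ 2 + b z * x + c z) * deltaSqF v a b c z x) -
        1 / 2 * B * (x ^ 3 + a z * x ^ 2 + b z * x + c z) * deltaF v a b c z x +
        C * (x ^ 3 + a z * x ^ 2 + b z * x + c z) ^ 2)) :
    A * (v z * deriv (fun ζ => v ζ * deriv w ζ) z) + B * (v z * deriv w z) + C * w z =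
      boundary v a b c A B S X Y z 1 := by
  have hV := h.isOpen
  set T : ℂ → ℝ → ℂ := fun z s => ∫ σ in s..1, Xs z σ / Y z σ with hTdef
  have hT : C1Family V (Ioc 0 1) T (fun z s => -(Xs z s / Y z s)) :=
    h.holFamily_integrand.c1Family_integral hV
  -- the integrals converge locally uniformly
  have hunif : ∀ z ∈ V, Tendsto (fun p : ℂ × ℝ => T p.1 p.2 - w p.1) (𝓝 z ×ˢ 𝓝[>] 0) (𝓝 0) := by
    intro z hz
    have hVz := hV.mem_nhds hz
    obtain ⟨M, hM⟩ : ∃ M : ℝ, ∀ᶠ ζ in 𝓝 z, ‖a ζ‖ ≤ M ∧ ‖b ζ‖ ≤ M ∧ ‖c ζ‖ ≤ M := by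
      refine ⟨max (‖a z‖ + 1) (max (‖b z‖ + 1) (‖c z‖ + 1)), ?_⟩
      have ha := (h.diff_a.differentiableAt hVz).continuousAt.norm.eventually_lt_const
        (lt_add_one ‖a z‖)
      have hb := (h.diff_b.differentiableAt hVz).continuousAt.norm.eventually_lt_const
        (lt_add_one ‖b z‖)
      have hc := (h.diff_c.differentiableAt hVz).continuousAt.norm.eventually_lt_const
        (lt_add_one ‖c z‖)
      filter_upwards [ha, hb, hc] with ζ h1 h2 h3
      exact ⟨h1.le.trans (le_max_left _ _), h2.le.trans (le_max_of_le_right (le_max_left _ _)),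
        h3.le.trans (le_max_of_le_right (le_max_right _ _))⟩
    obtain ⟨r, hr0, hr⟩ := exists_radius_revCubic M
    have hbig : ∀ᶠ p : ℂ × ℝ in 𝓝 z ×ˢ 𝓝[>] 0, r⁻¹ < ‖X p.1 p.2‖ :=
      (tendsto_norm_cobounded_atTop.comp (h.start z hz)).eventually_gt_atTop _
    obtain ⟨W, hW, U, hU, hWU⟩ := mem_prod_iff.mp hbig
    obtain ⟨s₁, hs₁, hs₁U⟩ := mem_nhdsGT_iff_exists_Ioc_subset.mp hU
    have hs₁pos : 0 < s₁ := hs₁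
    have h12 := (h.tendsto_X_div_Y hz).norm.const_mul 12
    rw [norm_zero, mul_zero] at h12
    refine squeeze_zero_norm' ?_ h12
    filter_upwards [prod_mem_prod (inter_mem (inter_mem hVz hW) hM)
      (Ioc_mem_nhdsGT (lt_min hs₁pos one_pos))]
    rintro ⟨ζ, s⟩ ⟨⟨⟨hζ, hζW⟩, hζM⟩, hs⟩
    have hsJ : s ∈ Ioc (0 : ℝ) 1 := ⟨hs.1, hs.2.trans (min_le_right _ _)⟩
    obtain ⟨w', hw', hbound⟩ := tail_integral hr0 (hr _ _ _ hζM.1 hζM.2.1 hζM.2.2)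
      (h.famX.hasDeriv ζ hζ) (h.famY.hasDeriv ζ hζ) (h.eqn ζ hζ) (h.ne_zero ζ hζ)
      (hT.hasDeriv ζ hζ)
      ((h.start ζ hζ).comp (tendsto_const_nhds.prodMk tendsto_id))
    rw [tendsto_nhds_unique (hw ζ hζ) hw']
    refine hbound s hsJ fun σ hσ => ?_
    exact hWU (show (ζ, σ) ∈ W ×ˢ U from
      ⟨hζW, hs₁U ⟨hσ.1, hσ.2.trans (hs.2.trans (min_le_left _ _))⟩⟩)
  have h1mem : (1 : ℝ) ∈ Ioc (0 : ℝ) 1 := ⟨one_pos, le_rfl⟩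
  -- `T(ζ, 1)` is an empty integral for every `ζ`, so its `z`-derivatives vanish too.
  have hT1 : familyL v A B C T z 1 = 0 := by
    have e1 : ∀ ζ, T ζ 1 = 0 := fun ζ => intervalIntegral.integral_same
    have e2 : ∀ ζ, dz T ζ 1 = 0 := fun ζ => by simp [dz, e1]
    have e3 : dz (fun ζ s => v ζ * dz T ζ s) z 1 = 0 := by
      rw [dz]
      simp [e2]
    rw [familyL, e1, e2, e3]
    simp
  have hLT : ∀ s ∈ Ioc (0 : ℝ) 1, familyL v A B C T z s =
      boundary v a b c A B S X Y z 1 - boundary v a b c A B S X Y z s := by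
    intro s hs
    have hder : ∀ σ ∈ Ioc (0 : ℝ) 1, HasDerivWithinAt
        (fun s => familyL v A B C T z s + boundary v a b c A B S X Y z s) 0 (Ioc 0 1) σ := by
      intro σ hσ
      have h1 := hT.hasDerivWithinAt_familyL hV hv A B C hz hσ
      rw [familyL_neg] at h1
      have h2 := h1.add (h.hasDerivWithinAt_boundary hv hz hS hσ)
      rwa [neg_add_cancel] at h2
    have := (convex_Ioc (0 : ℝ) 1).norm_image_sub_le_of_norm_hasDerivWithin_le (C := 0) hder
      (by simp) h1mem hs
    rw [zero_mul, norm_le_zero_iff, sub_eq_zero, hT1, zero_add] at this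
    rw [← this, add_sub_cancel_right]
  have hlim1 := tendsto_familyL hV hv hT.toHolFamily hunif A B C hz
  have hlim2 := (tendsto_const_nhds (x := boundary v a b c A B S X Y z 1)).sub
    (h.tendsto_boundary hv hz A B hS4)
  rw [sub_zero] at hlim2
  refine tendsto_nhds_unique hlim1 (hlim2.congr' ?_)
  filter_upwards [Ioc_mem_nhdsGT (one_pos (α := ℝ))] with s hs
  exact (hLT s hs).symm

end PathData
end Core

/-! ### Existence of paths from `O` in a fibre -/

section Paths

theorem exists_cubic_eq_prod (a b c : ℂ) :
    ∃ e₁ e₂ e₃ : ℂ, ∀ x : ℂ, x ^ 3 + a * x ^ 2 + b * x + c = (x - e₁) * (x - e₂) * (x - e₃) := by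
  let p : ℂ[X] := .X ^ 3 + .C a * .X ^ 2 + .C b * .X + .C c
  have hp : p.Monic := by unfold p; monicity!
  have hdeg : p.natDegree = 3 := by unfold p; compute_degree!
  have hs := IsAlgClosed.splits p
  have hcard : p.roots.card = 3 := by rw [← hs.natDegree_eq_card_roots, hdeg]
  obtain ⟨e₁, e₂, e₃, he⟩ := Multiset.card_eq_three.mp hcard
  refine ⟨e₁, e₂, e₃, fun x => ?_⟩
  have h1 := congrArg (Polynomial.eval x) hs.eq_prod_roots
  rw [hp.leadingCoeff, he] at h1
  simp [p] at h1
  rw [h1]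
  ring

/-- A direction for a ray avoiding three given points. -/
theorem exists_direction (d₁ d₂ d₃ : ℂ) (h₁ : d₁ ≠ 0) (h₂ : d₂ ≠ 0) (h₃ : d₃ ≠ 0) :
    ∃ γ : ℂ, γ ≠ 0 ∧ (γ / d₁).im ≠ 0 ∧ (γ / d₂).im ≠ 0 ∧ (γ / d₃).im ≠ 0 := by
  -- The direction is `1 + t i` with `t` different from the slopes of the `dᵢ`. For vertical `dᵢ`
  -- the slope has the default value `0`, a harmless extra exclusion, as no `t` makes `1 + t i`
  -- vertical.
  obtain ⟨t, ht⟩ := Infinite.exists_notMem_finset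
    ({d₁.im / d₁.re, d₂.im / d₂.re, d₃.im / d₃.re} : Finset ℝ)
  simp only [Finset.mem_insert, Finset.mem_singleton, not_or] at ht
  have key : ∀ d : ℂ, d ≠ 0 → t ≠ d.im / d.re → (⟨1, t⟩ / d : ℂ).im ≠ 0 := by
    intro d hd hne h0
    have hn : Complex.normSq d ≠ 0 := by simpa using hd
    rw [Complex.div_im] at h0
    have h1 : t * d.re - d.im = 0 := by
      field_simp at h0
      linarith
    by_cases hre : d.re = 0
    · rw [hre, mul_zero, zero_sub, neg_eq_zero] at h1
      exact hd (Complex.ext hre h1)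
    · apply hne
      field_simp
      linarith
  refine ⟨⟨1, t⟩, fun h => ?_, key _ h₁ ht.1, key _ h₂ ht.2.1, key _ h₃ ht.2.2⟩
  simpa using congrArg Complex.re h

theorem one_add_mul_mem_slitPlane {τ : ℝ} {ζ : ℂ} (hζ : ζ.im ≠ 0) :
    1 + (τ : ℂ) * ζ ∈ Complex.slitPlane := by
  by_cases hτ : τ = 0
  · simp [hτ]
  · right
    simp [hτ, hζ]

theorem exp_half_log_sq {ρ : ℂ} (hρ : ρ ≠ 0) : Complex.exp (Complex.log ρ / 2) ^ 2 = ρ := by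
  rw [← Complex.exp_nat_mul]
  push_cast
  rw [mul_div_cancel₀ _ two_ne_zero, Complex.exp_log hρ]

theorem equation_fibre_iff {W : WeierstrassCurve ℂ} (h₁ : W.a₁ = 0) (h₃ : W.a₃ = 0) (x y : ℂ) :
    W.toAffine.Equation x y ↔ y ^ 2 = x ^ 3 + W.a₂ * x ^ 2 + W.a₄ * x + W.a₆ := by
  rw [WeierstrassCurve.Affine.equation_iff, h₁, h₃]
  simp

/-- Take the ray `x + γ τ` with `τ = 1/s - 1` running from `∞` to `0`. It misses each root `eᵢ`
because `γ/(x - eᵢ)` is not real. For the same reason `1 + τ γ/(x - eᵢ)` stays in the slit plane, so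
the product of the three principal square roots lifts the ray, with value `1` at `s = 1`. -/
theorem exists_isFibrePath {W : WeierstrassCurve ℂ} (h₁ : W.a₁ = 0) (h₃ : W.a₃ = 0) {x y : ℂ}
    (heq : W.toAffine.Equation x y) (hy : y ≠ 0) : ∃ X Y : ℝ → ℂ, IsFibrePath W x y X Y := by
  obtain ⟨e₁, e₂, e₃, he⟩ := exists_cubic_eq_prod W.a₂ W.a₄ W.a₆
  have hy2 : y ^ 2 = (x - e₁) * (x - e₂) * (x - e₃) := by
    rw [← he, ← equation_fibre_iff h₁ h₃]; exact heq
  have hne : (x - e₁) * (x - e₂) * (x - e₃) ≠ 0 := hy2 ▸ pow_ne_zero 2 hy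
  have hd₁ : x - e₁ ≠ 0 := fun h => hne (by rw [h]; ring)
  have hd₂ : x - e₂ ≠ 0 := fun h => hne (by rw [h]; ring)
  have hd₃ : x - e₃ ≠ 0 := fun h => hne (by rw [h]; ring)
  obtain ⟨γ, hγ, hi₁, hi₂, hi₃⟩ := exists_direction _ _ _ hd₁ hd₂ hd₃
  let τ : ℝ → ℝ := fun s => s⁻¹ - 1
  let R : ℂ → ℝ → ℂ := fun d s => Complex.exp (Complex.log (1 + (τ s : ℂ) * (γ / d)) / 2)
  have hτ : ContDiffOn ℝ 1 (fun s => (τ s : ℂ)) (Ioc 0 1) := by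
    have : ContDiffOn ℝ 1 τ (Ioc 0 1) :=
      (contDiffOn_inv ℝ |>.mono fun s hs => ne_of_gt hs.1).sub contDiffOn_const
    exact Complex.ofRealCLM.contDiff.comp_contDiffOn this
  have hR : ∀ d, (γ / d).im ≠ 0 → ContDiffOn ℝ 1 (R d) (Ioc 0 1) := by
    intro d hd
    have h1 : ContDiffOn ℝ 1 (fun s => 1 + (τ s : ℂ) * (γ / d)) (Ioc 0 1) :=
      contDiffOn_const.add (hτ.mul contDiffOn_const)
    have h2 : ContDiffOn ℝ 1 (fun s => Complex.log (1 + (τ s : ℂ) * (γ / d))) (Ioc 0 1) :=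
      fun s hs => ContDiffAt.comp_contDiffWithinAt (g := Complex.log) s
        ((Complex.contDiffAt_log (one_add_mul_mem_slitPlane hd)).restrict_scalars ℝ) (h1 s hs)
    exact (h2.div_const 2).cexp
  have hRsq : ∀ d, (γ / d).im ≠ 0 → d ≠ 0 → ∀ s, R d s ^ 2 * d = d + γ * τ s := by
    intro d hd hd0 s
    rw [exp_half_log_sq (Complex.slitPlane_ne_zero (one_add_mul_mem_slitPlane hd))]
    field_simp
  refine ⟨fun s => x + γ * τ s, fun s => y * (R (x - e₁) s * R (x - e₂) s * R (x - e₃) s),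
    ?_, ?_, ?_, ?_, ?_, ?_, ?_⟩
  · exact contDiffOn_const.add (contDiffOn_const.mul hτ)
  · exact contDiffOn_const.mul (((hR _ hi₁).mul (hR _ hi₂)).mul (hR _ hi₃))
  · intro s hs
    rw [equation_fibre_iff h₁ h₃, he, mul_pow, mul_pow, mul_pow, hy2]
    have g₁ := hRsq _ hi₁ hd₁ s
    have g₂ := hRsq _ hi₂ hd₂ s
    have g₃ := hRsq _ hi₃ hd₃ s
    calc _ = (R (x - e₁) s ^ 2 * (x - e₁)) * (R (x - e₂) s ^ 2 * (x - e₂)) *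
          (R (x - e₃) s ^ 2 * (x - e₃)) := by ring
      _ = _ := by rw [g₁, g₂, g₃]; ring
  · intro s _
    exact mul_ne_zero hy (mul_ne_zero (mul_ne_zero (Complex.exp_ne_zero _)
      (Complex.exp_ne_zero _)) (Complex.exp_ne_zero _))
  · rw [← tendsto_norm_atTop_iff_cobounded]
    have h1 : Tendsto τ (𝓝[>] 0) atTop :=
      tendsto_atTop_add_const_right _ (-1) tendsto_inv_nhdsGT_zero
    have h2 : Tendsto (fun s => ‖γ‖ * τ s - ‖x‖) (𝓝[>] 0) atTop :=
      tendsto_atTop_add_const_right _ (-‖x‖) (h1.const_mul_atTop (norm_pos_iff.mpr hγ))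
    refine tendsto_atTop_mono (fun s => ?_) h2
    have h3 : ‖γ * (τ s : ℂ)‖ = ‖γ‖ * |τ s| := by rw [norm_mul, Complex.norm_real, Real.norm_eq_abs]
    have h4 := norm_sub_norm_le (γ * (τ s : ℂ)) (-x)
    rw [norm_neg, sub_neg_eq_add, add_comm (γ * (τ s : ℂ)) x] at h4
    have h5 : ‖γ‖ * τ s ≤ ‖γ‖ * |τ s| := by gcongr; exact le_abs_self _
    linarith
  · simp [τ]
  · simp [τ, R]

end Paths

/-! ### From path families along an arc to analytic data -/

section FamilyOfPaths

variable {V : Set ℂ}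

theorem c1Family_of_contDiffOn {X : ℂ → ℝ → ℂ} (hV : IsOpen V)
    (hX : ContDiffOn ℝ 1 (Function.uncurry X) (V ×ˢ Ioc 0 1))
    (hol : ∀ s ∈ Ioc (0 : ℝ) 1, DifferentiableOn ℂ (fun z => X z s) V) :
    C1Family V (Ioc 0 1) X
      (fun z s => fderivWithin ℝ (Function.uncurry X) (V ×ˢ Ioc 0 1) (z, s) (0, 1)) := by
  have hu : UniqueDiffOn ℝ (V ×ˢ Ioc (0 : ℝ) 1) := hV.uniqueDiffOn.prod (uniqueDiffOn_Ioc 0 1)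
  refine ⟨⟨hX.continuousOn, hol⟩, ?_, fun z hz s hs => ?_⟩
  · exact (hX.continuousOn_fderivWithin hu le_rfl).clm_apply continuousOn_const
  · have h1 := (hX.differentiableOn one_ne_zero (z, s) ⟨hz, hs⟩).hasFDerivWithinAt
    have h2 : HasDerivWithinAt (fun σ : ℝ => (z, σ)) ((0 : ℂ), (1 : ℝ)) (Ioc 0 1) s :=
      (hasDerivWithinAt_const s _ z).prodMk (hasDerivWithinAt_id s _)
    exact h1.comp_hasDerivWithinAt s h2 fun σ hσ => ⟨hz, hσ⟩

theorem integral_deriv_div_eq {X Xs Y : ℝ → ℂ}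
    (hX : ∀ s ∈ Ioc (0 : ℝ) 1, HasDerivWithinAt X (Xs s) (Ioc 0 1) s) {ε : ℝ}
    (hε : ε ∈ Ioc (0 : ℝ) 1) :
    ∫ s in ε..1, deriv X s / Y s = ∫ s in ε..1, Xs s / Y s := by
  -- At `s = 1` the two-sided `deriv` may differ from the one-sided derivative `Xs`; interior points
  -- suffice for the integral.
  refine intervalIntegral.integral_congr_uIoo fun s hs => ?_
  rw [uIoo_of_le hε.2] at hs
  have hs' : s ∈ Ioo (0 : ℝ) 1 := ⟨hε.1.trans hs.1, hs.2⟩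
  have := (hX s ⟨hs'.1, hs'.2.le⟩).hasDerivAt (Ioc_mem_nhds hs'.1 hs'.2)
  simp only [this.deriv]

theorem isPathIntegral_iff {X Xs Y : ℝ → ℂ}
    (hX : ∀ s ∈ Ioc (0 : ℝ) 1, HasDerivWithinAt X (Xs s) (Ioc 0 1) s) (w : ℂ) :
    IsPathIntegral X Y w ↔ Tendsto (fun ε : ℝ => ∫ s in ε..1, Xs s / Y s) (𝓝[>] 0) (𝓝 w) := by
  refine tendsto_congr' ?_
  filter_upwards [Ioc_mem_nhdsGT (one_pos (α := ℝ))] with ε hε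
  exact integral_deriv_div_eq hX hε

variable {K : Type*} [Field K] [Algebra ℂ K]

/-- An open set of parameters over which the coefficients of `E` and the coordinates of the point
`(x, y)` of `E` are holomorphic, and `y` has no zero. -/
structure IsGoodSet (φ : Arc K) (E : WeierstrassCurve K) (x y : K) (U : Set ℂ) : Prop where
  isOpen : IsOpen U
  a₁_eq : ∀ z ∈ U, φ.ev E.a₁ z = 0
  a₃_eq : ∀ z ∈ U, φ.ev E.a₃ z = 0
  diff_a₂ : DifferentiableOn ℂ (φ.ev E.a₂) U
  diff_a₄ : DifferentiableOn ℂ (φ.ev E.a₄) U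
  diff_a₆ : DifferentiableOn ℂ (φ.ev E.a₆) U
  diff_x : DifferentiableOn ℂ (φ.ev x) U
  diff_y : DifferentiableOn ℂ (φ.ev y) U
  eqn : ∀ z ∈ U, φ.ev y z ^ 2 =
    φ.ev x z ^ 3 + φ.ev E.a₂ z * φ.ev x z ^ 2 + φ.ev E.a₄ z * φ.ev x z + φ.ev E.a₆ z
  ne_zero : ∀ z ∈ U, φ.ev y z ≠ 0

variable {φ : Arc K} {E : WeierstrassCurve K} {x y : K} {U : Set ℂ}

theorem IsGoodSet.equation_iff (hU : IsGoodSet φ E x y U) {z : ℂ} (hz : z ∈ U) (X Y : ℂ) :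
    (φ.fibre E z).toAffine.Equation X Y ↔
      Y ^ 2 = X ^ 3 + φ.ev E.a₂ z * X ^ 2 + φ.ev E.a₄ z * X + φ.ev E.a₆ z :=
  equation_fibre_iff (W := φ.fibre E z) (hU.a₁_eq z hz) (hU.a₃_eq z hz) X Y

theorem IsGoodSet.exists_isFibrePath (hU : IsGoodSet φ E x y U) {z : ℂ} (hz : z ∈ U) :
    ∃ X₀ Y₀ : ℝ → ℂ, IsFibrePath (φ.fibre E z) (φ.ev x z) (φ.ev y z) X₀ Y₀ :=
  ManinMap.exists_isFibrePath (hU.a₁_eq z hz) (hU.a₃_eq z hz)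
    ((hU.equation_iff hz _ _).mpr (hU.eqn z hz)) (hU.ne_zero z hz)

theorem IsGoodSet.pathData (hU : IsGoodSet φ E x y U) (hV : IsOpen V) {X Y : ℂ → ℝ → ℂ}
    (h : IsPathFamily φ E x y V X Y) :
    PathData (V ∩ U) (φ.ev E.a₂) (φ.ev E.a₄) (φ.ev E.a₆) X
      (fun z s => fderivWithin ℝ (Function.uncurry X) ((V ∩ U) ×ˢ Ioc 0 1) (z, s) (0, 1)) Y
      (fun z s => fderivWithin ℝ (Function.uncurry Y) ((V ∩ U) ×ˢ Ioc 0 1) (z, s) (0, 1)) where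
  isOpen := hV.inter hU.isOpen
  diff_a := hU.diff_a₂.mono inter_subset_right
  diff_b := hU.diff_a₄.mono inter_subset_right
  diff_c := hU.diff_a₆.mono inter_subset_right
  famX := c1Family_of_contDiffOn (hV.inter hU.isOpen)
    (h.contDiff_X.mono (prod_mono inter_subset_left subset_rfl))
    fun s hs => (h.holomorphic_X s hs).mono inter_subset_left
  famY := c1Family_of_contDiffOn (hV.inter hU.isOpen)
    (h.contDiff_Y.mono (prod_mono inter_subset_left subset_rfl))
    fun s hs => (h.holomorphic_Y s hs).mono inter_subset_left
  eqn z hz s hs := (hU.equation_iff hz.2 _ _).mp ((h.path z hz.1).equation s hs)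
  ne_zero z hz s hs := (h.path z hz.1).ne_zero s hs
  start z hz := h.start z hz.1

theorem IsGoodSet.exists_isPathIntegral (hU : IsGoodSet φ E x y U) (hV : IsOpen V)
    {X Y : ℂ → ℝ → ℂ} (h : IsPathFamily φ E x y V X Y) {z : ℂ} (hz : z ∈ V ∩ U) :
    ∃ w, IsPathIntegral (X z) (Y z) w := by
  have hp := hU.pathData hV h
  obtain ⟨r, hr0, hr⟩ := exists_radius_revCubic
    (max ‖φ.ev E.a₂ z‖ (max ‖φ.ev E.a₄ z‖ ‖φ.ev E.a₆ z‖))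
  obtain ⟨w, hw, -⟩ := tail_integral hr0
    (hr _ _ _ (le_max_left _ _) (le_max_of_le_right (le_max_left _ _))
      (le_max_of_le_right (le_max_right _ _)))
    (hp.famX.hasDeriv z hz) (hp.famY.hasDeriv z hz) (hp.eqn z hz) (hp.ne_zero z hz)
    ((hp.holFamily_integrand.c1Family_integral hp.isOpen).hasDeriv z hz)
    ((hp.start z hz).comp (tendsto_const_nhds.prodMk tendsto_id))
  exact ⟨w, (isPathIntegral_iff (hp.famX.hasDeriv z hz) w).mpr hw⟩

end FamilyOfPaths

/-! ### Extending a path to the neighbouring fibres -/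

section Extension

theorem re_exp_half_log_pos {ρ : ℂ} (hρ : ρ ∈ Complex.slitPlane) :
    0 < (Complex.exp (Complex.log ρ / 2)).re := by
  rw [Complex.exp_re]
  refine mul_pos (Real.exp_pos _) (Real.cos_pos_of_mem_Ioo ?_)
  have h1 : (Complex.log ρ / 2).im = ρ.arg / 2 := by
    rw [show (2 : ℂ) = ((2 : ℝ) : ℂ) by norm_num, Complex.div_ofReal_im, Complex.log_im]
  rw [h1]
  have h2 := Complex.neg_pi_lt_arg ρ
  have h3 := lt_of_le_of_ne (Complex.arg_le_pi ρ) (Complex.slitPlane_arg_ne_pi hρ)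
  constructor <;> linarith

theorem eq_of_sq_eq_sq_of_re_pos {A B : ℂ} (h : A ^ 2 = B ^ 2) (hA : 0 < A.re) (hB : 0 < B.re) :
    A = B := by
  rcases sq_eq_sq_iff_eq_or_eq_neg.mp h with h | h
  · exact h
  · rw [h, Complex.neg_re] at hA
    linarith

theorem mem_slitPlane_of_norm_sub_one_lt {ρ : ℂ} (h : ‖ρ - 1‖ < 1) : ρ ∈ Complex.slitPlane := by
  left
  have := (Complex.abs_re_le_norm (ρ - 1)).trans_lt h
  rw [Complex.sub_re, Complex.one_re] at this
  linarith [(abs_lt.mp this).1]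

variable {a b c x : ℂ → ℂ} {z₁ : ℂ} {X₀ Y₀ : ℝ → ℂ}

/-- The deformation of the path `X₀` whose endpoint is moved from `x z₁` to `x z`. -/
def movedX (x : ℂ → ℂ) (z₁ : ℂ) (X₀ : ℝ → ℂ) (z : ℂ) (s : ℝ) : ℂ := X₀ s + s * (x z - x z₁)

/-- The quotient of the cubic along the deformed path by its value along the original path. -/
def cubicRatio (a b c x : ℂ → ℂ) (z₁ : ℂ) (X₀ Y₀ : ℝ → ℂ) (z : ℂ) (s : ℝ) : ℂ :=
  (movedX x z₁ X₀ z s ^ 3 + a z * movedX x z₁ X₀ z s ^ 2 + b z * movedX x z₁ X₀ z s + c z) /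
    Y₀ s ^ 2

/-- The lift of the deformed path to the double cover. -/
def movedY (a b c x : ℂ → ℂ) (z₁ : ℂ) (X₀ Y₀ : ℝ → ℂ) (z : ℂ) (s : ℝ) : ℂ :=
  Y₀ s * Complex.exp (Complex.log (cubicRatio a b c x z₁ X₀ Y₀ z s) / 2)

theorem tendsto_movedX (hX₀ : Tendsto X₀ (𝓝[>] 0) (Bornology.cobounded ℂ)) {z : ℂ}
    (hx : ContinuousAt x z) :
    Tendsto (Function.uncurry (movedX x z₁ X₀)) (𝓝 z ×ˢ 𝓝[>] 0) (Bornology.cobounded ℂ) := by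
  rw [← tendsto_norm_atTop_iff_cobounded]
  have h1 : Tendsto (fun p : ℂ × ℝ => ‖X₀ p.2‖) (𝓝 z ×ˢ 𝓝[>] 0) atTop :=
    (tendsto_norm_cobounded_atTop.comp hX₀).comp tendsto_snd
  have h2 : Tendsto (fun p : ℂ × ℝ => -‖(p.2 : ℂ) * (x p.1 - x z₁)‖) (𝓝 z ×ˢ 𝓝[>] 0)
      (𝓝 (-‖((0 : ℝ) : ℂ) * (x z - x z₁)‖)) := by
    have hs : Tendsto (fun p : ℂ × ℝ => (p.2 : ℂ)) (𝓝 z ×ˢ 𝓝[>] 0) (𝓝 ((0 : ℝ) : ℂ)) :=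
      ((Complex.continuous_ofReal.tendsto 0).mono_left nhdsWithin_le_nhds).comp tendsto_snd
    exact (hs.mul ((hx.tendsto.comp tendsto_fst).sub_const _)).norm.neg
  refine tendsto_atTop_mono (fun p => ?_) (h1.atTop_add h2)
  have := norm_sub_norm_le (X₀ p.2) (-((p.2 : ℂ) * (x p.1 - x z₁)))
  rw [norm_neg, sub_neg_eq_add] at this
  simpa [Function.uncurry, movedX, sub_eq_add_neg] using this

/-- The moved path is `t X₀` with `t → 1`, since the displacement is bounded and `X₀ → ∞`. After
division by `X₀³` numerator and denominator both tend to `1`. -/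
theorem tendsto_cubicRatio (hX₀ : Tendsto X₀ (𝓝[>] 0) (Bornology.cobounded ℂ))
    (heq : ∀ s ∈ Ioc (0 : ℝ) 1, Y₀ s ^ 2 = X₀ s ^ 3 + a z₁ * X₀ s ^ 2 + b z₁ * X₀ s + c z₁)
    (ha : ContinuousAt a z₁) (hb : ContinuousAt b z₁) (hc : ContinuousAt c z₁)
    (hx : ContinuousAt x z₁) :
    Tendsto (Function.uncurry (cubicRatio a b c x z₁ X₀ Y₀)) (𝓝 z₁ ×ˢ 𝓝[>] 0) (𝓝 1) := by
  have hq : Tendsto (fun p : ℂ × ℝ => (X₀ p.2)⁻¹) (𝓝 z₁ ×ˢ 𝓝[>] 0) (𝓝 0) :=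
    (tendsto_inv₀_cobounded.comp hX₀).comp tendsto_snd
  have hs : Tendsto (fun p : ℂ × ℝ => (p.2 : ℂ)) (𝓝 z₁ ×ˢ 𝓝[>] 0) (𝓝 ((0 : ℝ) : ℂ)) :=
    ((Complex.continuous_ofReal.tendsto 0).mono_left nhdsWithin_le_nhds).comp tendsto_snd
  have hxx : Tendsto (fun p : ℂ × ℝ => x p.1 - x z₁) (𝓝 z₁ ×ˢ 𝓝[>] 0) (𝓝 0) := by
    simpa using ((hx.tendsto.comp tendsto_fst).sub_const (x z₁))
  have ht : Tendsto (fun p : ℂ × ℝ => 1 + (p.2 : ℂ) * (x p.1 - x z₁) * (X₀ p.2)⁻¹)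
      (𝓝 z₁ ×ˢ 𝓝[>] 0) (𝓝 1) := by
    simpa using ((hs.mul hxx).mul hq).const_add 1
  have ha' : Tendsto (fun p : ℂ × ℝ => a p.1) (𝓝 z₁ ×ˢ 𝓝[>] 0) (𝓝 (a z₁)) :=
    ha.tendsto.comp tendsto_fst
  have hb' : Tendsto (fun p : ℂ × ℝ => b p.1) (𝓝 z₁ ×ˢ 𝓝[>] 0) (𝓝 (b z₁)) :=
    hb.tendsto.comp tendsto_fst
  have hc' : Tendsto (fun p : ℂ × ℝ => c p.1) (𝓝 z₁ ×ˢ 𝓝[>] 0) (𝓝 (c z₁)) :=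
    hc.tendsto.comp tendsto_fst
  have hnum := (((ht.pow 3).add ((ha'.mul (ht.pow 2)).mul hq)).add
    ((hb'.mul ht).mul (hq.pow 2))).add (hc'.mul (hq.pow 3))
  have hden : Tendsto (fun p : ℂ × ℝ => revCubic (a z₁) (b z₁) (c z₁) (X₀ p.2)⁻¹)
      (𝓝 z₁ ×ˢ 𝓝[>] 0) (𝓝 1) := by
    have := (((tendsto_const_nhds (x := (1 : ℂ))).add (hq.const_mul (a z₁))).add
      ((hq.pow 2).const_mul (b z₁))).add ((hq.pow 3).const_mul (c z₁))
    simpa [revCubic] using this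
  have h1 := hnum.div hden one_ne_zero
  simp only [one_pow, mul_one, mul_zero, add_zero, ne_eq, OfNat.ofNat_ne_zero, not_false_eq_true,
    zero_pow, div_one] at h1
  refine h1.congr' ?_
  have hne : ∀ᶠ p : ℂ × ℝ in 𝓝 z₁ ×ˢ 𝓝[>] 0, X₀ p.2 ≠ 0 :=
    (hX₀.eventually (Bornology.eventually_ne_cobounded 0)).prod_inr _
  have hmem : ∀ᶠ p : ℂ × ℝ in 𝓝 z₁ ×ˢ 𝓝[>] 0, p.2 ∈ Ioc (0 : ℝ) 1 :=
    (show ∀ᶠ s in 𝓝[>] (0 : ℝ), s ∈ Ioc (0 : ℝ) 1 from Ioc_mem_nhdsGT one_pos).prod_inr _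
  filter_upwards [hne, hmem] with p hp hs
  have h2 : Y₀ p.2 ^ 2 = revCubic (a z₁) (b z₁) (c z₁) (X₀ p.2)⁻¹ * X₀ p.2 ^ 3 := by
    rw [heq p.2 hs, revCubic]; field_simp
  have h3 : movedX x z₁ X₀ p.1 p.2 =
      (1 + (p.2 : ℂ) * (x p.1 - x z₁) * (X₀ p.2)⁻¹) * X₀ p.2 := by
    rw [movedX]; field_simp
  simp only [Function.uncurry, cubicRatio, Pi.div_apply]
  rw [h2, h3]
  generalize 1 + (p.2 : ℂ) * (x p.1 - x z₁) * (X₀ p.2)⁻¹ = t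
  rw [mul_comm (revCubic _ _ _ _), ← div_div]
  congr 1
  field_simp

theorem continuousOn_cubicRatio {U : Set ℂ} (hX₀ : ContinuousOn X₀ (Ioc 0 1))
    (hY₀ : ContinuousOn Y₀ (Ioc 0 1)) (h0 : ∀ s ∈ Ioc (0 : ℝ) 1, Y₀ s ≠ 0)
    (ha : ContinuousOn a U) (hb : ContinuousOn b U) (hc : ContinuousOn c U)
    (hx : ContinuousOn x U) :
    ContinuousOn (Function.uncurry (cubicRatio a b c x z₁ X₀ Y₀)) (U ×ˢ Ioc 0 1) := by
  have hl : ∀ {f : ℂ → ℂ}, ContinuousOn f U →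
      ContinuousOn (fun p : ℂ × ℝ => f p.1) (U ×ˢ Ioc 0 1) :=
    fun hf => hf.comp continuousOn_fst fun _ hp => hp.1
  have hr : ∀ {f : ℝ → ℂ}, ContinuousOn f (Ioc 0 1) →
      ContinuousOn (fun p : ℂ × ℝ => f p.2) (U ×ˢ Ioc 0 1) :=
    fun hf => hf.comp continuousOn_snd fun _ hp => hp.2
  have hs : ContinuousOn (fun p : ℂ × ℝ => (p.2 : ℂ)) (U ×ˢ Ioc 0 1) := by fun_prop
  have hm : ContinuousOn (fun p : ℂ × ℝ => movedX x z₁ X₀ p.1 p.2) (U ×ˢ Ioc 0 1) :=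
    (hr hX₀).add (hs.mul ((hl hx).sub continuousOn_const))
  exact ((((hm.pow 3).add ((hl ha).mul (hm.pow 2))).add ((hl hb).mul hm)).add (hl hc)).div
    ((hr hY₀).pow 2) fun p hp => pow_ne_zero 2 (h0 p.2 hp.2)

/-- The ratio is uniformly close to `1` along the whole path, including its start at `O`. -/
theorem eventually_norm_cubicRatio_sub_one_lt {U : Set ℂ} (hU : IsOpen U) (hz₁ : z₁ ∈ U)
    (hX₀ : ContinuousOn X₀ (Ioc 0 1)) (hY₀ : ContinuousOn Y₀ (Ioc 0 1))
    (hstart : Tendsto X₀ (𝓝[>] 0) (Bornology.cobounded ℂ))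
    (heq : ∀ s ∈ Ioc (0 : ℝ) 1, Y₀ s ^ 2 = X₀ s ^ 3 + a z₁ * X₀ s ^ 2 + b z₁ * X₀ s + c z₁)
    (h0 : ∀ s ∈ Ioc (0 : ℝ) 1, Y₀ s ≠ 0)
    (ha : ContinuousOn a U) (hb : ContinuousOn b U) (hc : ContinuousOn c U)
    (hx : ContinuousOn x U) :
    ∀ᶠ z in 𝓝 z₁, ∀ s ∈ Ioc (0 : ℝ) 1, ‖cubicRatio a b c x z₁ X₀ Y₀ z s - 1‖ < 1 := by
  have hmem := hU.mem_nhds hz₁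
  have h1 : ∀ s ∈ Ioc (0 : ℝ) 1, cubicRatio a b c x z₁ X₀ Y₀ z₁ s = 1 := by
    intro s hs
    rw [cubicRatio, movedX, sub_self, mul_zero, add_zero, ← heq s hs,
      div_self (pow_ne_zero 2 (h0 s hs))]
  have key : ∀ s₀ ∈ Icc (0 : ℝ) 1, ∀ᶠ p : ℂ × ℝ in 𝓝 (z₁, s₀), p.2 ∈ Ioc (0 : ℝ) 1 →
      ‖cubicRatio a b c x z₁ X₀ Y₀ p.1 p.2 - 1‖ < 1 := by
    intro s₀ hs₀
    rcases hs₀.1.eq_or_lt with rfl | hpos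
    · have h2 := ((tendsto_cubicRatio hstart heq (ha.continuousAt hmem) (hb.continuousAt hmem)
        (hc.continuousAt hmem) (hx.continuousAt hmem)).sub_const 1).norm
      rw [sub_self, norm_zero] at h2
      have h3 := h2.eventually_lt_const one_pos
      rw [← nhdsWithin_univ, ← nhdsWithin_prod_eq, eventually_nhdsWithin_iff] at h3
      filter_upwards [h3] with p hp hs
      exact hp ⟨mem_univ _, hs.1⟩
    · have hs₁ : s₀ ∈ Ioc (0 : ℝ) 1 := ⟨hpos, hs₀.2⟩
      have h2 := (continuousOn_cubicRatio (z₁ := z₁) hX₀ hY₀ h0 ha hb hc hx (z₁, s₀) ⟨hz₁, hs₁⟩)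
      have h3 := (h2.tendsto.sub_const 1).norm
      rw [Function.uncurry_apply_pair, h1 s₀ hs₁, sub_self, norm_zero] at h3
      have h4 := h3.eventually_lt_const one_pos
      rw [eventually_nhdsWithin_iff] at h4
      have h5 : ∀ᶠ p : ℂ × ℝ in 𝓝 (z₁, s₀), p.1 ∈ U :=
        continuous_fst.continuousAt.eventually_mem hmem
      filter_upwards [h4, h5] with p hp hpU hs
      exact hp ⟨hpU, hs⟩
  -- Compactness of `[0, 1]` makes the neighbourhood of `z₁` independent of `s`; the limit at `O`
  -- serves as the missing value at `s = 0`.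
  have := isCompact_Icc.eventually_forall_of_forall_eventually (x₀ := z₁)
    (P := fun z s => s ∈ Ioc (0 : ℝ) 1 → ‖cubicRatio a b c x z₁ X₀ Y₀ z s - 1‖ < 1) key
  filter_upwards [this] with z hz s hs
  exact hz s ⟨hs.1.le, hs.2⟩ hs

variable {K : Type*} [Field K] [Algebra ℂ K] {φ : Arc K} {E : WeierstrassCurve K} {p q : K}
  {U : Set ℂ}

/-- Every path in a fibre extends to a holomorphic family of paths in the nearby fibres. -/
theorem IsGoodSet.exists_isPathFamily (hU : IsGoodSet φ E p q U) {z₁ : ℂ} (hz₁ : z₁ ∈ U)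
    (h : IsFibrePath (φ.fibre E z₁) (φ.ev p z₁) (φ.ev q z₁) X₀ Y₀) :
    ∃ (V : Set ℂ) (X Y : ℂ → ℝ → ℂ), IsOpen V ∧ z₁ ∈ V ∧ V ⊆ U ∧ IsPathFamily φ E p q V X Y ∧
      EqOn (X z₁) X₀ (Ioc 0 1) ∧ EqOn (Y z₁) Y₀ (Ioc 0 1) := by
  set a := φ.ev E.a₂
  set b := φ.ev E.a₄
  set c := φ.ev E.a₆
  set x := φ.ev p with hx
  set y := φ.ev q with hy
  have heq : ∀ s ∈ Ioc (0 : ℝ) 1, Y₀ s ^ 2 = X₀ s ^ 3 + a z₁ * X₀ s ^ 2 + b z₁ * X₀ s + c z₁ :=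
    fun s hs => (hU.equation_iff hz₁ _ _).mp (h.equation s hs)
  have hy₁ : y z₁ ≠ 0 := hU.ne_zero z₁ hz₁
  have hev := eventually_norm_cubicRatio_sub_one_lt (x := x) hU.isOpen hz₁ h.contDiff_X.continuousOn
    h.contDiff_Y.continuousOn h.start heq h.ne_zero hU.diff_a₂.continuousOn
    hU.diff_a₄.continuousOn hU.diff_a₆.continuousOn hU.diff_x.continuousOn
  have hyev : ∀ᶠ z in 𝓝 z₁, ‖y z / y z₁ - 1‖ < 1 := by
    have h1 : ContinuousAt (fun z => ‖y z / y z₁ - 1‖) z₁ :=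
      (((hU.diff_y.continuousOn.continuousAt (hU.isOpen.mem_nhds hz₁)).div_const _).sub
        continuousAt_const).norm
    refine h1.eventually_lt_const ?_
    change ‖y z₁ / y z₁ - 1‖ < 1
    rw [div_self hy₁, sub_self, norm_zero]
    exact one_pos
  obtain ⟨V, hV, hVo, hzV⟩ := eventually_nhds_iff.mp
    ((hev.and hyev).and (hU.isOpen.mem_nhds hz₁))
  have hVU : V ⊆ U := fun z hz => (hV z hz).2
  have hρ : ∀ z ∈ V, ∀ s ∈ Ioc (0 : ℝ) 1, cubicRatio a b c x z₁ X₀ Y₀ z s ∈ Complex.slitPlane :=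
    fun z hz s hs => mem_slitPlane_of_norm_sub_one_lt ((hV z hz).1.1 s hs)
  have hsq : ∀ z ∈ V, ∀ s ∈ Ioc (0 : ℝ) 1, movedY a b c x z₁ X₀ Y₀ z s ^ 2 =
      movedX x z₁ X₀ z s ^ 3 + a z * movedX x z₁ X₀ z s ^ 2 + b z * movedX x z₁ X₀ z s + c z := by
    intro z hz s hs
    rw [movedY, mul_pow, exp_half_log_sq (Complex.slitPlane_ne_zero (hρ z hz s hs)), cubicRatio,
      mul_div_cancel₀ _ (pow_ne_zero 2 (h.ne_zero s hs))]
  have h1mem : (1 : ℝ) ∈ Ioc (0 : ℝ) 1 := ⟨one_pos, le_rfl⟩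
  have hX1 : ∀ z, movedX x z₁ X₀ z 1 = x z := by
    intro z
    rw [movedX, h.end_X]
    push_cast
    ring
  have hY1 : ∀ z ∈ V, movedY a b c x z₁ X₀ Y₀ z 1 = y z := by
    intro z hz
    -- Both sides are square roots of the same number with positive real part, so the lift ends at
    -- `y z` and not at `-y z`.
    have h1 : y z / y z₁ =
        Complex.exp (Complex.log (cubicRatio a b c x z₁ X₀ Y₀ z 1) / 2) := by
      refine eq_of_sq_eq_sq_of_re_pos ?_ ?_ (re_exp_half_log_pos (hρ z hz 1 h1mem))
      · rw [exp_half_log_sq (Complex.slitPlane_ne_zero (hρ z hz 1 h1mem)), cubicRatio, hX1, h.end_Y,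
          div_pow, hU.eqn z (hVU hz)]
      · have h2 := (Complex.abs_re_le_norm _).trans_lt (hV z hz).1.2
        rw [Complex.sub_re, Complex.one_re] at h2
        linarith [(abs_lt.mp h2).1]
    rw [movedY, ← h1, h.end_Y, mul_div_cancel₀ _ hy₁]
  -- smoothness
  have hcd : ∀ {f : ℂ → ℂ}, DifferentiableOn ℂ f U →
      ContDiffOn ℝ 1 (fun p : ℂ × ℝ => f p.1) (V ×ˢ Ioc 0 1) := by
    intro f hf
    have h1 : ContDiffOn ℝ 1 f V := ((hf.mono hVU).contDiffOn hVo).restrict_scalars ℝ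
    exact h1.comp contDiffOn_fst fun _ hp => hp.1
  have hcr : ∀ {f : ℝ → ℂ}, ContDiffOn ℝ 1 f (Ioc 0 1) →
      ContDiffOn ℝ 1 (fun p : ℂ × ℝ => f p.2) (V ×ˢ Ioc 0 1) :=
    fun hf => hf.comp contDiffOn_snd fun _ hp => hp.2
  have hcs : ContDiffOn ℝ 1 (fun p : ℂ × ℝ => (p.2 : ℂ)) (V ×ˢ Ioc 0 1) :=
    hcr Complex.ofRealCLM.contDiff.contDiffOn
  have hcX : ContDiffOn ℝ 1 (fun p : ℂ × ℝ => movedX x z₁ X₀ p.1 p.2) (V ×ˢ Ioc 0 1) :=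
    (hcr h.contDiff_X).add (hcs.mul ((hcd hU.diff_x).sub contDiffOn_const))
  have hcρ : ContDiffOn ℝ 1 (fun p : ℂ × ℝ => cubicRatio a b c x z₁ X₀ Y₀ p.1 p.2)
      (V ×ˢ Ioc 0 1) := by
    have hne : ∀ p ∈ V ×ˢ Ioc (0 : ℝ) 1, Y₀ p.2 ^ 2 ≠ 0 := fun p hp =>
      pow_ne_zero 2 (h.ne_zero p.2 hp.2)
    exact ((((hcX.pow 3).add ((hcd hU.diff_a₂).mul (hcX.pow 2))).add
      ((hcd hU.diff_a₄).mul hcX)).add (hcd hU.diff_a₆)).mul (((hcr h.contDiff_Y).pow 2).inv hne)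
  have hcY : ContDiffOn ℝ 1 (fun p : ℂ × ℝ => movedY a b c x z₁ X₀ Y₀ p.1 p.2)
      (V ×ˢ Ioc 0 1) := by
    have hlog : ContDiffOn ℝ 1 (fun p : ℂ × ℝ => Complex.log
        (cubicRatio a b c x z₁ X₀ Y₀ p.1 p.2)) (V ×ˢ Ioc 0 1) :=
      fun p hp => ContDiffAt.comp_contDiffWithinAt (g := Complex.log) p
        ((Complex.contDiffAt_log (hρ p.1 hp.1 p.2 hp.2)).restrict_scalars ℝ) (hcρ p hp)
    exact (hcr h.contDiff_Y).mul (hlog.div_const 2).cexp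
  have hdX : ∀ s : ℝ, DifferentiableOn ℂ (fun z => movedX x z₁ X₀ z s) V := fun s =>
    (differentiableOn_const _).add ((differentiableOn_const _).mul
      ((hU.diff_x.mono hVU).sub (differentiableOn_const _)))
  have hdY : ∀ s ∈ Ioc (0 : ℝ) 1,
      DifferentiableOn ℂ (fun z => movedY a b c x z₁ X₀ Y₀ z s) V := by
    intro s hs
    have h1 : DifferentiableOn ℂ (fun z => cubicRatio a b c x z₁ X₀ Y₀ z s) V :=
      (((((hdX s).pow 3).add ((hU.diff_a₂.mono hVU).mul ((hdX s).pow 2))).add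
        ((hU.diff_a₄.mono hVU).mul (hdX s))).add (hU.diff_a₆.mono hVU)).div_const _
    exact (differentiableOn_const _).mul
      ((h1.clog fun z hz => hρ z hz s hs).div_const 2).cexp
  refine ⟨V, movedX x z₁ X₀, movedY a b c x z₁ X₀ Y₀, hVo, hzV, hVU, ?_, ?_, ?_⟩
  · have hslice : ∀ {H : ℂ → ℝ → ℂ},
        ContDiffOn ℝ 1 (fun p : ℂ × ℝ => H p.1 p.2) (V ×ˢ Ioc 0 1) → ∀ z ∈ V,
        ContDiffOn ℝ 1 (H z) (Ioc 0 1) := fun hH z hz =>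
      hH.comp (contDiffOn_const.prodMk contDiffOn_id) fun s hs => ⟨hz, hs⟩
    have hst : ∀ z ∈ V, Tendsto (Function.uncurry (movedX x z₁ X₀)) (𝓝 z ×ˢ 𝓝[>] 0)
        (Bornology.cobounded ℂ) := fun z hz =>
      tendsto_movedX h.start (hU.diff_x.continuousOn.continuousAt (hU.isOpen.mem_nhds (hVU hz)))
    refine ⟨fun z hz => ⟨hslice hcX z hz, hslice hcY z hz, ?_, ?_, ?_, hX1 z, hY1 z hz⟩, hcX, hcY,
      fun s _ => hdX s, hdY, hst⟩
    · exact fun s hs => (hU.equation_iff (hVU hz) _ _).mpr (hsq z hz s hs)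
    · exact fun s hs => mul_ne_zero (h.ne_zero s hs) (Complex.exp_ne_zero _)
    · exact (hst z hz).comp (tendsto_const_nhds.prodMk tendsto_id)
  · intro s _
    simp [movedX]
  · intro s hs
    have : cubicRatio a b c x z₁ X₀ Y₀ z₁ s = 1 := by
      rw [cubicRatio, movedX, sub_self, mul_zero, add_zero, ← heq s hs,
        div_self (pow_ne_zero 2 (h.ne_zero s hs))]
    rw [movedY, this]
    simp

theorem IsGoodSet.exists_isBranch (hU : IsGoodSet φ E p q U) {z₁ : ℂ} (hz₁ : z₁ ∈ U)
    (h : IsFibrePath (φ.fibre E z₁) (φ.ev p z₁) (φ.ev q z₁) X₀ Y₀) :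
    ∃ X Y w, IsBranch φ E p q z₁ X Y w ∧ EqOn (X z₁) X₀ (Ioc 0 1) ∧ EqOn (Y z₁) Y₀ (Ioc 0 1) := by
  obtain ⟨V, X, Y, hV, hz₁V, hVU, hfam, hX, hY⟩ := hU.exists_isPathFamily hz₁ h
  have hex : ∀ z, ∃ w, z ∈ V → IsPathIntegral (X z) (Y z) w := by
    intro z
    by_cases hz : z ∈ V
    · obtain ⟨w, hw⟩ := hU.exists_isPathIntegral hV hfam ⟨hz, hVU hz⟩
      exact ⟨w, fun _ => hw⟩
    · exact ⟨0, fun h => absurd h hz⟩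
  choose w hw using hex
  exact ⟨X, Y, w, ⟨V, hV, hz₁V, hfam, hw⟩, hX, hY⟩

end Extension

/-! ### The operator `L` on a branch of the integral -/

section BranchValue

variable {K : Type*} [Field K] [Algebra ℂ K] {φ : Arc K} {E : WeierstrassCurve K} {x y : K}
  {U : Set ℂ}

open PathData in
/-- The value of the operator `L` on a branch of `∫_O^P dx/y`. -/
theorem IsGoodSet.applyL_branch (hU : IsGoodSet φ E x y U) {v : ℂ → ℂ}
    (hv : DifferentiableOn ℂ v U) {z : ℂ} (hz : z ∈ U) {X Y : ℂ → ℝ → ℂ} {w : ℂ → ℂ}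
    (hw : IsBranch φ E x y z X Y w) {A B C : K} {S : ℂ[X]} (hS4 : S.natDegree ≤ 4)
    (hS : ∀ t : ℂ, 2 * (t ^ 3 + φ.ev E.a₂ z * t ^ 2 + φ.ev E.a₄ z * t + φ.ev E.a₆ z) *
        S.derivative.eval t -
      3 * (3 * t ^ 2 + 2 * φ.ev E.a₂ z * t + φ.ev E.a₄ z) * S.eval t =
      2 * (φ.ev A z * (3 / 4 * deltaF v (φ.ev E.a₂) (φ.ev E.a₄) (φ.ev E.a₆) z t ^ 2 -
          1 / 2 * (t ^ 3 + φ.ev E.a₂ z * t ^ 2 + φ.ev E.a₄ z * t + φ.ev E.a₆ z) *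
            deltaSqF v (φ.ev E.a₂) (φ.ev E.a₄) (φ.ev E.a₆) z t) -
        1 / 2 * φ.ev B z * (t ^ 3 + φ.ev E.a₂ z * t ^ 2 + φ.ev E.a₄ z * t + φ.ev E.a₆ z) *
          deltaF v (φ.ev E.a₂) (φ.ev E.a₄) (φ.ev E.a₆) z t +
        φ.ev C z *
          (t ^ 3 + φ.ev E.a₂ z * t ^ 2 + φ.ev E.a₄ z * t + φ.ev E.a₆ z) ^ 2)) :
    φ.applyL v A B C w z =
      S.eval (φ.ev x z) / φ.ev y z ^ 3 +
        φ.ev A z * (-(v z * (deriv (φ.ev x) z / φ.ev y z) *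
            deltaF v (φ.ev E.a₂) (φ.ev E.a₄) (φ.ev E.a₆) z (φ.ev x z) / (2 * φ.ev y z ^ 2)) +
          v z * deriv (fun ζ => v ζ * (deriv (φ.ev x) ζ / φ.ev y ζ)) z) +
        φ.ev B z * (v z * (deriv (φ.ev x) z / φ.ev y z)) := by
  obtain ⟨V, hV, hzV, hfam, hint⟩ := hw
  have hp := hU.pathData hV hfam
  have hX1 : ∀ ζ ∈ V, X ζ 1 = φ.ev x ζ := fun ζ hζ => (hfam.path ζ hζ).end_X
  have hY1 : ∀ ζ ∈ V, Y ζ 1 = φ.ev y ζ := fun ζ hζ => (hfam.path ζ hζ).end_Y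
  have hd : ∀ ζ ∈ V, dz X ζ 1 = deriv (φ.ev x) ζ := fun ζ hζ =>
    EventuallyEq.deriv_eq ((hV.eventually_mem hζ).mono hX1)
  have hq : ∀ ζ ∈ V, deltaXDivY v X Y ζ 1 = v ζ * (deriv (φ.ev x) ζ / φ.ev y ζ) := fun ζ hζ => by
    rw [deltaXDivY, hd ζ hζ, hY1 ζ hζ]
  have hdq : dz (deltaXDivY v X Y) z 1 =
      deriv (fun ζ => v ζ * (deriv (φ.ev x) ζ / φ.ev y ζ)) z :=
    EventuallyEq.deriv_eq ((hV.eventually_mem hzV).mono hq)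
  have key := hp.applyL_eq_boundary (hv.mono inter_subset_right)
    (fun ζ hζ => (isPathIntegral_iff (hp.famX.hasDeriv ζ hζ) (w ζ)).mp (hint ζ hζ.1))
    ⟨hzV, hz⟩ hS4 hS
  rw [Arc.applyL, key, boundary, hdq, hq z hzV, hX1 z hzV, hY1 z hzV]

end BranchValue

/-! ### Uniqueness of derivations along a homomorphism -/

section LeibnizMaps

open Polynomial in
/-- An additive map satisfying the Leibniz rule along a ring homomorphism from a field of
characteristic zero is determined by its values on a subfield and on a transcendence basis. -/
theorem eq_zero_of_leibniz {k K R : Type*} [Field k] [Field K] [CharZero K] [Algebra k K]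
    [CommRing R] (Φ : K →+* R) (D : K →+ R) (hD : ∀ g h, D (g * h) = Φ g * D h + Φ h * D g)
    (hk : ∀ c : k, D (algebraMap k K c) = 0) {t : K}
    (halg : Algebra.IsAlgebraic (IntermediateField.adjoin k {t}) K) (ht : D t = 0) (g : K) :
    D g = 0 := by
  have hinv : ∀ g, D g = 0 → D g⁻¹ = 0 := by
    intro g hg
    rcases eq_or_ne g 0 with rfl | hg0
    · simp
    have h1 := hD g g⁻¹
    have h2 : D 1 = 0 := by simpa using hk 1
    rw [mul_inv_cancel₀ hg0, h2, hg, mul_zero, add_zero] at h1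
    have h3 : Φ g⁻¹ * (Φ g * D g⁻¹) = 0 := by rw [← h1, mul_zero]
    rwa [← mul_assoc, ← map_mul, inv_mul_cancel₀ hg0, map_one, one_mul] at h3
  -- The kernel of `D` is a field containing `k` and `t`, so `K` is algebraic over it.
  let F : IntermediateField k K :=
    { carrier := {g | D g = 0}
      mul_mem' := fun {a b} ha hb => by
        simp only [mem_ofPred_eq] at ha hb ⊢
        rw [hD, ha, hb, mul_zero, mul_zero, add_zero]
      add_mem' := fun {a b} ha hb => by
        simp only [mem_ofPred_eq] at ha hb ⊢
        rw [map_add, ha, hb, add_zero]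
      algebraMap_mem' := hk
      inv_mem' := hinv }
  have hF : ∀ c : F, D c = 0 := fun c => c.2
  have hle : IntermediateField.adjoin k {t} ≤ F := by
    rw [IntermediateField.adjoin_le_iff, singleton_subset_iff]
    exact ht
  let := (IntermediateField.inclusion hle).toRingHom.toAlgebra
  have : IsScalarTower (IntermediateField.adjoin k {t}) F K := IsScalarTower.of_algebraMap_eq' rfl
  have : Algebra.IsAlgebraic F K :=
    Algebra.IsAlgebraic.tower_top (K := IntermediateField.adjoin k {t}) F
  -- Chain rule, as `D` kills the coefficients. For the minimal polynomial of `g` the left side is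
  -- `0`, and `p'(g) ≠ 0` by separability, so `D g = 0`.
  have hmap : ∀ p : F[X], D (aeval g p) = Φ (aeval g (derivative p)) * D g := by
    have hpow : ∀ n : ℕ, D (g ^ n) = Φ (n * g ^ (n - 1)) * D g := by
      intro n
      induction n with
      | zero => simpa using hk 1
      | succ n ih =>
        rw [pow_succ, hD, ih, Nat.add_sub_cancel]
        rcases n with _ | n
        · simp
        · simp only [map_mul, map_pow, map_natCast, Nat.add_sub_cancel]
          push_cast
          ring
    intro p
    induction p using Polynomial.induction_on' with
    | add p q hp hq => simp only [map_add, hp, hq, add_mul]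
    | monomial n c =>
      rw [aeval_monomial, hD, derivative_monomial, aeval_monomial, hpow]
      change _ + _ * D (c : K) = _
      rw [hF c, mul_zero, add_zero]
      simp only [map_mul, map_natCast]
      ring
  have hint : IsIntegral F g := Algebra.IsIntegral.isIntegral g
  have h1 := hmap (minpoly F g)
  have h2 : aeval g (derivative (minpoly F g)) ≠ 0 :=
    (minpoly.irreducible hint).separable.aeval_derivative_ne_zero (minpoly.aeval F g)
  rw [minpoly.aeval, map_zero] at h1
  have h3 : Φ (aeval g (derivative (minpoly F g)))⁻¹ *
      (Φ (aeval g (derivative (minpoly F g))) * D g) = 0 := by rw [← h1, mul_zero]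
  rwa [← mul_assoc, ← map_mul, inv_mul_cancel₀ h2, map_one, one_mul] at h3

end LeibnizMaps

/-! ### Arcs and vector fields along them -/

section Arcs

variable {K : Type*} [Field K] [Algebra ℂ K]

namespace Arc

variable (φ : Arc K)

/-- The homomorphism from `K` to germs of functions at the centre of an arc. -/
def germHom : K →+* Germ (𝓝[≠] (0 : ℂ)) ℂ where
  toFun g := (φ.ev g : Germ (𝓝[≠] (0 : ℂ)) ℂ)
  map_one' := Germ.coe_eq.mpr <| by
    filter_upwards [φ.const 1] with z hz
    simpa using hz
  map_zero' := Germ.coe_eq.mpr <| by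
    filter_upwards [φ.const 0] with z hz
    simpa using hz
  map_mul' g h := Germ.coe_eq.mpr (φ.mul g h)
  map_add' g h := Germ.coe_eq.mpr (φ.add g h)

theorem eventually_ev_ne_zero {g : K} (hg : g ≠ 0) : ∀ᶠ z in 𝓝[≠] (0 : ℂ), φ.ev g z ≠ 0 := by
  have h := congrArg φ.germHom (mul_inv_cancel₀ hg)
  rw [map_mul, map_one] at h
  have h' : ∀ᶠ z in 𝓝[≠] (0 : ℂ), φ.ev g z * φ.ev g⁻¹ z = 1 := Germ.coe_eq.mp h
  filter_upwards [h'] with z hz h0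
  rw [h0, zero_mul] at hz
  exact zero_ne_one hz

theorem eq_of_eventually_ev_eq {g h : K} (hgh : ∀ᶠ z in 𝓝[≠] (0 : ℂ), φ.ev g z = φ.ev h z) :
    g = h :=
  φ.germHom.injective (Germ.coe_eq.mpr hgh)

theorem eventually_differentiableAt (g : K) :
    ∀ᶠ z in 𝓝[≠] (0 : ℂ), DifferentiableAt ℂ (φ.ev g) z :=
  (φ.meromorphic g).eventually_analyticAt.mono fun _ h => h.differentiableAt

end Arc

/-- A meromorphic function with vanishing derivative is constant. -/
theorem exists_eventually_eq_const {f : ℂ → ℂ} (hf : MeromorphicAt f 0)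
    (h : ∀ᶠ z in 𝓝[≠] (0 : ℂ), deriv f z = 0) : ∃ c, ∀ᶠ z in 𝓝[≠] (0 : ℂ), f z = c := by
  obtain ⟨r, hr, hball⟩ := Metric.mem_nhdsWithin_iff.mp (h.and hf.eventually_analyticAt)
  -- A half disc is convex, avoids the possible pole at `0` and accumulates there. So `f` is
  -- constant on it, and the dichotomy for meromorphic germs carries this to a punctured disc.
  set s : Set ℂ := Metric.ball 0 r ∩ {z | 0 < z.re} with hs
  have hsub : s ⊆ Metric.ball 0 r ∩ {0}ᶜ := fun z hz => ⟨hz.1, fun h0 => by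
    have := hz.2
    simp [mem_singleton_iff.mp h0] at this⟩
  have hso : IsOpen s := Metric.isOpen_ball.inter (isOpen_lt continuous_const Complex.continuous_re)
  have hsc : IsPreconnected s :=
    ((convex_ball 0 r).inter (convex_halfSpace_re_gt 0)).isPreconnected
  obtain ⟨c, hc⟩ := hso.exists_is_const_of_deriv_eq_zero hsc
    (fun z hz => (hball (hsub hz)).2.differentiableAt.differentiableWithinAt)
    (fun z hz => (hball (hsub hz)).1)
  refine ⟨c, ?_⟩
  rcases (hf.sub (MeromorphicAt.const c 0)).eventually_eq_zero_or_eventually_ne_zero with h0 | h0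
  · filter_upwards [h0] with z hz
    exact sub_eq_zero.mp hz
  · exfalso
    obtain ⟨r', hr', hball'⟩ := Metric.mem_nhdsWithin_iff.mp h0
    have hm : 0 < min r r' / 2 := by positivity
    have hz : ((min r r' / 2 : ℝ) : ℂ) ∈ Metric.ball (0 : ℂ) (min r r') := by
      rw [mem_ball_zero_iff, Complex.norm_real, Real.norm_of_nonneg hm.le]
      linarith
    have h1 := hball' ⟨Metric.ball_subset_ball (min_le_right _ _) hz, by
      simpa using hm.ne'⟩
    refine h1 (sub_eq_zero.mpr (hc _ ⟨Metric.ball_subset_ball (min_le_left _ _) hz, ?_⟩))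
    simpa using hm

/-- A punctured neighbourhood of `0` contains a full neighbourhood of each of its points; hence
identities between germs may be differentiated. -/
theorem eventually_eventually_nhds {P : ℂ → Prop} (h : ∀ᶠ z in 𝓝[≠] (0 : ℂ), P z) :
    ∀ᶠ z in 𝓝[≠] (0 : ℂ), ∀ᶠ ζ in 𝓝 z, P ζ := by
  filter_upwards [eventually_eventually_nhdsWithin.mpr h, self_mem_nhdsWithin] with z hz hz0
  rwa [isOpen_compl_singleton.nhdsWithin_eq hz0] at hz

namespace Arc

variable (φ : Arc K)

theorem eventually_deriv_ev_eq {g : K} {f : ℂ → ℂ}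
    (h : ∀ᶠ z in 𝓝[≠] (0 : ℂ), φ.ev g z = f z) :
    ∀ᶠ z in 𝓝[≠] (0 : ℂ), deriv (φ.ev g) z = deriv f z :=
  (eventually_eventually_nhds h).mono fun _ hz => EventuallyEq.deriv_eq hz

/-- The difference between a derivation and a vector field along an arc. -/
def derivationDefect (δ : Derivation ℂ K K) (v : ℂ → ℂ) : K →+ Germ (𝓝[≠] (0 : ℂ)) ℂ :=
  AddMonoidHom.mk'
    (fun g => ((fun z => φ.ev (δ g) z - v z * deriv (φ.ev g) z : ℂ → ℂ) :
      Germ (𝓝[≠] (0 : ℂ)) ℂ)) fun g h => by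
    refine Germ.coe_eq.mpr ?_
    have h1 := φ.add (δ g) (δ h)
    rw [← map_add] at h1
    filter_upwards [h1, φ.eventually_deriv_ev_eq (φ.add g h), φ.eventually_differentiableAt g,
      φ.eventually_differentiableAt h] with z h1 h2 h3 h4
    rw [h1, h2, deriv_fun_add h3 h4]
    ring

theorem derivationDefect_eq_zero_iff {δ : Derivation ℂ K K} {v : ℂ → ℂ} {g : K} :
    φ.derivationDefect δ v g = 0 ↔
      ∀ᶠ z in 𝓝[≠] (0 : ℂ), φ.ev (δ g) z = v z * deriv (φ.ev g) z := by
  refine (Germ.coe_eq (g := 0)).trans (eventually_congr (Eventually.of_forall fun z => ?_))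
  exact sub_eq_zero

theorem derivationDefect_mul (δ : Derivation ℂ K K) (v : ℂ → ℂ) (g h : K) :
    φ.derivationDefect δ v (g * h) = φ.germHom g * φ.derivationDefect δ v h +
      φ.germHom h * φ.derivationDefect δ v g := by
  refine Germ.coe_eq.mpr ?_
  have h1 := φ.add (g * δ h) (h * δ g)
  have h2 : δ (g * h) = g * δ h + h * δ g := δ.leibniz g h
  rw [← h2] at h1
  filter_upwards [h1, φ.mul g (δ h), φ.mul h (δ g), φ.eventually_deriv_ev_eq (φ.mul g h),
    φ.eventually_differentiableAt g, φ.eventually_differentiableAt h] with z h1 h2 h3 h4 h5 h6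
  rw [h1, h2, h3, h4, deriv_fun_mul h5 h6]
  ring

theorem derivationDefect_algebraMap (δ : Derivation ℂ K K) (v : ℂ → ℂ) (c : ℂ) :
    φ.derivationDefect δ v (algebraMap ℂ K c) = 0 := by
  rw [derivationDefect_eq_zero_iff, δ.map_algebraMap]
  filter_upwards [φ.const 0, φ.eventually_deriv_ev_eq (φ.const c)] with z h1 h2
  rw [map_zero] at h1
  rw [h1, h2, deriv_const, mul_zero]

/-- Every derivation is represented by a meromorphic vector field along every arc. -/
theorem exists_represents (δ : Derivation ℂ K K) {t : K} (ht : Transcendental ℂ t)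
    (halg : Algebra.IsAlgebraic (IntermediateField.adjoin ℂ {t}) K) :
    ∃ v, φ.Represents δ v := by
  have : CharZero K := charZero_of_injective_algebraMap (algebraMap ℂ K).injective
  -- Otherwise `t` is constant along the arc, hence a complex number, contrary to transcendence.
  have ht' : ∀ᶠ z in 𝓝[≠] (0 : ℂ), deriv (φ.ev t) z ≠ 0 := by
    rcases (φ.meromorphic t).deriv.eventually_eq_zero_or_eventually_ne_zero with h | h
    · obtain ⟨c, hc⟩ := exists_eventually_eq_const (φ.meromorphic t) h
      refine absurd ?_ ht
      have : t = algebraMap ℂ K c := φ.eq_of_eventually_ev_eq <| by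
        filter_upwards [hc, φ.const c] with z h1 h2
        rw [h1, h2]
      rw [this]
      exact isAlgebraic_algebraMap c
    · exact h
  -- The element `t` forces `v = δt/t'`. The defect `δg - v g'` obeys the Leibniz rule and vanishes
  -- on `ℂ` and `t`, hence on all of `K`.
  refine ⟨fun z => φ.ev (δ t) z / deriv (φ.ev t) z,
    (φ.meromorphic _).div (φ.meromorphic _).deriv, fun g => ?_⟩
  refine φ.derivationDefect_eq_zero_iff.mp (eq_zero_of_leibniz φ.germHom _
    (φ.derivationDefect_mul δ _) (φ.derivationDefect_algebraMap δ _) halg ?_ g)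
  rw [derivationDefect_eq_zero_iff]
  filter_upwards [ht'] with z hz
  rw [div_mul_cancel₀ _ hz]

end Arc

end Arcs

/-! ### Existence of an arc -/

section ArcExistence

open Polynomial

/-- A simple root of a polynomial with polynomial coefficients continues analytically. -/
theorem exists_analyticAt_root (p : ℂ[X][X]) {t₀ y₀ : ℂ}
    (h0 : (p.map (evalRingHom t₀)).eval y₀ = 0)
    (h1 : (derivative (p.map (evalRingHom t₀))).eval y₀ ≠ 0) :
    ∃ ψ : ℂ → ℂ, AnalyticAt ℂ ψ t₀ ∧ ∀ᶠ t in 𝓝 t₀, (p.map (evalRingHom t)).eval (ψ t) = 0 := by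
  set f : ℂ × ℂ → ℂ := fun u => (p.map (evalRingHom u.1)).eval u.2 with hf
  have hsum : f = fun u => ∑ i ∈ p.support, (p.coeff i).eval u.1 * u.2 ^ i := by
    funext u
    rw [hf]
    simp only [eval_map, eval₂_eq_sum, Polynomial.sum, coe_evalRingHom]
  have hcd : ContDiff ℂ (⊤ : WithTop ℕ∞) f := by
    rw [hsum]
    refine ContDiff.sum fun i _ => ContDiff.mul ?_ (contDiff_snd.pow i)
    simpa only [coe_aeval_eq_eval, Function.comp_def] using
      (contDiff_aeval (𝕜 := ℂ) (p.coeff i) (⊤ : WithTop ℕ∞)).comp contDiff_fst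
  have hcda : ContDiffAt ℂ (⊤ : WithTop ℕ∞) f (t₀, y₀) := hcd.contDiffAt
  have hd : HasFDerivAt f (fderiv ℂ f (t₀, y₀)) (t₀, y₀) :=
    (hcd.differentiable (by simp)).differentiableAt.hasFDerivAt
  have hinv : (fderiv ℂ f (t₀, y₀) ∘L .inr ℂ ℂ ℂ).IsInvertible := by
    have h2 : HasFDerivAt (fun y : ℂ => f (t₀, y)) (fderiv ℂ f (t₀, y₀) ∘L .inr ℂ ℂ ℂ) y₀ :=
      hd.comp y₀ (hasFDerivAt_prodMk_right t₀ y₀)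
    have h3 := ((p.map (evalRingHom t₀)).hasDerivAt y₀).hasFDerivAt
    rw [h2.unique h3]
    refine ⟨ContinuousLinearEquiv.smulLeft (Units.mk0 _ h1), ?_⟩
    ext
    simp
  refine ⟨hcda.implicitFunction (by simp) hinv, ?_, ?_⟩
  · exact (hcda.contDiffAt_implicitFunction (by simp) hinv).analyticAt
  · filter_upwards [hcda.eventually_apply_implicitFunction (by simp) hinv] with t ht
    exact ht.trans h0

/-- The ring of germs of meromorphic functions at `0`. -/
def meromorphicGerms : Subring (Germ (𝓝[≠] (0 : ℂ)) ℂ) where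
  carrier := {γ | ∃ f : ℂ → ℂ, MeromorphicAt f 0 ∧ (f : Germ (𝓝[≠] (0 : ℂ)) ℂ) = γ}
  mul_mem' := by
    rintro _ _ ⟨f, hf, rfl⟩ ⟨g, hg, rfl⟩
    exact ⟨f * g, hf.mul hg, rfl⟩
  one_mem' := ⟨1, MeromorphicAt.const 1 0, rfl⟩
  add_mem' := by
    rintro _ _ ⟨f, hf, rfl⟩ ⟨g, hg, rfl⟩
    exact ⟨f + g, hf.add hg, rfl⟩
  zero_mem' := ⟨0, MeromorphicAt.const 0 0, rfl⟩
  neg_mem' := by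
    rintro _ ⟨f, hf, rfl⟩
    exact ⟨-f, hf.neg, rfl⟩

/-- A meromorphic germ is zero or free of zeros near the centre. This lets homomorphisms from `ℂ[X]`
extend to `ℂ(X)`. -/
theorem isUnit_meromorphicGerms {γ : meromorphicGerms} (hγ : γ ≠ 0) : IsUnit γ := by
  obtain ⟨_, f, hf, rfl⟩ := γ
  have h : ∀ᶠ z in 𝓝[≠] (0 : ℂ), f z ≠ 0 :=
    hf.eventually_eq_zero_or_eventually_ne_zero.resolve_left fun h0 =>
      hγ (Subtype.ext (Germ.coe_eq.mpr h0))
  refine IsUnit.of_mul_eq_one ⟨(f⁻¹ : ℂ → ℂ), f⁻¹, hf.inv, rfl⟩ (Subtype.ext (Germ.coe_eq.mpr ?_))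
  filter_upwards [h] with z hz
  exact mul_inv_cancel₀ hz

/-- Polynomials as germs of functions at the point `t₀`. -/
def polynomialGerm (t₀ : ℂ) : ℂ[X] →+* meromorphicGerms where
  toFun q := ⟨((fun z => q.eval (t₀ + z) : ℂ → ℂ) : Germ (𝓝[≠] (0 : ℂ)) ℂ), _,
    AnalyticAt.meromorphicAt ((AnalyticAt.aeval_polynomial (f := fun z => t₀ + z)
      (analyticAt_const.add analyticAt_id) q).congr (by simp [coe_aeval_eq_eval])), rfl⟩
  map_one' := Subtype.ext <| Germ.coe_eq.mpr <| Eventually.of_forall fun z => by simp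
  map_zero' := Subtype.ext <| Germ.coe_eq.mpr <| Eventually.of_forall fun z => by simp
  map_mul' p q := Subtype.ext <| Germ.coe_eq.mpr <| Eventually.of_forall fun z => by simp
  map_add' p q := Subtype.ext <| Germ.coe_eq.mpr <| Eventually.of_forall fun z => by simp

theorem polynomialGerm_ne_zero (t₀ : ℂ) {q : ℂ[X]} (hq : q ≠ 0) : polynomialGerm t₀ q ≠ 0 := by
  intro h
  have h1 : ∀ᶠ z in 𝓝[≠] (0 : ℂ), q.eval (t₀ + z) = 0 := Germ.coe_eq.mp (Subtype.ext_iff.mp h)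
  have h2 : {z | q.eval (t₀ + z) = 0}.Finite :=
    (q.finite_setOfPred_isRoot hq).preimage (add_right_injective t₀).injOn
  have h3 : ∀ᶠ z in 𝓝[≠] (0 : ℂ), ¬ q.eval (t₀ + z) = 0 :=
    nhdsNE_le_cofinite 0 h2.compl_mem_cofinite
  obtain ⟨z, hz, hz'⟩ := (h1.and h3).exists
  exact hz' hz

variable {K : Type*} [Field K] [Algebra ℂ K]

/-- A homomorphism to germs of meromorphic functions gives an arc. -/
theorem nonempty_arc_of_ringHom (Φ : K →+* meromorphicGerms)
    (hΦ : ∀ c : ℂ, (Φ (algebraMap ℂ K c) : Germ (𝓝[≠] (0 : ℂ)) ℂ) = (fun _ => c : ℂ → ℂ)) :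
    Nonempty (Arc K) := by
  choose ev hmer hev using fun g => (Φ g).2
  refine ⟨⟨ev, hmer, fun c => ?_, fun g h => ?_, fun g h => ?_⟩⟩
  · exact Germ.coe_eq.mp ((hev _).trans (hΦ c))
  · refine (Germ.coe_eq (g := fun z => ev g z + ev h z)).mp ((hev _).trans ?_)
    rw [map_add, Subring.coe_add, ← hev g, ← hev h]
    rfl
  · refine (Germ.coe_eq (g := fun z => ev g z * ev h z)).mp ((hev _).trans ?_)
    rw [map_mul, Subring.coe_mul, ← hev g, ← hev h]
    rfl

theorem exists_transcendental_of_trdeg (htr : Algebra.trdeg ℂ K = 1) :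
    ∃ t : K, Transcendental ℂ t ∧ Algebra.IsAlgebraic (IntermediateField.adjoin ℂ {t}) K := by
  obtain ⟨s, hs⟩ := exists_isTranscendenceBasis ℂ K
  have hcard : Cardinal.mk s = 1 := hs.cardinalMk_eq_trdeg.trans htr
  obtain ⟨t, rfl⟩ := Cardinal.mk_set_eq_one_iff.mp hcard
  refine ⟨t, hs.1.transcendental ⟨t, rfl⟩, ?_⟩
  convert! hs.isAlgebraic_field <;> simp

/-- The discriminant of an irreducible monic polynomial over `ℂ[X]`, in the form of a Bézout
identity. -/
theorem exists_mul_add_derivative_mul_eq_C {p : ℂ[X][X]} (hp : p.Monic) (hpi : Irreducible p) :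
    ∃ (a b : ℂ[X][X]) (d : ℂ[X]), d ≠ 0 ∧ p * a + derivative p * b = C d := by
  have hp0 : p.natDegree ≠ 0 := fun h =>
    hpi.not_isUnit (by rw [eq_one_of_monic_natDegree_zero hp h]; exact isUnit_one)
  obtain ⟨a, b, -, -, h⟩ := exists_mul_add_mul_eq_C_resultant p (derivative p) le_rfl le_rfl
    (Or.inl hp0)
  refine ⟨a, b, _, ?_, h⟩
  have hinj := IsFractionRing.injective ℂ[X] (FractionRing ℂ[X])
  -- By Gauss' lemma `p` stays irreducible over `ℂ(X)`, so it is separable there and its resultant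
  -- with `p'` is non-zero.
  have hirr : Irreducible (p.map (algebraMap ℂ[X] (FractionRing ℂ[X]))) :=
    (hp.irreducible_iff_irreducible_map_fraction_map).mp hpi
  intro h0
  have h1 := resultant_map_map p (derivative p) p.natDegree (derivative p).natDegree
    (algebraMap ℂ[X] (FractionRing ℂ[X]))
  rw [h0, map_zero, ← natDegree_map_eq_of_injective hinj p,
    ← natDegree_map_eq_of_injective hinj (derivative p), resultant_eq_zero_iff,
    ← derivative_map] at h1
  exact h1.2 hirr.separable

open scoped IntermediateField.algebraAdjoinAdjoin in
-- `K` is finite over `ℂ(t)`, generated by some `α` integral over `ℂ[t]`. Over a point `t₀` off the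
-- discriminant the minimal polynomial has a simple root, which continues to an analytic root `ψ`;
-- then `t ↦ t₀ + z`, `α ↦ ψ(t₀ + z)` defines a homomorphism to meromorphic germs.
theorem nonempty_arc (hfg : (⊤ : IntermediateField ℂ K).FG) {t : K} (ht : Transcendental ℂ t)
    (halg : Algebra.IsAlgebraic (IntermediateField.adjoin ℂ {t}) K) : Nonempty (Arc K) := by
  have : CharZero K := charZero_of_injective_algebraMap (algebraMap ℂ K).injective
  have : Algebra.IsAlgebraic (Algebra.adjoin ℂ {t}) K :=
    (IsFractionRing.comap_isAlgebraic_iff (K := IntermediateField.adjoin ℂ {t})).mpr halg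
  let : Algebra ℂ[X] K := (aeval t).toRingHom.toAlgebra
  have hmapX : ∀ q : ℂ[X], algebraMap ℂ[X] K q = aeval t q := fun q => rfl
  have : IsScalarTower ℂ ℂ[X] K := IsScalarTower.of_algebraMap_eq fun c => by
    rw [hmapX, Polynomial.algebraMap_apply, Algebra.algebraMap_self, RingHom.id_apply, aeval_C]
  have : FaithfulSMul ℂ[X] K := (faithfulSMul_iff_algebraMap_injective _ _).mpr
    (transcendental_iff_injective.mp ht)
  have hX : Algebra.IsAlgebraic ℂ[X] K := by
    let r : ℂ[X] →+* Algebra.adjoin ℂ {t} :=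
      (aeval (⟨t, Algebra.self_mem_adjoin_singleton ℂ t⟩ : Algebra.adjoin ℂ {t})).toRingHom
    refine Algebra.IsAlgebraic.of_ringHom_of_comp_eq r (RingHom.id K) ?_
      Function.injective_id ?_
    · rintro ⟨g, hg⟩
      obtain ⟨q, rfl⟩ := (Algebra.adjoin_singleton_eq_range_aeval ℂ t ▸ hg :
        g ∈ (aeval (R := ℂ) t).range)
      refine ⟨q, Subtype.ext ?_⟩
      exact (aeval_algHom_apply (Algebra.adjoin ℂ {t}).val _ q).symm
    · exact RingHom.ext fun q => (aeval_algHom_apply (Algebra.adjoin ℂ {t}).val _ q).symm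
  let Q := FractionRing ℂ[X]
  let : Algebra Q K := FractionRing.liftAlgebra ℂ[X] K
  have : IsScalarTower ℂ[X] Q K := FractionRing.isScalarTower_liftAlgebra ℂ[X] K
  have : Algebra.IsAlgebraic Q K := IsFractionRing.comap_isAlgebraic_iff.mp hX
  have : Algebra.EssFiniteType ℂ K := IntermediateField.fg_top_iff.mp hfg
  have : IsScalarTower ℂ Q K := inferInstance
  have : Algebra.EssFiniteType Q K := Algebra.EssFiniteType.of_comp ℂ Q K
  have : Module.Finite Q K := Algebra.finite_of_essFiniteType_of_isAlgebraic
  -- an integral primitive element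
  obtain ⟨α₀, hα₀⟩ := Field.exists_primitive_element Q K
  obtain ⟨e, he, hα⟩ := (hX.isAlgebraic α₀).exists_integral_multiple
  set α := e • α₀ with hαdef
  have hgen : Algebra.adjoin Q {α} = ⊤ := by
    have h1 : Algebra.adjoin Q {α₀} = ⊤ :=
      Algebra.adjoin_eq_top_of_primitive_element (Algebra.IsAlgebraic.isAlgebraic α₀) hα₀
    rw [eq_top_iff, ← h1, Algebra.adjoin_le_iff, singleton_subset_iff]
    have h2 : α₀ = (algebraMap ℂ[X] Q e)⁻¹ • α := by
      rw [hαdef, ← algebraMap_smul Q e α₀, inv_smul_smul₀]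
      exact (map_ne_zero_iff _ (IsFractionRing.injective ℂ[X] Q)).mpr he
    rw [h2]
    exact Subalgebra.smul_mem _ (Algebra.self_mem_adjoin_singleton Q α) _
  let pb := PowerBasis.ofAdjoinEqTop hα.tower_top hgen
  have hmin : minpoly Q α = (minpoly ℂ[X] α).map (algebraMap ℂ[X] Q) :=
    minpoly.isIntegrallyClosed_eq_field_fractions' Q hα
  set p := minpoly ℂ[X] α with hp
  have hpm : p.Monic := minpoly.monic hα
  obtain ⟨a, b, d, hd, hbez⟩ := exists_mul_add_derivative_mul_eq_C hpm (minpoly.irreducible hα)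
  obtain ⟨t₀, ht₀⟩ : ∃ t₀, d.eval t₀ ≠ 0 := by
    by_contra! h
    exact hd (Polynomial.funext fun z => by simpa using h z)
  obtain ⟨y₀, hy₀⟩ : ∃ y₀, (p.map (evalRingHom t₀)).eval y₀ = 0 := by
    refine IsAlgClosed.exists_root _ ?_
    rw [hpm.degree_map]
    exact (minpoly.degree_pos hα).ne'
  have hy₁ : (derivative (p.map (evalRingHom t₀))).eval y₀ ≠ 0 := by
    intro h
    have h1 := congrArg (fun q => (q.map (evalRingHom t₀)).eval y₀) hbez
    simp only [Polynomial.map_add, Polynomial.map_mul, eval_add, eval_mul, hy₀, ← derivative_map,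
      h, zero_mul, add_zero, map_C, eval_C, coe_evalRingHom] at h1
    exact ht₀ h1.symm
  obtain ⟨ψ, hψ, hroot⟩ := exists_analyticAt_root p hy₀ hy₁
  have hunit : ∀ q : nonZeroDivisors ℂ[X], IsUnit (polynomialGerm t₀ q) := fun q =>
    isUnit_meromorphicGerms (polynomialGerm_ne_zero t₀ (nonZeroDivisors.ne_zero q.2))
  let ι : Q →+* meromorphicGerms := IsLocalization.lift (M := nonZeroDivisors ℂ[X]) hunit
  have hι : ∀ q : ℂ[X], ι (algebraMap ℂ[X] Q q) = polynomialGerm t₀ q :=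
    IsLocalization.lift_eq hunit
  let := ι.toAlgebra
  let η : meromorphicGerms := ⟨((fun z => ψ (t₀ + z) : ℂ → ℂ) : Germ (𝓝[≠] (0 : ℂ)) ℂ), _,
    AnalyticAt.meromorphicAt (AnalyticAt.comp (g := ψ) (f := fun z => t₀ + z) (by simpa using hψ)
      (analyticAt_const.add analyticAt_id)), rfl⟩
  have hη : aeval η (minpoly Q pb.gen) = 0 := by
    rw [PowerBasis.ofAdjoinEqTop_gen, hmin, aeval_def, eval₂_map]
    have : (algebraMap Q meromorphicGerms).comp (algebraMap ℂ[X] Q) = polynomialGerm t₀ :=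
      RingHom.ext hι
    rw [this]
    have heval : ∀ q : ℂ[X][X], ((eval₂ (polynomialGerm t₀) η q : meromorphicGerms) :
        Germ (𝓝[≠] (0 : ℂ)) ℂ) =
        (fun z => (q.map (evalRingHom (t₀ + z))).eval (ψ (t₀ + z)) : ℂ → ℂ) := by
      intro q
      induction q using Polynomial.induction_on' with
      | add q r hq hr =>
        rw [eval₂_add, Subring.coe_add, hq, hr]
        refine Germ.coe_eq.mpr (Eventually.of_forall fun z => ?_)
        simp
      | monomial n c =>
        rw [eval₂_monomial]
        refine Germ.coe_eq.mpr (Eventually.of_forall fun z => ?_)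
        simp
    refine Subtype.ext ((heval p).trans (Germ.coe_eq.mpr ?_))
    have htend : Tendsto (fun z => t₀ + z) (𝓝[≠] (0 : ℂ)) (𝓝 t₀) :=
      Tendsto.mono_left (by simpa using (continuous_const_add t₀).tendsto (0 : ℂ))
        nhdsWithin_le_nhds
    exact htend.eventually hroot
  let Φ : K →+* meromorphicGerms := (pb.lift η hη).toRingHom
  refine nonempty_arc_of_ringHom Φ fun c => ?_
  have : Φ (algebraMap ℂ K c) = polynomialGerm t₀ (C c) := by
    rw [← hι, IsScalarTower.algebraMap_apply ℂ Q K]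
    exact ((pb.lift η hη).commutes _)
  rw [this]
  refine Germ.coe_eq.mpr (Eventually.of_forall fun z => ?_)
  simp

end ArcExistence

/-! ### Specialization of the algebraic identities along an arc -/

section ManinValue

variable {K : Type*} [Field K] [Algebra ℂ K] (φ : Arc K)

namespace Arc

theorem germHom_div (g h : K) : φ.germHom (g / h) = φ.germHom g / φ.germHom h := by
  rcases eq_or_ne h 0 with rfl | hh
  · rw [div_zero, map_zero]
    exact Germ.coe_eq.mpr (Eventually.of_forall fun z => (div_zero _).symm)
  · have h1 := φ.mul (g / h) h
    rw [div_mul_cancel₀ g hh] at h1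
    refine Germ.coe_eq.mpr ?_
    filter_upwards [h1, φ.eventually_ev_ne_zero hh] with z hz hz0
    exact eq_div_of_mul_eq hz0 hz.symm

/-- The specialization of polynomials over `K` along an arc. -/
def specialize : K[X] →+* Germ (𝓝[≠] (0 : ℂ)) ℂ[X] :=
  Polynomial.eval₂RingHom
    { toFun := fun g => ((fun z => Polynomial.C (φ.ev g z) : ℂ → ℂ[X]) : Germ (𝓝[≠] (0 : ℂ)) ℂ[X])
      map_one' := Germ.coe_eq.mpr <| by
        have : ∀ᶠ z in 𝓝[≠] (0 : ℂ), φ.ev 1 z = 1 := Germ.coe_eq.mp (map_one φ.germHom)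
        filter_upwards [this] with z hz
        simp [hz]
      map_zero' := Germ.coe_eq.mpr <| by
        have : ∀ᶠ z in 𝓝[≠] (0 : ℂ), φ.ev 0 z = 0 := Germ.coe_eq.mp (map_zero φ.germHom)
        filter_upwards [this] with z hz
        simp [hz]
      map_mul' := fun g h => Germ.coe_eq.mpr <| by
        filter_upwards [φ.mul g h] with z hz
        simp [hz]
      map_add' := fun g h => Germ.coe_eq.mpr <| by
        filter_upwards [φ.add g h] with z hz
        simp [hz] }
    ((fun _ => Polynomial.X : ℂ → ℂ[X]) : Germ (𝓝[≠] (0 : ℂ)) ℂ[X])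

theorem specialize_C (g : K) : φ.specialize (.C g) =
    ((fun z => .C (φ.ev g z) : ℂ → ℂ[X]) : Germ (𝓝[≠] (0 : ℂ)) ℂ[X]) :=
  Polynomial.eval₂_C _ _

theorem specialize_X : φ.specialize .X =
    ((fun _ => .X : ℂ → ℂ[X]) : Germ (𝓝[≠] (0 : ℂ)) ℂ[X]) :=
  Polynomial.eval₂_X _ _

end Arc

/-- With five explicit coefficients, derivatives and specializations of `S` can be computed term by
term. -/
theorem polynomial_eq_of_natDegree_le_four {R : Type*} [CommRing R] {S : R[X]}
    (hS : S.natDegree ≤ 4) :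
    S = .C (S.coeff 0) + .C (S.coeff 1) * .X + .C (S.coeff 2) * .X ^ 2 + .C (S.coeff 3) * .X ^ 3 +
      .C (S.coeff 4) * .X ^ 4 := by
  conv_lhs => rw [S.as_sum_range_C_mul_X_pow' (Nat.lt_succ_of_le hS)]
  simp [Finset.sum_range_succ]

variable {φ} {δ : Derivation ℂ K K} {v : ℂ → ℂ} {E : WeierstrassCurve K}

/-- The differential equation for the primitive of `L(dx/y)`, specialized along an arc. -/
theorem eventually_specialize_primitive (hv : φ.Represents δ v) {A B C : K} {S : K[X]}
    (hS4 : S.natDegree ≤ 4)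
    (hS : 2 * cubic E * Polynomial.derivative S - 3 * Polynomial.derivative (cubic E) * S =
        2 * numeratorL δ E A B C) :
    ∀ᶠ z in 𝓝[≠] (0 : ℂ), ∃ T : ℂ[X], T.natDegree ≤ 4 ∧
      (∀ t, T.eval t = φ.ev (S.coeff 0) z + φ.ev (S.coeff 1) z * t + φ.ev (S.coeff 2) z * t ^ 2 +
        φ.ev (S.coeff 3) z * t ^ 3 + φ.ev (S.coeff 4) z * t ^ 4) ∧
      ∀ t : ℂ, 2 * (t ^ 3 + φ.ev E.a₂ z * t ^ 2 + φ.ev E.a₄ z * t + φ.ev E.a₆ z) *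
          T.derivative.eval t -
        3 * (3 * t ^ 2 + 2 * φ.ev E.a₂ z * t + φ.ev E.a₄ z) * T.eval t =
        2 * (φ.ev A z * (3 / 4 *
              PathData.deltaF v (φ.ev E.a₂) (φ.ev E.a₄) (φ.ev E.a₆) z t ^ 2 -
            1 / 2 * (t ^ 3 + φ.ev E.a₂ z * t ^ 2 + φ.ev E.a₄ z * t + φ.ev E.a₆ z) *
              PathData.deltaSqF v (φ.ev E.a₂) (φ.ev E.a₄) (φ.ev E.a₆) z t) -
          1 / 2 * φ.ev B z * (t ^ 3 + φ.ev E.a₂ z * t ^ 2 + φ.ev E.a₄ z * t + φ.ev E.a₆ z) *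
            PathData.deltaF v (φ.ev E.a₂) (φ.ev E.a₄) (φ.ev E.a₆) z t +
          φ.ev C z *
            (t ^ 3 + φ.ev E.a₂ z * t ^ 2 + φ.ev E.a₄ z * t + φ.ev E.a₆ z) ^ 2) := by
  have hsq : ∀ a : K, ∀ᶠ z in 𝓝[≠] (0 : ℂ),
      φ.ev (δ (δ a)) z = v z * deriv (fun ζ => v ζ * deriv (φ.ev a) ζ) z := fun a => by
    filter_upwards [hv.2 (δ a), φ.eventually_deriv_ev_eq (hv.2 a)] with z h1 h2
    rw [h1, h2]
  rw [polynomial_eq_of_natDegree_le_four hS4] at hS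
  have h := congrArg φ.specialize hS
  simp only [cubic, numeratorL, deltaCubicPoly, deltaSqCubicPoly,
    Polynomial.derivative_mul, Polynomial.derivative_C, Polynomial.derivative_X,
    Polynomial.derivative_X_pow, map_add, map_sub, map_mul, map_pow, map_zero, map_one,
    map_ofNat, Arc.specialize_C, Arc.specialize_X, map_natCast] at h
  have h' := Germ.coe_eq.mp h
  have h34 : ∀ᶠ z in 𝓝[≠] (0 : ℂ), φ.ev (3 / 4) z = 3 / 4 := by
    simpa only [map_div₀, map_ofNat] using φ.const (3 / 4)
  have h12 : ∀ᶠ z in 𝓝[≠] (0 : ℂ), φ.ev (1 / 2) z = 1 / 2 := by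
    simpa only [map_div₀, map_ofNat, map_one] using φ.const (1 / 2)
  filter_upwards [h', h34, h12, hv.2 E.a₂, hv.2 E.a₄, hv.2 E.a₆, hsq E.a₂, hsq E.a₄, hsq E.a₆]
    with z hz h34 h12 h2 h4 h6 hh2 hh4 hh6
  refine ⟨.C (φ.ev (S.coeff 0) z) + .C (φ.ev (S.coeff 1) z) * .X +
    .C (φ.ev (S.coeff 2) z) * .X ^ 2 + .C (φ.ev (S.coeff 3) z) * .X ^ 3 +
    .C (φ.ev (S.coeff 4) z) * .X ^ 4, by compute_degree, fun t => by simp, fun t => ?_⟩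
  simp only [Function.comp_apply, Pi.natCast_apply] at hz
  have hzt := congrArg (Polynomial.eval t) hz
  simp only [h34, h12, h2, h4, h6, hh2, hh4, hh6, Polynomial.eval_add, Polynomial.eval_mul,
    Polynomial.eval_sub, Polynomial.eval_pow, Polynomial.eval_C, Polynomial.eval_X,
    Polynomial.eval_zero, Polynomial.eval_one, Polynomial.eval_ofNat, Nat.cast_ofNat] at hzt
  simp only [Polynomial.derivative_add, Polynomial.derivative_mul, Polynomial.derivative_C,
    Polynomial.derivative_X, Polynomial.derivative_X_pow, Polynomial.eval_add, Polynomial.eval_mul,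
    Polynomial.eval_pow, Polynomial.eval_C, Polynomial.eval_X, Polynomial.eval_zero,
    Polynomial.eval_one, Nat.cast_ofNat, PathData.deltaF, PathData.deltaSqF]
  clear h hS
  linear_combination hzt

end ManinValue

/-! ### The value of the Manin map -/

section Main

variable {K : Type*} [Field K] [Algebra ℂ K] {φ : Arc K} {δ : Derivation ℂ K K} {v : ℂ → ℂ}
  {E : WeierstrassCurve K} {x y : K}

/-- All parameters close to the centre of an arc have a good neighbourhood. -/
theorem eventually_exists_isGoodSet [E.IsCharNeTwoNF] (hv : MeromorphicAt v 0)
    (hP : E.toAffine.Equation x y) (hy : y ≠ 0) :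
    ∀ᶠ z in 𝓝[≠] (0 : ℂ), ∃ U, z ∈ U ∧ IsGoodSet φ E x y U ∧ DifferentiableOn ℂ v U := by
  have h0 : ∀ᶠ z in 𝓝[≠] (0 : ℂ), φ.ev 0 z = 0 := Germ.coe_eq.mp (map_zero φ.germHom)
  have heq : y ^ 2 = x ^ 3 + E.a₂ * x ^ 2 + E.a₄ * x + E.a₆ := by
    have h := (WeierstrassCurve.Affine.equation_iff x y).mp hP
    simpa using h
  have hev : ∀ᶠ z in 𝓝[≠] (0 : ℂ), φ.ev y z ^ 2 =
      φ.ev x z ^ 3 + φ.ev E.a₂ z * φ.ev x z ^ 2 + φ.ev E.a₄ z * φ.ev x z + φ.ev E.a₆ z := by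
    have h := congrArg φ.germHom heq
    simp only [map_add, map_mul, map_pow] at h
    exact Germ.coe_eq.mp h
  filter_upwards [eventually_eventually_nhds h0, eventually_eventually_nhds hev,
    eventually_eventually_nhds (φ.eventually_ev_ne_zero hy),
    eventually_eventually_nhds (φ.eventually_differentiableAt E.a₂),
    eventually_eventually_nhds (φ.eventually_differentiableAt E.a₄),
    eventually_eventually_nhds (φ.eventually_differentiableAt E.a₆),
    eventually_eventually_nhds (φ.eventually_differentiableAt x),
    eventually_eventually_nhds (φ.eventually_differentiableAt y),
    eventually_eventually_nhds hv.eventually_analyticAt] with z h0 h1 h2 h3 h4 h5 h6 h7 h8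
  obtain ⟨U, hU, hUo, hz⟩ := eventually_nhds_iff.mp
    (h0.and (h1.and (h2.and (h3.and (h4.and (h5.and (h6.and (h7.and h8))))))))
  refine ⟨U, hz, ⟨hUo, fun ζ hζ => ?_, fun ζ hζ => ?_, ?_, ?_, ?_, ?_, ?_, ?_, ?_⟩, ?_⟩
  · rw [WeierstrassCurve.a₁_of_isCharNeTwoNF]
    exact (hU ζ hζ).1
  · rw [WeierstrassCurve.a₃_of_isCharNeTwoNF]
    exact (hU ζ hζ).1
  · exact fun ζ hζ => (hU ζ hζ).2.2.2.1.differentiableWithinAt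
  · exact fun ζ hζ => (hU ζ hζ).2.2.2.2.1.differentiableWithinAt
  · exact fun ζ hζ => (hU ζ hζ).2.2.2.2.2.1.differentiableWithinAt
  · exact fun ζ hζ => (hU ζ hζ).2.2.2.2.2.2.1.differentiableWithinAt
  · exact fun ζ hζ => (hU ζ hζ).2.2.2.2.2.2.2.1.differentiableWithinAt
  · exact fun ζ hζ => (hU ζ hζ).2.1
  · exact fun ζ hζ => (hU ζ hζ).2.2.1
  · exact fun ζ hζ => (hU ζ hζ).2.2.2.2.2.2.2.2.differentiableAt.differentiableWithinAt

/-- The value of the Manin map, for the primitive `S(x) / y³` of `L(dx/y)`. -/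
def maninValue (δ : Derivation ℂ K K) (E : WeierstrassCurve K) (A B : K) (S : K[X]) (x y : K) : K :=
  S.eval x / y ^ 3 + A * (δ x * (-deltaCubic δ E x) / (2 * y ^ 3) + δ (δ x / y)) + B * (δ x / y)

/-- Along the arc `δ` becomes `v d/dz`, which turns the algebraic formula into the boundary term at
`P` found analytically. -/
theorem eventually_ev_maninValue (hv : φ.Represents δ v) (hy : y ≠ 0) (A B : K) {S : K[X]}
    (hS4 : S.natDegree ≤ 4) :
    ∀ᶠ z in 𝓝[≠] (0 : ℂ), φ.ev (maninValue δ E A B S x y) z =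
      (φ.ev (S.coeff 0) z + φ.ev (S.coeff 1) z * φ.ev x z + φ.ev (S.coeff 2) z * φ.ev x z ^ 2 +
        φ.ev (S.coeff 3) z * φ.ev x z ^ 3 + φ.ev (S.coeff 4) z * φ.ev x z ^ 4) / φ.ev y z ^ 3 +
        φ.ev A z * (-(v z * (deriv (φ.ev x) z / φ.ev y z) *
            PathData.deltaF v (φ.ev E.a₂) (φ.ev E.a₄) (φ.ev E.a₆) z (φ.ev x z) /
              (2 * φ.ev y z ^ 2)) +
          v z * deriv (fun ζ => v ζ * (deriv (φ.ev x) ζ / φ.ev y ζ)) z) +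
        φ.ev B z * (v z * (deriv (φ.ev x) z / φ.ev y z)) := by
  have h1 : ∀ᶠ z in 𝓝[≠] (0 : ℂ), φ.ev (maninValue δ E A B S x y) z =
      (φ.ev (S.coeff 0) z + φ.ev (S.coeff 1) z * φ.ev x z + φ.ev (S.coeff 2) z * φ.ev x z ^ 2 +
        φ.ev (S.coeff 3) z * φ.ev x z ^ 3 + φ.ev (S.coeff 4) z * φ.ev x z ^ 4) / φ.ev y z ^ 3 +
        φ.ev A z * (φ.ev (δ x) z * (-(φ.ev (δ E.a₂) z * φ.ev x z ^ 2 +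
          φ.ev (δ E.a₄) z * φ.ev x z + φ.ev (δ E.a₆) z)) / ((2 : ℕ) * φ.ev y z ^ 3) +
            φ.ev (δ (δ x / y)) z) + φ.ev B z * φ.ev (δ x / y) z := by
    refine Germ.coe_eq.mp ((congrArg φ.germHom (?_ : _ =
      (S.coeff 0 + S.coeff 1 * x + S.coeff 2 * x ^ 2 + S.coeff 3 * x ^ 3 + S.coeff 4 * x ^ 4) /
        y ^ 3 + A * (δ x * (-(δ E.a₂ * x ^ 2 + δ E.a₄ * x + δ E.a₆)) / ((2 : ℕ) * y ^ 3) +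
          δ (δ x / y)) + B * (δ x / y))).trans ?_)
    · have hS : S.eval x = S.coeff 0 + S.coeff 1 * x + S.coeff 2 * x ^ 2 + S.coeff 3 * x ^ 3 +
          S.coeff 4 * x ^ 4 := by
        conv_lhs => rw [polynomial_eq_of_natDegree_le_four hS4]
        simp
      rw [maninValue, deltaCubic, hS, Nat.cast_ofNat]
    -- This quotient is kept as one element: it also occurs under `δ`, and its germ is computed
    -- separately.
    · set r := δ x / y
      simp only [map_add, map_mul, map_pow, map_neg, Arc.germHom_div, map_natCast]
      rfl
  have h2 : ∀ᶠ z in 𝓝[≠] (0 : ℂ), φ.ev (δ x / y) z = v z * (deriv (φ.ev x) z / φ.ev y z) := by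
    have h3 : ∀ᶠ z in 𝓝[≠] (0 : ℂ), φ.ev (δ x / y) z = φ.ev (δ x) z / φ.ev y z :=
      Germ.coe_eq.mp (φ.germHom_div (δ x) y)
    filter_upwards [h3, hv.2 x] with z h4 h5
    rw [h4, h5, mul_div_assoc]
  filter_upwards [h1, h2, hv.2 (δ x / y), φ.eventually_deriv_ev_eq h2, hv.2 x, hv.2 E.a₂,
    hv.2 E.a₄, hv.2 E.a₆, φ.eventually_ev_ne_zero hy] with z h1 h2 h3 h4 h5 h6 h7 h8 h9
  rw [h1, h3, h4, h2, h5, h6, h7, h8, PathData.deltaF]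
  congr 3
  push_cast
  field_simp

/-- Along every arc, the Manin map has the value given by the primitive of `L(dx/y)`. -/
theorem Arc.eventually_applyL_branch [E.IsCharNeTwoNF] (hv : φ.Represents δ v)
    (hP : E.toAffine.Equation x y) (hy : y ≠ 0) {A B C : K} {S : K[X]} (hS4 : S.natDegree ≤ 4)
    (hS : 2 * cubic E * Polynomial.derivative S - 3 * Polynomial.derivative (cubic E) * S =
        2 * numeratorL δ E A B C) :
    ∀ᶠ z₁ in 𝓝[≠] (0 : ℂ),
    (∃ X₀ Y₀ : ℝ → ℂ, IsFibrePath (φ.fibre E z₁) (φ.ev x z₁) (φ.ev y z₁) X₀ Y₀) ∧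
    (∀ X₀ Y₀ : ℝ → ℂ, IsFibrePath (φ.fibre E z₁) (φ.ev x z₁) (φ.ev y z₁) X₀ Y₀ →
      ∃ X Y w, IsBranch φ E x y z₁ X Y w ∧
        EqOn (X z₁) X₀ (Ioc 0 1) ∧ EqOn (Y z₁) Y₀ (Ioc 0 1)) ∧
    ∀ X Y w, IsBranch φ E x y z₁ X Y w →
      φ.applyL v A B C w z₁ = φ.ev (maninValue δ E A B S x y) z₁ := by
  filter_upwards [eventually_exists_isGoodSet (φ := φ) hv.1 hP hy,
    eventually_specialize_primitive hv hS4 hS, eventually_ev_maninValue hv hy A B hS4]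
    with z ⟨U, hzU, hU, hvU⟩ ⟨T, hT4, hTeval, hT⟩ hm
  refine ⟨hU.exists_isFibrePath hzU, fun X₀ Y₀ h => hU.exists_isBranch hzU h,
    fun X Y w hw => ?_⟩
  rw [hU.applyL_branch hvU hzU hw hT4 hT, hm, hTeval]

/-- For uniqueness, some arc, with a path and a branch over it, makes the condition non-vacuous and
fixes the germ of `m`, and the field homomorphism to germs is injective. For existence, the formula
holds on every branch along every arc. -/
theorem isManinValue_iff (hfg : (⊤ : IntermediateField ℂ K).FG) (htr : Algebra.trdeg ℂ K = 1)
    [E.IsCharNeTwoNF] (hP : E.toAffine.Equation x y) (hy : y ≠ 0) {A B C : K} {S : K[X]}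
    (hS4 : S.natDegree ≤ 4)
    (hS : 2 * cubic E * Polynomial.derivative S - 3 * Polynomial.derivative (cubic E) * S =
        2 * numeratorL δ E A B C) (m : K) :
    IsManinValue δ E A B C x y m ↔ m = maninValue δ E A B S x y := by
  obtain ⟨t, ht, halg⟩ := exists_transcendental_of_trdeg htr
  constructor
  · intro h
    obtain ⟨φ⟩ := nonempty_arc hfg ht halg
    obtain ⟨v, hv, hm⟩ := h φ
    refine φ.eq_of_eventually_ev_eq ?_
    filter_upwards [hm, Arc.eventually_applyL_branch hv hP hy hS4 hS] with z h₁ h₂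
    obtain ⟨X₀, Y₀, hpath⟩ := h₁.1
    obtain ⟨X, Y, w, hw, -⟩ := h₁.2.1 X₀ Y₀ hpath
    rw [← h₁.2.2 X Y w hw, h₂.2.2 X Y w hw]
  · rintro rfl φ
    obtain ⟨v, hv⟩ := φ.exists_represents δ ht halg
    exact ⟨v, hv, Arc.eventually_applyL_branch hv hP hy hS4 hS⟩

end Main

end ManinMap

end

theorem mainTheorem7 {K : Type*} [Field K] [Algebra ℂ K]
    -- `K` is the function field of a smooth projective complex curve
    (hfg : (⊤ : IntermediateField ℂ K).FG) (htr : Algebra.trdeg ℂ K = 1)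
    -- `E : y² = x³ + a₂ x² + a₄ x + a₆`
    (E : WeierstrassCurve K) [E.IsElliptic] [E.IsCharNeTwoNF]
    (δ : Derivation ℂ K K) (hδ : δ ≠ 0) (A B C : K)
    (F : E.toAffine.FunctionField) (hF : ManinMap.IsExactWith δ E A B C F)
    -- `P = (x, y)`
    (x y : K) (hP : E.toAffine.Equation x y) (hy : y ≠ 0) :
    (∃ FP : K, ManinMap.HasValueAt E F x y FP) ∧
    (∃ FO : K, ManinMap.HasValueAtO E F FO) ∧
    ∀ FP FO : K, ManinMap.HasValueAt E F x y FP → ManinMap.HasValueAtO E F FO →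
      ∀ m : K, ManinMap.IsManinValue δ E A B C x y m ↔
        m = FP - FO +
          A * (δ x * (-ManinMap.deltaCubic δ E x) / (2 * y ^ 3) + δ (δ x / y)) +
          B * (δ x / y) := by
  obtain ⟨α, S, hS4, hFS, hS⟩ := ManinMap.exists_primitive_shape δ E hF
  have hFP := ManinMap.hasValueAt_of_mul_pow_eq E (x := x) hy hFS
  have hFO := ManinMap.hasValueAtO_of_mul_pow_eq E hS4 hFS
  refine ⟨⟨_, hFP⟩, ⟨_, hFO⟩, fun FP FO h₁ h₂ m => ?_⟩
  -- Values are unique, so `FP` and `FO` are `α + S(x)/y³` and `α`; the constant `α` cancels.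
  rw [h₁.unique hP hFP, h₂.unique hFO, add_sub_cancel_left]
  exact ManinMap.isManinValue_iff hfg htr hP hy hS4 hS m
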